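/- Fix a dimension $d$. A polygonal curve $P=\langle p_1,\dots,p_n\rangle$ with $n\ge 1$ vertices in $\mathbb R^d$ is the continuous map $P:[1,n]\to\mathbb R^d$ with $P(i+\lambda)=(1-\lambda)p_i+\lambda p_{i+1}$ for integers $1\le i<n$ and $0\le\lambda\le 1$. The Fréchet distance of two polygonal curves $P,Q$ with $n$ and $m$ vertices is $$\delta_F(P,Q)=\inf_{(\sigma,\theta)}\ \max_{0\le t\le 1}\|P(\sigma(t))-Q(\theta(t))\|,$$ where $\sigma:[0,1]\to[1,n]$ and $\theta:[0,1]\to[1,m]$ range over the continuous non-decreasing functions with $\sigma(0)=\theta(0)=1$, $\sigma(1)=n$, $\theta(1)=m$. For $\delta>0$, the vertex-restricted min-# simplification problem under the global Fréchet distance asks, given $P$ and $\delta$, for indices $1=s_1<s_2<\dots<s_k=n$ such that $P'=\langle p_{s_1},\dots,p_{s_k}\rangle$ satisfies $\delta_F(P,P')\le\delta$ and $k$ is minimum. The real RAM is a random access machine with registers and memory cells for exact real numbers (unit-cost $+,-,\cdot,/,\sqrt{\ }$, comparisons; no rounding) and for integers of $O(\log n)$ bits (unit-cost arithmetic, comparisons,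 indirect addressing). The EREW PRAM consists of synchronous processors of this kind, all running the same program on a shared memory, no two of which may access the same memory cell in the same step; their number may depend on $n$. Space is the number of memory cells used plus the number of processors. The constants in the bounds below depend only on $d$. **Theorem.** (1) There is a real RAM program that, for every polygonal curve $P$ with $n$ vertices in $\mathbb R^d$ and every $\delta>0$, solves the vertex-restricted min-# simplification problem under the global Fréchet distance exactly, in $O(n^4)$ time using $O(n^3)$ space. (2) There is an EREW PRAM program that, for every polygonal curve $P$ with $n$ vertices in $\mathbb R^d$ and every $\delta>0$, solves the same problem exactly, in $O(n^3)$ time using $O(n^4/\log n)$ space (with $\log(n+1)$ in place of $\log n$, so that the bound makes sense for $n=1$). -/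

import Mathlib

/-! ### Polygonal curves, Fréchet distance, vertex-restricted simplification -/

namespace CurveSimp

/-- `ℝ^d` with the Euclidean norm. -/
abbrev Pt (d : ℕ) : Type := EuclideanSpace ℝ (Fin d)

/-- The `i`-th vertex (counted from `0`). The value `0` for `i ≥ n` only ever enters `polyline`
with coefficient `0` on the parameter interval `[0, n - 1]`. -/
noncomputable def vertex {d n : ℕ} (p : Fin n → Pt d) (i : ℕ) : Pt d :=
  if h : i < n then p ⟨i, h⟩ else 0

/-- The polygonal curve with vertices `p 0, …, p (n - 1)`, parametrized over `[0, n - 1]`: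
it takes the value `(1 - λ) p_i + λ p_{i+1}` at `i + λ`, `0 ≤ λ < 1`. -/
noncomputable def polyline {d n : ℕ} (p : Fin n → Pt d) (x : ℝ) : Pt d :=
  (1 - (x - (⌊x⌋₊ : ℝ))) • vertex p ⌊x⌋₊ + (x - (⌊x⌋₊ : ℝ)) • vertex p (⌊x⌋₊ + 1)

/-- Re-parametrizations of a polygonal curve with `n` vertices: continuous non-decreasing maps of
`[0, 1]` onto the parameter interval `[0, n - 1]`. -/
structure IsReparam (n : ℕ) (σ : ℝ → ℝ) : Prop where
  continuousOn : ContinuousOn σ (Set.Icc 0 1)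
  monotoneOn : MonotoneOn σ (Set.Icc 0 1)
  map_zero : σ 0 = 0
  map_one : σ 1 = (n : ℝ) - 1

/-- `w` is the width `max_{0 ≤ t ≤ 1} ‖P(σ(t)) - Q(θ(t))‖` of the matching `(σ, θ)`. -/
def IsWidth {d n m : ℕ} (p : Fin n → Pt d) (q : Fin m → Pt d) (σ θ : ℝ → ℝ) (w : ℝ) : Prop :=
  IsGreatest ((fun t => ‖polyline p (σ t) - polyline q (θ t)‖) '' Set.Icc 0 1) w

/-- The (global) Fréchet distance between two polygonal curves: the infimum of the widths of all
matchings. -/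
noncomputable def frechetDist {d n m : ℕ} (p : Fin n → Pt d) (q : Fin m → Pt d) : ℝ :=
  sInf {w : ℝ | ∃ σ θ : ℝ → ℝ, IsReparam n σ ∧ IsReparam m θ ∧ IsWidth p q σ θ w}

/-- `s 0 < … < s (k - 1)` are the indices of a subsequence of the `n` vertices that contains
the first and the last vertex. -/
def IsVertexSelection {n k : ℕ} (s : Fin k → Fin n) : Prop :=
  StrictMono s ∧ ∃ hk : 0 < k,
    (s ⟨0, hk⟩ : ℕ) = 0 ∧ (s ⟨k - 1, Nat.sub_lt hk Nat.one_pos⟩ : ℕ) + 1 = n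

/-- `p ∘ s` is a vertex-restricted simplification of `p` within global Fréchet distance `δ`. -/
def IsSimplification {d n k : ℕ} (p : Fin n → Pt d) (δ : ℝ) (s : Fin k → Fin n) : Prop :=
  IsVertexSelection s ∧ frechetDist p (p ∘ s) ≤ δ

/-- `p ∘ s` is a vertex-restricted simplification within global Fréchet distance `δ` that has the
minimum number of vertices. -/
def IsMinSimplification {d n k : ℕ} (p : Fin n → Pt d) (δ : ℝ) (s : Fin k → Fin n) : Prop :=
  IsSimplification p δ s ∧
    ∀ (k' : ℕ) (s' : Fin k' → Fin n), IsSimplification p δ s' → k ≤ k'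

end CurveSimp

/-! ### Real RAM and EREW PRAM

A machine has finitely many synchronous processors that run the same program. Each has private
registers (a program names only finitely many of them) and the machine has a shared memory that is
addressed indirectly. Registers and memory come in two sorts, natural numbers (indices, addresses,
counters) and exact real numbers; there is no conversion from reals to naturals other than by
branching on comparisons. With one processor this is the real RAM. -/

namespace RealPRAM

inductive NatOp
  | add | sub | mul | div

/-- Subtraction is truncated at `0`, division is rounded down. -/
def NatOp.eval : NatOp → ℕ → ℕ → ℕ
  | .add, a, b => a + b
  | .sub, a, b => a - b
  | .mul, a, b => a * b
  | .div, a, b => a / b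

inductive RealOp
  | add | sub | mul | div

/-- Division by `0` returns `0`; a program can test for it beforehand. -/
noncomputable def RealOp.eval : RealOp → ℝ → ℝ → ℝ
  | .add, a, b => a + b
  | .sub, a, b => a - b
  | .mul, a, b => a * b
  | .div, a, b => a / b

/-- Elementary instructions. The first argument of a register instruction is the target. -/
inductive Instr
  /-- load a natural constant -/
  | natConst (r c : ℕ)
  | natOp (o : NatOp) (r a b : ℕ)
  /-- load a rational constant -/
  | realConst (r : ℕ) (c : ℚ)
  | realOp (o : RealOp) (r a b : ℕ)
  | realSqrt (r a : ℕ)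
  /-- copy natural register `a` into real register `r` -/
  | cast (r a : ℕ)
  /-- natural register `r` := natural memory cell whose address is in natural register `a` -/
  | natLoad (r a : ℕ)
  /-- natural memory cell whose address is in natural register `a` := natural register `r` -/
  | natStore (a r : ℕ)
  /-- real register `r` := real memory cell whose address is in natural register `a` -/
  | realLoad (r a : ℕ)
  /-- real memory cell whose address is in natural register `a` := real register `r` -/
  | realStore (a r : ℕ)

/-- Tests compare two registers of the same sort. -/
inductive Test
  | natLt (a b : ℕ)
  | natLe (a b : ℕ)
  | realLt (a b : ℕ)
  | realLe (a b : ℕ)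

inductive Prog
  | instr (c : Instr)
  | seq (p q : Prog)
  | ite (b : Test) (p q : Prog)
  | loop (b : Test) (p : Prog)

/-- State of one processor: what remains to be executed (the current statement first), the
natural registers, and the real registers. -/
structure ProcState where
  control : List Prog
  nreg : ℕ → ℕ
  rreg : ℕ → ℝ

/-- Shared memory. -/
structure Memory where
  nat : ℕ → ℕ
  real : ℕ → ℝ

/-- A cell of the shared memory. -/
inductive Cell
  | nat (a : ℕ)
  | real (a : ℕ)

def Cell.addr : Cell → ℕ
  | .nat a => a
  | .real a => a

def Test.Holds (s : ProcState) : Test → Prop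
  | .natLt a b => s.nreg a < s.nreg b
  | .natLe a b => s.nreg a ≤ s.nreg b
  | .realLt a b => s.rreg a < s.rreg b
  | .realLe a b => s.rreg a ≤ s.rreg b

/-- Effect of an instruction on the registers of the processor that executes it. -/
noncomputable def Instr.exec (m : Memory) (s : ProcState) : Instr → ProcState
  | .natConst r c => { s with nreg := Function.update s.nreg r c }
  | .natOp o r a b => { s with nreg := Function.update s.nreg r (o.eval (s.nreg a) (s.nreg b)) }
  | .realConst r c => { s with rreg := Function.update s.rreg r (c : ℝ) }
  | .realOp o r a b => { s with rreg := Function.update s.rreg r (o.eval (s.rreg a) (s.rreg b)) }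
  | .realSqrt r a => { s with rreg := Function.update s.rreg r (Real.sqrt (s.rreg a)) }
  | .cast r a => { s with rreg := Function.update s.rreg r (s.nreg a : ℝ) }
  | .natLoad r a => { s with nreg := Function.update s.nreg r (m.nat (s.nreg a)) }
  | .natStore _ _ => s
  | .realLoad r a => { s with rreg := Function.update s.rreg r (m.real (s.nreg a)) }
  | .realStore _ _ => s

open Classical in
/-- One step of a processor, as far as its own state is concerned. Every instruction, every test
and every unfolding of a sequential composition takes one step. -/
noncomputable def ProcState.next (m : Memory) (s : ProcState) : ProcState :=
  match s.control with
  | [] => s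
  | .instr c :: K => c.exec m { s with control := K }
  | .seq p q :: K => { s with control := p :: q :: K }
  | .ite b p q :: K => { s with control := (if b.Holds s then p else q) :: K }
  | .loop b p :: K => { s with control := if b.Holds s then p :: .loop b p :: K else K }

/-- The shared cell (if any) that a processor reads or writes in its next step. -/
def ProcState.access (s : ProcState) : Option Cell :=
  match s.control with
  | .instr (.natLoad _ a) :: _ => some (.nat (s.nreg a))
  | .instr (.natStore a _) :: _ => some (.nat (s.nreg a))
  | .instr (.realLoad _ a) :: _ => some (.real (s.nreg a))
  | .instr (.realStore a _) :: _ => some (.real (s.nreg a))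
  | _ => none

/-- The value that a processor writes into natural cell `x` in its next step, if it does. -/
def ProcState.natWrite (s : ProcState) (x : ℕ) : Option ℕ :=
  match s.control with
  | .instr (.natStore a r) :: _ => if s.nreg a = x then some (s.nreg r) else none
  | _ => none

/-- The value that a processor writes into real cell `x` in its next step, if it does. -/
def ProcState.realWrite (s : ProcState) (x : ℕ) : Option ℝ :=
  match s.control with
  | .instr (.realStore a r) :: _ => if s.nreg a = x then some (s.rreg r) else none
  | _ => none

/-- Configuration of a machine with `N` processors. -/
structure Config (N : ℕ) where
  proc : Fin N → ProcState
  mem : Memory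

/-- One synchronous step of the whole machine. Simultaneous writes into one cell, for which the
lowest-numbered processor would win here, are excluded by `Config.Exclusive`. -/
noncomputable def Config.step {N : ℕ} (c : Config N) : Config N where
  proc i := (c.proc i).next c.mem
  mem :=
    { nat := fun x =>
        ((List.finRange N).findSome? fun i => (c.proc i).natWrite x).getD (c.mem.nat x)
      real := fun x =>
        ((List.finRange N).findSome? fun i => (c.proc i).realWrite x).getD (c.mem.real x) }

/-- Exclusive read, exclusive write: no two processors access the same cell in the next step. -/
def Config.Exclusive {N : ℕ} (c : Config N) : Prop :=
  ∀ i j : Fin N, i ≠ j → ∀ x : Cell, (c.proc i).access = some x → (c.proc j).access ≠ some x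

/-- Only cells with addresses below `M` are accessed in the next step. -/
def Config.Within {N : ℕ} (c : Config N) (M : ℕ) : Prop :=
  ∀ (i : Fin N) (x : Cell), (c.proc i).access = some x → x.addr < M

/-- All natural numbers that are stored anywhere are at most `W` (bounded word size). -/
def Config.WordBounded {N : ℕ} (c : Config N) (W : ℕ) : Prop :=
  (∀ (i : Fin N) (r : ℕ), (c.proc i).nreg r ≤ W) ∧ ∀ x : ℕ, c.mem.nat x ≤ W

def Config.Halted {N : ℕ} (c : Config N) : Prop :=
  ∀ i : Fin N, (c.proc i).control = []

end RealPRAM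

/-! ### Solving the simplification problem on such a machine -/

namespace CurveSimp

open RealPRAM

/-- Start configuration on input `(p, δ)`: real cell `i * d + j` holds coordinate `j` of vertex
`i`, real cell `n * d` holds `δ`, everything else in memory is `0`; each processor has `n` in natural
register `0`, its own number in natural register `1`, and `0` in its other registers. -/
noncomputable def startConfig {d n : ℕ} (prog : Prog) (N : ℕ) (p : Fin n → Pt d) (δ : ℝ) :
    Config N where
  proc i :=
    { control := [prog]
      nreg := fun r => if r = 0 then n else if r = 1 then (i : ℕ) else 0
      rreg := fun _ => 0 }
  mem :=
    { nat := fun _ => 0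
      real := fun a =>
        if h : a < n * d then
          p ⟨a / d, Nat.div_lt_of_lt_mul (by rwa [Nat.mul_comm] at h)⟩
            ⟨a % d, Nat.mod_lt a (Nat.pos_of_mul_pos_left (Nat.lt_of_le_of_lt a.zero_le h))⟩
        else if a = n * d then δ else 0 }

/-- The memory holds an optimal simplification: its number `k` of vertices in natural cell `0` and
the indices `s 0 < … < s (k - 1)` of its vertices in natural cells `1, …, k`. -/
def OutputCorrect {d n : ℕ} (p : Fin n → Pt d) (δ : ℝ) (m : Memory) : Prop :=
  ∃ s : Fin (m.nat 0) → Fin n,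
    (∀ i : Fin (m.nat 0), m.nat ((i : ℕ) + 1) = (s i : ℕ)) ∧ IsMinSimplification p δ s

/-- Started on `(p, δ)` with `N` processors, `prog` halts after `T` synchronous steps with a
correct output. All accesses are exclusive and to memory cells with addresses below `M`, among which
are the input cells, and all natural numbers are at most `W`. -/
def Solves {d n : ℕ} (prog : Prog) (N : ℕ) (p : Fin n → Pt d) (δ : ℝ) (T M W : ℕ) : Prop :=
  (Config.step^[T] (startConfig prog N p δ)).Halted ∧
  OutputCorrect p δ (Config.step^[T] (startConfig prog N p δ)).mem ∧
  n * d + 1 ≤ M ∧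
  ∀ t ≤ T,
    (Config.step^[t] (startConfig prog N p δ)).Exclusive ∧
    (Config.step^[t] (startConfig prog N p δ)).Within M ∧
    (Config.step^[t] (startConfig prog N p δ)).WordBounded W

end CurveSimp

/-! ### A small imperative language for the machine with one processor -/

/-! Both statements follow from one sequential program that takes cubic time and cubic space. Cubic
time lies within `O(n ^ 4)`, and on a machine with a single processor cubic space lies within `O(n ^
4 / log (n + 1))`, because `log (n + 1) ≤ n`.

Geometry. Consider the parameter rectangle of the curve and a subsequence of its vertices. In the
cell of two edges the free space is convex, so two free points that are ordered in both coordinates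
are joined by a monotone path (`Joined.cell`). Hence a simplification amounts to a chain of links
between pairs (vertex `i` of the subsequence, edge `j` of the curve on which its partner lies). If a
link leads from edge `j'` to a later edge `j`, it only requires nondecreasing heights in the free
intervals above the vertices `j' + 1, …, j`; the two partners may be any free points of their edges.
If the edge stays the same, the partners must be in order. `isSimplification_of_links` builds a
matching from a chain. For the converse, `exists_links`, the infimum in the Fréchet distance must be
shown to be attained: a matching of width at most `D` leaves a certificate consisting of finitely
many discrete choices and bounded real parameters subject to closed conditions, so compactness
allows `D` to decrease to `δ`.

Shortest chains. The position of a partner matters only as long as a chain stays on one edge. There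
an exchange argument applies: every later vertex matched on this edge can be linked directly to the
vertex with which the edge was entered, matched at its lowest free point. So it suffices to keep two
values for each pair `(i, j)`, one for chains that enter edge `j` along their last link and one for
all chains (`cost_le_of_links`, `isMinSimplification_of_pred`). A value encodes the length of a
chain together with the predecessor.

Time. For each of the `O(n ^ 2)` segments from `i'` to `i` and for every `j`, the best entry `j' <
j` from which the strip can be traversed is needed. A queue that is sorted by height and by value
has this entry at its head (`IsPassed.head_le_iff`), and it costs amortized constant time per
vertex, which gives `O(n ^ 3)` in total.

Implementation. The program is written in a small language with expressions and loops that is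
compiled to the machine. `Cmd.WP` bounds running time, addresses and word size along with functional
correctness. -/

namespace RealPRAM

/-- The data of a machine with one processor. -/
structure Store where
  nreg : ℕ → ℕ
  rreg : ℕ → ℝ
  nmem : ℕ → ℕ
  rmem : ℕ → ℝ

/-- The one-processor configuration with data `s` and remaining program `K`. -/
def Store.config (s : Store) (K : List Prog) : Config 1 where
  proc _ := ⟨K, s.nreg, s.rreg⟩
  mem := ⟨s.nmem, s.rmem⟩

/-- Effect of an instruction on the data of a machine with one processor. -/
noncomputable def Instr.run (s : Store) : Instr → Store
  | .natConst r c => { s with nreg := Function.update s.nreg r c }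
  | .natOp o r a b => { s with nreg := Function.update s.nreg r (o.eval (s.nreg a) (s.nreg b)) }
  | .realConst r c => { s with rreg := Function.update s.rreg r (c : ℝ) }
  | .realOp o r a b => { s with rreg := Function.update s.rreg r (o.eval (s.rreg a) (s.rreg b)) }
  | .realSqrt r a => { s with rreg := Function.update s.rreg r (Real.sqrt (s.rreg a)) }
  | .cast r a => { s with rreg := Function.update s.rreg r (s.nreg a : ℝ) }
  | .natLoad r a => { s with nreg := Function.update s.nreg r (s.nmem (s.nreg a)) }
  | .natStore a r => { s with nmem := Function.update s.nmem (s.nreg a) (s.nreg r) }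
  | .realLoad r a => { s with rreg := Function.update s.rreg r (s.rmem (s.nreg a)) }
  | .realStore a r => { s with rmem := Function.update s.rmem (s.nreg a) (s.rreg r) }

/-- All addresses used by an instruction are below `M`. -/
def Instr.Local (M : ℕ) (s : Store) : Instr → Prop
  | .natLoad _ a => s.nreg a < M
  | .natStore a _ => s.nreg a < M
  | .realLoad _ a => s.nreg a < M
  | .realStore a _ => s.nreg a < M
  | _ => True

def Store.Bounded (W : ℕ) (s : Store) : Prop :=
  (∀ r, s.nreg r ≤ W) ∧ ∀ x, s.nmem x ≤ W

def Test.On (s : Store) : Test → Prop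
  | .natLt a b => s.nreg a < s.nreg b
  | .natLe a b => s.nreg a ≤ s.nreg b
  | .realLt a b => s.rreg a < s.rreg b
  | .realLe a b => s.rreg a ≤ s.rreg b

theorem getD_ite_eq_update {α : Type*} (f : ℕ → α) (a : ℕ) (v : α) (x : ℕ) :
    (if a = x then some v else none).getD (f x) = Function.update f a v x := by
  by_cases h : a = x
  · subst h; simp
  · simp [h, Ne.symm h]

/-- With one processor the search for the writer of a cell reduces to a single candidate, so a step
is a `Function.update`. -/
theorem step_instr (s : Store) (c : Instr) (K : List Prog) :
    (s.config (.instr c :: K)).step = (c.run s).config K := by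
  cases c <;>
    simp [Store.config, Config.step, ProcState.next, Instr.exec, Instr.run, ProcState.natWrite,
      ProcState.realWrite, List.finRange_succ] <;>
    exact funext fun x => getD_ite_eq_update _ _ _ x

theorem step_seq (s : Store) (p q : Prog) (K : List Prog) :
    (s.config (.seq p q :: K)).step = s.config (p :: q :: K) := by
  simp [Store.config, Config.step, ProcState.next, ProcState.natWrite, ProcState.realWrite,
    List.finRange_succ]

open Classical in
theorem step_ite (s : Store) (b : Test) (p q : Prog) (K : List Prog) :
    (s.config (.ite b p q :: K)).step = s.config ((if b.On s then p else q) :: K) := by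
  cases b <;>
    simp [Store.config, Config.step, ProcState.next, ProcState.natWrite, ProcState.realWrite,
      List.finRange_succ, Test.Holds, Test.On] <;> rfl

open Classical in
theorem step_loop (s : Store) (b : Test) (p : Prog) (K : List Prog) :
    (s.config (.loop b p :: K)).step =
      s.config (if b.On s then p :: .loop b p :: K else K) := by
  cases b <;>
    simp [Store.config, Config.step, ProcState.next, ProcState.natWrite, ProcState.realWrite,
      List.finRange_succ, Test.Holds, Test.On] <;> rfl

/-! ### Runs of the machine with one processor -/

/-- All accesses of the next step are exclusive and below `M`, and all words are at most `W`. -/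
def Config.Good {N : ℕ} (M W : ℕ) (c : Config N) : Prop :=
  c.Exclusive ∧ c.Within M ∧ c.WordBounded W

/-- From `c` the machine gets to `c'` in `t` steps, before each of which it is in a good state. -/
def Leads (M W : ℕ) (c c' : Config 1) (t : ℕ) : Prop :=
  Config.step^[t] c = c' ∧ ∀ u < t, (Config.step^[u] c).Good M W

theorem Leads.trans {M W : ℕ} {c c' c'' : Config 1} {t u : ℕ} (h : Leads M W c c' t)
    (h' : Leads M W c' c'' u) : Leads M W c c'' (t + u) := by
  refine ⟨by rw [Nat.add_comm, Function.iterate_add_apply, h.1, h'.1], fun v hv => ?_⟩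
  by_cases hvt : v < t
  · exact h.2 v hvt
  · obtain ⟨w, rfl⟩ := Nat.exists_eq_add_of_le (not_lt.1 hvt)
    rw [Nat.add_comm, Function.iterate_add_apply, h.1]
    exact h'.2 w (by omega)

theorem Leads.one {M W : ℕ} {c c' : Config 1} (h : c.Good M W) (hs : c.step = c') :
    Leads M W c c' 1 :=
  ⟨hs, fun u hu => by obtain rfl : u = 0 := by omega
                      exact h⟩

/-- Exclusiveness is vacuous for one processor, so only the address used by the current instruction
has to be checked. -/
theorem good_config {M W : ℕ} {s : Store} (hs : s.Bounded W) {K : List Prog}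
    (h : ∀ c K', K = .instr c :: K' → c.Local M s) : (s.config K).Good M W := by
  refine ⟨fun i j hij => absurd (Subsingleton.elim i j) hij, fun i x hx => ?_, fun i => hs.1, hs.2⟩
  rcases K with _ | ⟨_ | _ | _ | _, K⟩ <;> simp [Store.config, ProcState.access] at hx
  rename_i c
  have := h c K rfl
  cases c <;> simp at hx <;> subst hx <;> exact this

/-- `p` transforms `s` into `s'` in `t` steps. -/
def Exec (M W : ℕ) (p : Prog) (s s' : Store) (t : ℕ) : Prop :=
  ∀ K, Leads M W (s.config (p :: K)) (s'.config K) t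

theorem Exec.instr {M W : ℕ} {c : Instr} {s : Store} (hs : s.Bounded W) (h : c.Local M s) :
    Exec M W (.instr c) s (c.run s) 1 := fun K =>
  Leads.one (good_config hs (by rintro c' K' ⟨⟩; exact h)) (step_instr s c K)

theorem Exec.seq {M W : ℕ} {p q : Prog} {s s' s'' : Store} {t u : ℕ} (hs : s.Bounded W)
    (h : Exec M W p s s' t) (h' : Exec M W q s' s'' u) : Exec M W (.seq p q) s s'' (1 + (t + u)) :=
  fun K => (Leads.one (good_config hs (by rintro c' K' ⟨⟩)) (step_seq s p q K)).trans
    ((h _).trans (h' K))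

theorem Exec.ite_pos {M W : ℕ} {b : Test} {p q : Prog} {s s' : Store} {t : ℕ} (hs : s.Bounded W)
    (hb : b.On s) (h : Exec M W p s s' t) : Exec M W (.ite b p q) s s' (1 + t) := fun K =>
  (Leads.one (good_config hs (by rintro c' K' ⟨⟩)) (by rw [step_ite, if_pos hb])).trans (h K)

theorem Exec.ite_neg {M W : ℕ} {b : Test} {p q : Prog} {s s' : Store} {t : ℕ} (hs : s.Bounded W)
    (hb : ¬ b.On s) (h : Exec M W q s s' t) : Exec M W (.ite b p q) s s' (1 + t) := fun K =>
  (Leads.one (good_config hs (by rintro c' K' ⟨⟩)) (by rw [step_ite, if_neg hb])).trans (h K)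

theorem Exec.loop_done {M W : ℕ} {b : Test} {p : Prog} {s : Store} (hs : s.Bounded W)
    (hb : ¬ b.On s) : Exec M W (.loop b p) s s 1 := fun K =>
  Leads.one (good_config hs (by rintro c' K' ⟨⟩)) (by rw [step_loop, if_neg hb])

theorem Exec.loop_step {M W : ℕ} {b : Test} {p : Prog} {s s' s'' : Store} {t u : ℕ}
    (hs : s.Bounded W) (hb : b.On s) (h : Exec M W p s s' t) (h' : Exec M W (.loop b p) s' s'' u) :
    Exec M W (.loop b p) s s'' (1 + (t + u)) := fun K =>
  (Leads.one (good_config hs (by rintro c' K' ⟨⟩)) (by rw [step_loop, if_pos hb])).trans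
    ((h _).trans (h' K))

theorem Store.Bounded.update {W : ℕ} {s : Store} (hs : s.Bounded W) (r : ℕ) {v : ℕ} (hv : v ≤ W) :
    Store.Bounded W { s with nreg := Function.update s.nreg r v } := by
  refine ⟨fun x => ?_, hs.2⟩
  by_cases h : x = r
  · subst h; simpa using hv
  · simpa [h] using hs.1 x

theorem Store.Bounded.updateMem {W : ℕ} {s : Store} (hs : s.Bounded W) (r : ℕ) {v : ℕ}
    (hv : v ≤ W) : Store.Bounded W { s with nmem := Function.update s.nmem r v } := by
  refine ⟨hs.1, fun x => ?_⟩
  by_cases h : x = r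
  · subst h; simpa using hv
  · simpa [h] using hs.2 x

/-! #### Expressions -/

/-- Number of registers of either sort that hold variables; the others are temporary. -/
abbrev numVars : ℕ := 32

/-- Values of the variables and of the memory. -/
structure State where
  n : Fin numVars → ℕ
  r : Fin numVars → ℝ
  nm : ℕ → ℕ
  rm : ℕ → ℝ

/-- The state that a store represents. -/
def Store.state (s : Store) : State where
  n x := s.nreg x
  r x := s.rreg x
  nm := s.nmem
  rm := s.rmem

/-- Expressions with natural values. -/
inductive NExp
  | var (x : Fin numVars)
  | const (c : ℕ)
  | op (o : NatOp) (a b : NExp)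
  | load (a : NExp)

/-- Expressions with real values. -/
inductive RExp
  | var (x : Fin numVars)
  | const (c : ℚ)
  | op (o : RealOp) (a b : RExp)
  | sqrt (a : RExp)
  | load (a : NExp)

def NExp.val (s : State) : NExp → ℕ
  | .var x => s.n x
  | .const c => c
  | .op o a b => o.eval (a.val s) (b.val s)
  | .load a => s.nm (a.val s)

noncomputable def RExp.val (s : State) : RExp → ℝ
  | .var x => s.r x
  | .const c => c
  | .op o a b => o.eval (a.val s) (b.val s)
  | .sqrt a => Real.sqrt (a.val s)
  | .load a => s.rm (a.val s)

/-- All intermediate values are at most `W` and all addresses are below `M`. -/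
def NExp.Safe (M W : ℕ) (s : State) : NExp → Prop
  | .var _ => True
  | .const c => c ≤ W
  | .op o a b => a.Safe M W s ∧ b.Safe M W s ∧ o.eval (a.val s) (b.val s) ≤ W
  | .load a => a.Safe M W s ∧ a.val s < M

def RExp.Safe (M W : ℕ) (s : State) : RExp → Prop
  | .var _ => True
  | .const _ => True
  | .op _ a b => a.Safe M W s ∧ b.Safe M W s
  | .sqrt a => a.Safe M W s
  | .load a => a.Safe M W s ∧ a.val s < M

/-- Code that evaluates an expression into register `t`, with temporaries from `t` on. -/
def NExp.code : NExp → ℕ → Prog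
  | .var x, t => .seq (.instr (.natConst t 0)) (.instr (.natOp .add t x t))
  | .const c, t => .instr (.natConst t c)
  | .op o a b, t => .seq (a.code t) (.seq (b.code (t + 1)) (.instr (.natOp o t t (t + 1))))
  | .load a, t => .seq (a.code t) (.instr (.natLoad t t))

def RExp.code : RExp → ℕ → Prog
  | .var x, t => .seq (.instr (.realConst t 0)) (.instr (.realOp .add t x t))
  | .const c, t => .instr (.realConst t c)
  | .op o a b, t => .seq (a.code t) (.seq (b.code (t + 1)) (.instr (.realOp o t t (t + 1))))
  | .sqrt a, t => .seq (a.code t) (.instr (.realSqrt t t))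
  | .load a, t => .seq (a.code numVars) (.instr (.realLoad t numVars))

/-- Running time of loop-free code. -/
def Prog.cost : Prog → ℕ
  | .instr _ => 1
  | .seq p q => 1 + (p.cost + q.cost)
  | .ite _ p q => 1 + max p.cost q.cost
  | .loop _ _ => 1

/-- The temporaries form a stack: code for `t` leaves all registers below `t` alone, so the left
operand survives in `t` while the right one is evaluated from `t + 1` on. -/
theorem NExp.exec_code {M W : ℕ} (e : NExp) : ∀ (t : ℕ) (_ : numVars ≤ t) (s : Store)
    (_ : s.Bounded W) (_ : e.Safe M W s.state),
    ∃ f : ℕ → ℕ, (∀ r < t, f r = s.nreg r) ∧ f t = e.val s.state ∧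
      Store.Bounded W { s with nreg := f } ∧
      Exec M W (e.code t) s { s with nreg := f } (e.code t).cost := by
  induction e with
  | var x =>
    intro t ht s hs _
    have hx : (x : ℕ) ≠ t := by omega
    have h1 := Exec.instr (c := .natConst t 0) (M := M) hs trivial
    have b1 := hs.update t (Nat.zero_le W)
    have h2 := Exec.instr (c := .natOp .add t x t) (M := M) b1 trivial
    refine ⟨_, ?_, ?_, ?_, Exec.seq hs h1 h2⟩
    · intro r hr
      simp [Function.update_apply, hr.ne]
    · simp [NExp.val, NatOp.eval, Store.state, hx]
    · refine b1.update t ?_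
      simpa [NatOp.eval, Function.update_apply, hx] using hs.1 x
  | const c =>
    intro t ht s hs h
    refine ⟨_, ?_, ?_, hs.update t h, Exec.instr (c := .natConst t c) (M := M) hs trivial⟩
    · intro r hr; simp [hr.ne]
    · simp [NExp.val]
  | op o a b iha ihb =>
    intro t ht s hs ⟨ha, hb, hv⟩
    obtain ⟨f, f1, f2, f3, f4⟩ := iha t ht s hs ha
    have e1 : ({ s with nreg := f } : Store).state = s.state := by
      simp only [Store.state, State.mk.injEq, and_true]
      exact funext fun x => f1 _ (by omega)
    obtain ⟨g, g1, g2, g3, g4⟩ := ihb (t + 1) (by omega) { s with nreg := f } f3 (by rwa [e1])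
    have h5 := Exec.instr (c := .natOp o t t (t + 1)) (M := M) g3 trivial
    have hval : o.eval (g t) (g (t + 1)) = (NExp.op o a b).val s.state := by
      rw [g1 t (by omega), g2, e1]; simp [NExp.val, f2]
    refine ⟨Function.update g t (o.eval (g t) (g (t + 1))), ?_, ?_, ?_, Exec.seq hs f4 (Exec.seq f3 g4 h5)⟩
    · intro r hr
      rw [Function.update_of_ne hr.ne, g1 r (by omega)]; exact f1 r hr
    · simp [hval]
    · exact g3.update t (by rw [hval]; exact hv)
  | load a iha =>
    intro t ht s hs ⟨ha, hv⟩
    obtain ⟨f, f1, f2, f3, f4⟩ := iha t ht s hs ha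
    have h5 := Exec.instr (c := .natLoad t t) (M := M) f3
      (show f t < M by rw [f2]; exact hv)
    refine ⟨Function.update f t (s.nmem (f t)), ?_, ?_, ?_, Exec.seq hs f4 h5⟩
    · intro r hr
      rw [Function.update_of_ne hr.ne, f1 r hr]
    · simp [f2, NExp.val, Store.state]
    · exact f3.update t (hs.2 _)

/-- No natural value is pending inside a real expression, so every load may compute its address in
natural register `numVars`. Accordingly, natural registers are preserved only below `numVars`. -/
theorem RExp.exec_code {M W : ℕ} (e : RExp) : ∀ (t : ℕ) (_ : numVars ≤ t) (s : Store)
    (_ : s.Bounded W) (_ : e.Safe M W s.state),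
    ∃ (f : ℕ → ℕ) (g : ℕ → ℝ), (∀ r < numVars, f r = s.nreg r) ∧ (∀ r < t, g r = s.rreg r) ∧
      g t = e.val s.state ∧
      Store.Bounded W { s with nreg := f, rreg := g } ∧
      Exec M W (e.code t) s { s with nreg := f, rreg := g } (e.code t).cost := by
  induction e with
  | var x =>
    intro t ht s hs _
    have hx : (x : ℕ) ≠ t := by omega
    have h1 := Exec.instr (c := .realConst t 0) (M := M) hs trivial
    have h2 := Exec.instr (c := .realOp .add t x t) (M := M)
      (s := (Instr.realConst t 0).run s) hs trivial
    refine ⟨s.nreg, ((Instr.realOp .add t x t).run ((Instr.realConst t 0).run s)).rreg,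
      fun _ _ => rfl, ?_, ?_, hs, Exec.seq hs h1 h2⟩
    · intro r hr
      simp [Instr.run, Function.update_apply, hr.ne]
    · simp [RExp.val, RealOp.eval, Store.state, hx, Instr.run]
  | const c =>
    intro t ht s hs h
    refine ⟨s.nreg, ((Instr.realConst t c).run s).rreg, fun _ _ => rfl, ?_, ?_, hs,
      Exec.instr (c := .realConst t c) (M := M) hs trivial⟩
    · intro r hr; simp [Instr.run, hr.ne]
    · simp [Instr.run, RExp.val]
  | op o a b iha ihb =>
    intro t ht s hs ⟨ha, hb⟩
    obtain ⟨f, g, f0, f1, f2, f3, f4⟩ := iha t ht s hs ha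
    have e1 : ({ s with nreg := f, rreg := g } : Store).state = s.state := by
      simp only [Store.state, State.mk.injEq, and_true]
      exact ⟨funext fun x => f0 _ x.2, funext fun x => f1 _ (by omega)⟩
    obtain ⟨f', g', g0, g1, g2, g3, g4⟩ :=
      ihb (t + 1) (by omega) { s with nreg := f, rreg := g } f3 (by rwa [e1])
    have h5 := Exec.instr (c := .realOp o t t (t + 1)) (M := M) g3 trivial
    have hval : o.eval (g' t) (g' (t + 1)) = (RExp.op o a b).val s.state := by
      rw [g1 t (by omega), g2, e1]; simp [RExp.val, f2]
    refine ⟨f', Function.update g' t (o.eval (g' t) (g' (t + 1))), ?_, ?_, ?_, g3,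
      Exec.seq hs f4 (Exec.seq f3 g4 h5)⟩
    · intro r hr
      rw [g0 r hr]; exact f0 r hr
    · intro r hr
      rw [Function.update_of_ne hr.ne, g1 r (by omega)]; exact f1 r hr
    · simp [hval]
  | sqrt a iha =>
    intro t ht s hs ha
    obtain ⟨f, g, f0, f1, f2, f3, f4⟩ := iha t ht s hs ha
    have h5 := Exec.instr (c := .realSqrt t t) (M := M) f3 trivial
    refine ⟨f, Function.update g t (Real.sqrt (g t)), f0, ?_, ?_, f3, Exec.seq hs f4 h5⟩
    · intro r hr
      rw [Function.update_of_ne hr.ne, f1 r hr]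
    · simp [f2, RExp.val]
  | load a =>
    intro t ht s hs ⟨ha, hv⟩
    obtain ⟨f, f1, f2, f3, f4⟩ := a.exec_code numVars le_rfl s hs ha
    have h5 := Exec.instr (c := .realLoad t numVars) (M := M) f3
      (show f numVars < M by rw [f2]; exact hv)
    refine ⟨f, Function.update s.rreg t (s.rmem (f numVars)), f1, ?_, ?_, f3, Exec.seq hs f4 h5⟩
    · intro r hr
      rw [Function.update_of_ne hr.ne]
    · simp [f2, RExp.val, Store.state]

/-! #### Commands -/

inductive Cond
  | nlt (a b : NExp)
  | rlt (a b : RExp)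

def Cond.Holds (s : State) : Cond → Prop
  | .nlt a b => a.val s < b.val s
  | .rlt a b => a.val s < b.val s

def Cond.Safe (M W : ℕ) (s : State) : Cond → Prop
  | .nlt a b => a.Safe M W s ∧ b.Safe M W s
  | .rlt a b => a.Safe M W s ∧ b.Safe M W s

def Cond.code : Cond → Prog
  | .nlt a b => .seq (a.code numVars) (b.code (numVars + 1))
  | .rlt a b => .seq (a.code numVars) (b.code (numVars + 1))

def Cond.test : Cond → Test
  | .nlt _ _ => .natLt numVars (numVars + 1)
  | .rlt _ _ => .realLt numVars (numVars + 1)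

theorem Cond.exec_code {M W : ℕ} (c : Cond) (s : Store) (hs : s.Bounded W)
    (h : c.Safe M W s.state) : ∃ s' : Store, s'.Bounded W ∧ s'.state = s.state ∧
      (c.test.On s' ↔ c.Holds s.state) ∧ Exec M W c.code s s' c.code.cost := by
  cases c with
  | nlt a b =>
    obtain ⟨f, f1, f2, f3, f4⟩ := a.exec_code numVars le_rfl s hs h.1
    have e1 : ({ s with nreg := f } : Store).state = s.state := by
      simp only [Store.state, State.mk.injEq, and_true]
      exact funext fun x => f1 _ x.2
    obtain ⟨g, g1, g2, g3, g4⟩ := b.exec_code (numVars + 1) (by omega) _ f3 (by rw [e1]; exact h.2)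
    refine ⟨_, g3, ?_, ?_, Exec.seq hs f4 g4⟩
    · rw [← e1]
      simp only [Store.state, State.mk.injEq, and_true]
      exact funext fun x => g1 _ (by omega)
    · simp only [Cond.test, Test.On, Cond.Holds]
      rw [g2, g1 _ (by omega), e1]
      dsimp only
      rw [f2]
  | rlt a b =>
    obtain ⟨f, g, f0, f1, f2, f3, f4⟩ := a.exec_code numVars le_rfl s hs h.1
    have e1 : ({ s with nreg := f, rreg := g } : Store).state = s.state := by
      simp only [Store.state, State.mk.injEq, and_true]
      exact ⟨funext fun x => f0 _ x.2, funext fun x => f1 _ x.2⟩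
    obtain ⟨f', g', g0, g1, g2, g3, g4⟩ :=
      b.exec_code (numVars + 1) (by omega) _ f3 (by rw [e1]; exact h.2)
    refine ⟨_, g3, ?_, ?_, Exec.seq hs f4 g4⟩
    · rw [← e1]
      simp only [Store.state, State.mk.injEq, and_true]
      exact ⟨funext fun x => g0 _ x.2, funext fun x => g1 _ (by omega)⟩
    · simp only [Cond.test, Test.On, Cond.Holds]
      rw [g2, g1 _ (by omega), e1]
      dsimp only
      rw [f2]

inductive Cmd
  | skip
  | nset (x : Fin numVars) (e : NExp)
  | rset (x : Fin numVars) (e : RExp)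
  | nstore (a e : NExp)
  | rstore (a : NExp) (e : RExp)
  | seq (c c' : Cmd)
  | ite (b : Cond) (c c' : Cmd)
  | loop (b : Cond) (c : Cmd)

/-- Moves between registers are additions of `0`. A real store evaluates the value before the
address, since evaluating the value may overwrite natural temporaries. Tests only compare registers,
so a loop evaluates its condition once in advance and again at the end of each round. -/
def Cmd.code : Cmd → Prog
  | .skip => .instr (.natConst numVars 0)
  | .nset x e => .seq (e.code numVars)
      (.seq (.instr (.natConst (numVars + 1) 0)) (.instr (.natOp .add x numVars (numVars + 1))))
  | .rset x e => .seq (e.code numVars)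
      (.seq (.instr (.realConst (numVars + 1) 0)) (.instr (.realOp .add x numVars (numVars + 1))))
  | .nstore a e =>
      .seq (a.code numVars) (.seq (e.code (numVars + 1)) (.instr (.natStore numVars (numVars + 1))))
  | .rstore a e =>
      .seq (e.code numVars) (.seq (a.code numVars) (.instr (.realStore numVars numVars)))
  | .seq c c' => .seq c.code c'.code
  | .ite b c c' => .seq b.code (.ite b.test c.code c'.code)
  | .loop b c => .seq b.code (.loop b.test (.seq c.code b.code))

/-! ### Total correctness with time bounds -/

/-- Started in a state `s` the command terminates within `T` steps, with words at most `W` and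
addresses below `M`, in a state that satisfies `Q`. -/
def Cmd.WP (M W : ℕ) (c : Cmd) (T : ℕ) (Q : State → Prop) (s : State) : Prop :=
  ∀ σ : Store, σ.Bounded W → σ.state = s → ∃ (σ' : Store) (t : ℕ), t ≤ T ∧ σ'.Bounded W ∧
    Exec M W c.code σ σ' t ∧ Q σ'.state

theorem Cmd.WP.mono {M W : ℕ} {c : Cmd} {T T' : ℕ} {Q Q' : State → Prop} {s : State}
    (h : c.WP M W T Q s) (hT : T ≤ T') (hQ : ∀ s', Q s' → Q' s') : c.WP M W T' Q' s := by
  intro σ hσ e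
  obtain ⟨σ', t, h1, h2, h3, h4⟩ := h σ hσ e
  exact ⟨σ', t, h1.trans hT, h2, h3, hQ _ h4⟩

theorem Cmd.WP.seq {M W : ℕ} {c c' : Cmd} {T T' : ℕ} {Q : State → Prop} {s : State}
    (h : c.WP M W T (c'.WP M W T' Q) s) : (Cmd.seq c c').WP M W (1 + (T + T')) Q s := by
  intro σ hσ e
  obtain ⟨σ', t, h1, h2, h3, h4⟩ := h σ hσ e
  obtain ⟨σ'', t', k1, k2, k3, k4⟩ := h4 σ' h2 rfl
  exact ⟨σ'', _, by omega, k2, Exec.seq hσ h3 k3, k4⟩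

theorem Cmd.WP.ite {M W : ℕ} {b : Cond} {c c' : Cmd} {T T' : ℕ} {Q : State → Prop} {s : State}
    (hb : b.Safe M W s) (h : b.Holds s → c.WP M W T Q s) (h' : ¬ b.Holds s → c'.WP M W T' Q s) :
    (Cmd.ite b c c').WP M W (1 + (b.code.cost + (1 + max T T'))) Q s := by
  rintro σ hσ rfl
  obtain ⟨σ₁, b1, e1, i1, x1⟩ := b.exec_code σ hσ hb
  by_cases hc : b.Holds σ.state
  · obtain ⟨σ', t, h1, h2, h3, h4⟩ := h hc σ₁ b1 e1
    exact ⟨σ', _, by omega, h2, Exec.seq hσ x1 (Exec.ite_pos b1 (i1.2 hc) h3), h4⟩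
  · obtain ⟨σ', t, h1, h2, h3, h4⟩ := h' hc σ₁ b1 e1
    exact ⟨σ', _, by omega, h2, Exec.seq hσ x1 (Exec.ite_neg b1 (mt i1.1 hc) h3), h4⟩

/-- The measure `μ` decreases in each round and so bounds their number. A round pays for the body,
the new evaluation of the condition, the test, and the unfolding of the composition. -/
theorem Cmd.WP.loop {M W : ℕ} {b : Cond} {c : Cmd} {B : ℕ} {s : State} (I : State → Prop)
    (μ : State → ℕ) (hs : I s) (hb : ∀ s, I s → b.Safe M W s)
    (hc : ∀ s, I s → b.Holds s → c.WP M W B (fun s' => I s' ∧ μ s' < μ s) s) :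
    (Cmd.loop b c).WP M W ((B + b.code.cost + 2) * μ s + b.code.cost + 2)
      (fun s' => I s' ∧ ¬ b.Holds s') s := by
  -- The induction also carries that the two temporaries read by the test reflect the condition in
  -- the current state.
  have key : ∀ (k : ℕ) (σ : Store), σ.Bounded W → I σ.state → μ σ.state ≤ k →
      (b.test.On σ ↔ b.Holds σ.state) → ∃ (σ' : Store) (t : ℕ),
        t ≤ (B + b.code.cost + 2) * k + 1 ∧ σ'.Bounded W ∧
        Exec M W (.loop b.test (.seq c.code b.code)) σ σ' t ∧ I σ'.state ∧ ¬ b.Holds σ'.state := by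
    intro k
    induction k with
    | zero =>
      intro σ hσ hI hμ hbt
      by_cases hh : b.Holds σ.state
      · obtain ⟨σ', t, -, -, -, -, h5⟩ := hc _ hI hh σ hσ rfl
        omega
      · exact ⟨σ, 1, by omega, hσ, Exec.loop_done hσ (mt hbt.1 hh), hI, hh⟩
    | succ k ih =>
      intro σ hσ hI hμ hbt
      by_cases hh : b.Holds σ.state
      · obtain ⟨σ₁, t, h1, h2, h3, h4, h5⟩ := hc _ hI hh σ hσ rfl
        obtain ⟨σ₂, b1, e1, i1, x1⟩ := b.exec_code σ₁ h2 (hb _ h4)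
        obtain ⟨σ', u, k1, k2, k3, k4⟩ := ih σ₂ b1 (by rwa [e1]) (by rw [e1]; omega)
          (by rw [i1, e1])
        refine ⟨σ', _, ?_, k2, Exec.loop_step hσ (hbt.2 hh) (Exec.seq hσ h3 x1) k3, k4⟩
        rw [Nat.mul_succ]
        omega
      · exact ⟨σ, 1, by omega, hσ, Exec.loop_done hσ (mt hbt.1 hh), hI, hh⟩
  rintro σ hσ rfl
  obtain ⟨σ₁, b1, e1, i1, x1⟩ := b.exec_code σ hσ (hb _ hs)
  obtain ⟨σ', u, k1, k2, k3, k4⟩ := key _ σ₁ b1 (by rwa [e1]) le_rfl (by rw [i1, e1])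
  rw [e1] at k1
  exact ⟨σ', _, by omega, k2, Exec.seq hσ x1 k3, k4⟩

/-- Verification condition of a loop-free command. -/
def Cmd.vc (M W : ℕ) : Cmd → (State → Prop) → State → Prop
  | .skip, Q, s => Q s
  | .nset x e, Q, s => e.Safe M W s ∧ Q { s with n := Function.update s.n x (e.val s) }
  | .rset x e, Q, s => e.Safe M W s ∧ Q { s with r := Function.update s.r x (e.val s) }
  | .nstore a e, Q, s => a.Safe M W s ∧ e.Safe M W s ∧ a.val s < M ∧
      Q { s with nm := Function.update s.nm (a.val s) (e.val s) }
  | .rstore a e, Q, s => a.Safe M W s ∧ e.Safe M W s ∧ a.val s < M ∧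
      Q { s with rm := Function.update s.rm (a.val s) (e.val s) }
  | .seq c c', Q, s => c.vc M W (c'.vc M W Q) s
  | .ite b c c', Q, s => b.Safe M W s ∧ (b.Holds s → c.vc M W Q s) ∧ (¬ b.Holds s → c'.vc M W Q s)
  | .loop _ _, _, _ => False

theorem Cmd.WP.of_vc {M W : ℕ} (c : Cmd) : ∀ {Q : State → Prop} {s : State},
    c.vc M W Q s → c.WP M W c.code.cost Q s := by
  induction c with
  | skip =>
    rintro Q s h σ hσ rfl
    refine ⟨_, 1, le_rfl, hσ.update numVars (Nat.zero_le W),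
      Exec.instr (c := .natConst numVars 0) (M := M) hσ trivial, ?_⟩
    change Q _ at h
    convert h using 1
    simp only [Store.state, State.mk.injEq, and_true]
    funext x
    exact Function.update_of_ne (by omega) _ _
  | nset x e =>
    rintro Q s ⟨hs, hQ⟩ σ hσ rfl
    obtain ⟨f, f1, f2, f3, f4⟩ := e.exec_code numVars le_rfl σ hσ hs
    have h1 := Exec.instr (c := .natConst (numVars + 1) 0) (M := M) f3 trivial
    have b1 := f3.update (numVars + 1) (Nat.zero_le W)
    have h2 := Exec.instr (c := .natOp .add x numVars (numVars + 1)) (M := M) b1 trivial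
    refine ⟨_, _, le_rfl, ?_, Exec.seq hσ f4 (Exec.seq f3 h1 h2), ?_⟩
    · refine b1.update x ?_
      simpa [NatOp.eval] using f3.1 numVars
    · convert hQ using 1
      simp only [Store.state, State.mk.injEq, and_true, Instr.run]
      funext y
      by_cases hxy : y = x
      · subst hxy; simp [NatOp.eval, f2]; rfl
      · have : (y : ℕ) ≠ x := fun h => hxy (Fin.ext h)
        rw [Function.update_of_ne this, Function.update_of_ne (by omega),
          Function.update_of_ne hxy, f1 _ y.2]
  | rset x e =>
    rintro Q s ⟨hs, hQ⟩ σ hσ rfl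
    obtain ⟨f, g, f0, f1, f2, f3, f4⟩ := e.exec_code numVars le_rfl σ hσ hs
    have h1 := Exec.instr (c := .realConst (numVars + 1) 0) (M := M) f3 trivial
    have h2 := Exec.instr (c := .realOp .add x numVars (numVars + 1)) (M := M)
      (s := (Instr.realConst (numVars + 1) 0).run { σ with nreg := f, rreg := g }) f3 trivial
    refine ⟨_, _, le_rfl, ?_, Exec.seq hσ f4 (Exec.seq f3 h1 h2), ?_⟩
    · exact f3
    · convert hQ using 1
      simp only [Store.state, State.mk.injEq, and_true, Instr.run]
      refine ⟨funext fun y => f0 _ y.2, funext fun y => ?_⟩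
      by_cases hxy : y = x
      · subst hxy; simp [RealOp.eval, f2]; rfl
      · have : (y : ℕ) ≠ x := fun h => hxy (Fin.ext h)
        rw [Function.update_of_ne this, Function.update_of_ne (by omega),
          Function.update_of_ne hxy, f1 _ y.2]
  | nstore a e =>
    rintro Q s ⟨ha, he, hM, hQ⟩ σ hσ rfl
    obtain ⟨f, f1, f2, f3, f4⟩ := a.exec_code numVars le_rfl σ hσ ha
    have e1 : ({ σ with nreg := f } : Store).state = σ.state := by
      simp only [Store.state, State.mk.injEq, and_true]
      exact funext fun x => f1 _ x.2
    obtain ⟨g, g1, g2, g3, g4⟩ := e.exec_code (numVars + 1) (by omega) _ f3 (by rwa [e1])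
    have g0 : g numVars = a.val σ.state := by
      rw [g1 _ (by omega)]; exact f2
    have h2 := Exec.instr (c := .natStore numVars (numVars + 1)) (M := M) g3
      (show g numVars < M by rw [g0]; exact hM)
    refine ⟨_, _, le_rfl, ?_, Exec.seq hσ f4 (Exec.seq f3 g4 h2), ?_⟩
    · exact g3.updateMem _ (g3.1 _)
    · convert hQ using 1
      simp only [Store.state, State.mk.injEq, and_true, Instr.run]
      refine ⟨funext fun y => ?_, ?_⟩
      · rw [g1 _ (by omega)]; exact f1 _ y.2
      · rw [g0, g2, e1]; exact ⟨trivial, rfl⟩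
  | rstore a e =>
    rintro Q s ⟨ha, he, hM, hQ⟩ σ hσ rfl
    obtain ⟨f, g, f0, f1, f2, f3, f4⟩ := e.exec_code numVars le_rfl σ hσ he
    have e1 : ({ σ with nreg := f, rreg := g } : Store).state = σ.state := by
      simp only [Store.state, State.mk.injEq, and_true]
      exact ⟨funext fun x => f0 _ x.2, funext fun x => f1 _ x.2⟩
    obtain ⟨f', g1, g2, g3, g4⟩ := a.exec_code numVars le_rfl _ f3 (by rwa [e1])
    rw [e1] at g2
    have h2 := Exec.instr (c := .realStore numVars numVars) (M := M) g3
      (show f' numVars < M by rw [g2]; exact hM)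
    refine ⟨_, _, le_rfl, ?_, Exec.seq hσ f4 (Exec.seq f3 g4 h2), ?_⟩
    · exact g3
    · convert hQ using 1
      simp only [Store.state, State.mk.injEq, Instr.run]
      refine ⟨funext fun y => ?_, funext fun y => f1 _ y.2, ?_⟩
      · rw [g1 _ y.2]; exact f0 _ y.2
      · rw [g2, f2]; exact ⟨trivial, rfl⟩
  | seq c c' ih ih' =>
    intro Q s h
    exact Cmd.WP.seq ((ih h).mono le_rfl fun s' => ih')
  | ite b c c' ih ih' =>
    rintro Q s ⟨hb, h, h'⟩
    exact Cmd.WP.ite hb (fun hh => ih (h hh)) (fun hh => ih' (h' hh))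
  | loop b c ih =>
    intro Q s h
    exact h.elim

theorem Cmd.vc.mono {M W : ℕ} (c : Cmd) : ∀ {Q Q' : State → Prop} {s : State},
    c.vc M W Q s → (∀ s', Q s' → Q' s') → c.vc M W Q' s := by
  induction c with
  | skip => exact fun h hQ => hQ _ h
  | nset x e => exact fun h hQ => ⟨h.1, hQ _ h.2⟩
  | rset x e => exact fun h hQ => ⟨h.1, hQ _ h.2⟩
  | nstore a e => exact fun h hQ => ⟨h.1, h.2.1, h.2.2.1, hQ _ h.2.2.2⟩
  | rstore a e => exact fun h hQ => ⟨h.1, h.2.1, h.2.2.1, hQ _ h.2.2.2⟩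
  | seq c c' ih ih' => exact fun h hQ => ih h fun s' h' => ih' h' hQ
  | ite b c c' ih ih' => exact fun h hQ => ⟨h.1, fun hb => ih (h.2.1 hb) hQ,
      fun hb => ih' (h.2.2 hb) hQ⟩
  | loop b c ih => exact fun h _ => h.elim

theorem Cmd.vc.seq {M W : ℕ} {c c' : Cmd} {R Q : State → Prop} {s : State} (h : c.vc M W R s)
    (h' : ∀ s', R s' → c'.vc M W Q s') : (Cmd.seq c c').vc M W Q s :=
  h.mono c h'

/-- This rule and the next one splice loop-free segments, handled by computing `vc`, with commands
that contain loops. -/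
theorem Cmd.WP.vc_seq {M W : ℕ} {c c' : Cmd} {T : ℕ} {R Q : State → Prop}
    {s : State} (h : c.vc M W R s) (h' : ∀ s', R s' → c'.WP M W T Q s') :
    (Cmd.seq c c').WP M W (1 + (c.code.cost + T)) Q s :=
  Cmd.WP.seq ((Cmd.WP.of_vc c h).mono le_rfl h')

theorem Cmd.WP.seq_vc {M W : ℕ} {c c' : Cmd} {T : ℕ} {R Q : State → Prop}
    {s : State} (h : c.WP M W T R s) (h' : ∀ s', R s' → c'.vc M W Q s') :
    (Cmd.seq c c').WP M W (1 + (T + c'.code.cost)) Q s :=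
  Cmd.WP.seq (h.mono le_rfl fun s' hs' => Cmd.WP.of_vc c' (h' s' hs'))

/-! #### Arithmetic on expressions -/

instance : Add NExp := ⟨.op .add⟩
instance : Sub NExp := ⟨.op .sub⟩
instance : Mul NExp := ⟨.op .mul⟩
instance : Div NExp := ⟨.op .div⟩
instance : Sub RExp := ⟨.op .sub⟩
instance : Mul RExp := ⟨.op .mul⟩
instance : Div RExp := ⟨.op .div⟩

section
variable {M W : ℕ} {s : State}

@[simp] theorem NExp.val_var (x) : (NExp.var x).val s = s.n x := rfl
@[simp] theorem NExp.val_const (c) : (NExp.const c).val s = c := rfl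
@[simp] theorem NExp.val_load (a : NExp) : (NExp.load a).val s = s.nm (a.val s) := rfl
@[simp] theorem NExp.val_add (a b : NExp) : (a + b).val s = a.val s + b.val s := rfl
@[simp] theorem NExp.val_sub (a b : NExp) : (a - b).val s = a.val s - b.val s := rfl
@[simp] theorem NExp.val_mul (a b : NExp) : (a * b).val s = a.val s * b.val s := rfl
@[simp] theorem NExp.val_div (a b : NExp) : (a / b).val s = a.val s / b.val s := rfl

@[simp] theorem NExp.safe_var (x) : (NExp.var x).Safe M W s := trivial
@[simp] theorem NExp.safe_const (c) : (NExp.const c).Safe M W s ↔ c ≤ W := Iff.rfl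
@[simp] theorem NExp.safe_load (a : NExp) :
    (NExp.load a).Safe M W s ↔ a.Safe M W s ∧ a.val s < M := Iff.rfl
@[simp] theorem NExp.safe_add (a b : NExp) :
    (a + b).Safe M W s ↔ a.Safe M W s ∧ b.Safe M W s ∧ a.val s + b.val s ≤ W := Iff.rfl
@[simp] theorem NExp.safe_sub (a b : NExp) :
    (a - b).Safe M W s ↔ a.Safe M W s ∧ b.Safe M W s ∧ a.val s - b.val s ≤ W := Iff.rfl
@[simp] theorem NExp.safe_mul (a b : NExp) :
    (a * b).Safe M W s ↔ a.Safe M W s ∧ b.Safe M W s ∧ a.val s * b.val s ≤ W := Iff.rfl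
@[simp] theorem NExp.safe_div (a b : NExp) :
    (a / b).Safe M W s ↔ a.Safe M W s ∧ b.Safe M W s ∧ a.val s / b.val s ≤ W := Iff.rfl

@[simp] theorem RExp.val_var (x) : (RExp.var x).val s = s.r x := rfl
@[simp] theorem RExp.val_const (c) : (RExp.const c).val s = c := rfl
@[simp] theorem RExp.val_load (a : NExp) : (RExp.load a).val s = s.rm (a.val s) := rfl
@[simp] theorem RExp.val_sqrt (a : RExp) : (RExp.sqrt a).val s = √(a.val s) := rfl
@[simp] theorem RExp.val_sub (a b : RExp) : (a - b).val s = a.val s - b.val s := rfl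
@[simp] theorem RExp.val_mul (a b : RExp) : (a * b).val s = a.val s * b.val s := rfl
@[simp] theorem RExp.val_div (a b : RExp) : (a / b).val s = a.val s / b.val s := rfl

@[simp] theorem RExp.safe_var (x) : (RExp.var x).Safe M W s := trivial
@[simp] theorem RExp.safe_const (c) : (RExp.const c).Safe M W s := trivial
@[simp] theorem RExp.safe_load (a : NExp) :
    (RExp.load a).Safe M W s ↔ a.Safe M W s ∧ a.val s < M := Iff.rfl
@[simp] theorem RExp.safe_sqrt (a : RExp) : (RExp.sqrt a).Safe M W s ↔ a.Safe M W s := Iff.rfl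
@[simp] theorem RExp.safe_sub (a b : RExp) :
    (a - b).Safe M W s ↔ a.Safe M W s ∧ b.Safe M W s := Iff.rfl
@[simp] theorem RExp.safe_mul (a b : RExp) :
    (a * b).Safe M W s ↔ a.Safe M W s ∧ b.Safe M W s := Iff.rfl
@[simp] theorem RExp.safe_div (a b : RExp) :
    (a / b).Safe M W s ↔ a.Safe M W s ∧ b.Safe M W s := Iff.rfl

end

/-- The sum of the expressions `f c`, `c < d`. -/
def RExp.sum {d : ℕ} (f : Fin d → RExp) : RExp :=
  ((List.finRange d).map f).foldr (fun a b => .op .add a b) (.const 0)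

@[simp] theorem RExp.val_sum {d : ℕ} (f : Fin d → RExp) (s : State) :
    (RExp.sum f).val s = ∑ c, (f c).val s := by
  rw [Fin.sum_univ_def, RExp.sum]
  induction List.finRange d with
  | nil => simp
  | cons a l ih => simp [RExp.val, RealOp.eval, ih]

theorem RExp.safe_sum {d M W : ℕ} {f : Fin d → RExp} {s : State} (h : ∀ c, (f c).Safe M W s) :
    (RExp.sum f).Safe M W s := by
  rw [RExp.sum]
  induction List.finRange d with
  | nil => trivial
  | cons a l ih => exact ⟨h a, ih⟩

end RealPRAM

/-! ### The free space of two polygonal curves -/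

namespace CurveSimp

open Set

/-- The point at parameter `y` of the segment from `u` to `v`. -/
noncomputable def seg {d : ℕ} (u v : Pt d) (y : ℝ) : Pt d := (1 - y) • u + y • v

theorem vertex_of_lt {d n : ℕ} (p : Fin n → Pt d) {i : ℕ} (h : i < n) : vertex p i = p ⟨i, h⟩ :=
  dif_pos h

theorem polyline_natCast {d n : ℕ} (p : Fin n → Pt d) (m : ℕ) : polyline p m = vertex p m := by
  simp [polyline]

theorem polyline_cell {d n : ℕ} (p : Fin n → Pt d) (j : ℕ) {x : ℝ} (h : (j : ℝ) ≤ x)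
    (h' : x ≤ j + 1) : polyline p x = seg (vertex p j) (vertex p (j + 1)) (x - j) := by
  -- At the right end of the cell the floor has already jumped to `j + 1`, but both formulas give
  -- vertex `j + 1`.
  rcases h'.eq_or_lt with rfl | h'
  · rw [← Nat.cast_succ, polyline_natCast]
    simp [seg]
  · have : ⌊x⌋₊ = j := (Nat.floor_eq_iff (le_trans (Nat.cast_nonneg j) h)).2 ⟨h, h'⟩
    simp [polyline, seg, this]

theorem continuous_seg {d : ℕ} (u v : Pt d) : Continuous (seg u v) := by
  unfold seg; fun_prop

/-- The affine pieces on adjacent closed cells agree at the common vertex. Beyond the last vertex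
the curve runs to the default value `0`, so `N` need not be bounded by `n`. -/
theorem continuousOn_polyline {d n : ℕ} (p : Fin n → Pt d) (N : ℕ) :
    ContinuousOn (polyline p) (Icc 0 (N : ℝ)) := by
  induction N with
  | zero => simp
  | succ N ih =>
    have : Icc (0 : ℝ) ((N + 1 : ℕ) : ℝ) = Icc 0 (N : ℝ) ∪ Icc (N : ℝ) ((N + 1 : ℕ) : ℝ) :=
      (Icc_union_Icc_eq_Icc (Nat.cast_nonneg N) (by simp)).symm
    rw [this]
    refine ih.union_of_isClosed ?_ isClosed_Icc isClosed_Icc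
    refine ContinuousOn.congr (f := fun x => seg (vertex p N) (vertex p (N + 1)) (x - N)) ?_ ?_
    · exact ((continuous_seg _ _).comp (by fun_prop)).continuousOn
    · intro x hx
      exact polyline_cell p N hx.1 (by simpa using hx.2)

theorem polyline_segment {d n : ℕ} (p : Fin n → Pt d) {j : ℕ} {x x' t : ℝ} (hx : (j : ℝ) ≤ x)
    (hx' : x ≤ j + 1) (hy : (j : ℝ) ≤ x') (hy' : x' ≤ j + 1) (ht : 0 ≤ t) (ht' : t ≤ 1) :
    polyline p (x + t * (x' - x)) = seg (polyline p x) (polyline p x') t := by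
  rw [polyline_cell p j hx hx', polyline_cell p j hy hy',
    polyline_cell p j (x := x + t * (x' - x)) (by nlinarith) (by nlinarith)]
  simp only [seg]
  module

/-- There is a monotone path in the free space from `(x, y)` to `(x', y')`. -/
def Joined {d n m : ℕ} (p : Fin n → Pt d) (q : Fin m → Pt d) (δ x y x' y' : ℝ) : Prop :=
  ∃ σ θ : ℝ → ℝ, ContinuousOn σ (Icc 0 1) ∧ ContinuousOn θ (Icc 0 1) ∧
    MonotoneOn σ (Icc 0 1) ∧ MonotoneOn θ (Icc 0 1) ∧ σ 0 = x ∧ θ 0 = y ∧ σ 1 = x' ∧ θ 1 = y' ∧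
    ∀ t ∈ Icc (0 : ℝ) 1, ‖polyline p (σ t) - polyline q (θ t)‖ ≤ δ

/-- The concatenation of two paths parametrized over `[0, 1]`. -/
noncomputable def concat (f g : ℝ → ℝ) (t : ℝ) : ℝ := if t ≤ 1 / 2 then f (2 * t) else g (2 * t - 1)

theorem continuousOn_concat {f g : ℝ → ℝ} (hf : ContinuousOn f (Icc 0 1))
    (hg : ContinuousOn g (Icc 0 1)) (h : f 1 = g 0) : ContinuousOn (concat f g) (Icc 0 1) := by
  have : Icc (0 : ℝ) 1 = Icc 0 (1 / 2) ∪ Icc (1 / 2) 1 :=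
    (Icc_union_Icc_eq_Icc (by norm_num) (by norm_num)).symm
  rw [this]
  refine ContinuousOn.union_of_isClosed ?_ ?_ isClosed_Icc isClosed_Icc
  · refine ContinuousOn.congr (f := fun t => f (2 * t)) ?_ fun t ht => if_pos ht.2
    exact hf.comp (by fun_prop) fun t ht => ⟨by linarith [ht.1], by linarith [ht.2]⟩
  · refine ContinuousOn.congr (f := fun t => g (2 * t - 1)) ?_ fun t ht => ?_
    · exact hg.comp (by fun_prop) fun t ht => ⟨by linarith [ht.1], by linarith [ht.2]⟩
    · rcases ht.1.eq_or_lt with rfl | h'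
      · simp [concat, h]
      · exact if_neg (not_le.2 h')

theorem monotoneOn_concat {f g : ℝ → ℝ} (hf : MonotoneOn f (Icc 0 1))
    (hg : MonotoneOn g (Icc 0 1)) (h : f 1 = g 0) : MonotoneOn (concat f g) (Icc 0 1) := by
  intro t ht u hu htu
  simp only [concat]
  by_cases h1 : t ≤ 1 / 2 <;> by_cases h2 : u ≤ 1 / 2
  · rw [if_pos h1, if_pos h2]
    exact hf ⟨by linarith [ht.1], by linarith⟩ ⟨by linarith [hu.1], by linarith⟩ (by linarith)
  · rw [if_pos h1, if_neg h2]
    push Not at h2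
    calc f (2 * t) ≤ f 1 :=
          hf ⟨by linarith [ht.1], by linarith⟩ ⟨zero_le_one, le_rfl⟩ (by linarith)
      _ = g 0 := h
      _ ≤ g (2 * u - 1) :=
          hg ⟨le_rfl, zero_le_one⟩ ⟨by linarith, by linarith [hu.2]⟩ (by linarith)
  · linarith
  · rw [if_neg h1, if_neg h2]
    push Not at h1 h2
    exact hg ⟨by linarith, by linarith [ht.2]⟩ ⟨by linarith, by linarith [hu.2]⟩ (by linarith)

theorem Joined.trans {d n m : ℕ} {p : Fin n → Pt d} {q : Fin m → Pt d}
    {δ x y x' y' x'' y'' : ℝ} (h : Joined p q δ x y x' y') (h' : Joined p q δ x' y' x'' y'') :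
    Joined p q δ x y x'' y'' := by
  obtain ⟨σ, θ, c1, c2, m1, m2, e1, e2, e3, e4, hw⟩ := h
  obtain ⟨σ', θ', c1', c2', m1', m2', e1', e2', e3', e4', hw'⟩ := h'
  refine ⟨concat σ σ', concat θ θ', continuousOn_concat c1 c1' (by rw [e3, e1']),
    continuousOn_concat c2 c2' (by rw [e4, e2']), monotoneOn_concat m1 m1' (by rw [e3, e1']),
    monotoneOn_concat m2 m2' (by rw [e4, e2']), by simp [concat, e1], by simp [concat, e2], ?_, ?_,
    fun t ht => ?_⟩
  · rw [concat, if_neg (by norm_num)]; norm_num [e3']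
  · rw [concat, if_neg (by norm_num)]; norm_num [e4']
  · simp only [concat]
    split_ifs with h
    · exact hw _ ⟨by linarith [ht.1], by linarith⟩
    · push Not at h
      exact hw' _ ⟨by linarith, by linarith [ht.2]⟩

theorem norm_seg_sub_seg_le {d : ℕ} {u v u' v' : Pt d} {δ t : ℝ} (h : ‖u - u'‖ ≤ δ)
    (h' : ‖v - v'‖ ≤ δ) (ht : 0 ≤ t) (ht' : t ≤ 1) : ‖seg u v t - seg u' v' t‖ ≤ δ := by
  have : seg u v t - seg u' v' t = (1 - t) • (u - u') + t • (v - v') := by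
    simp only [seg]; module
  rw [this]
  refine (norm_add_le _ _).trans ?_
  rw [norm_smul, norm_smul, Real.norm_of_nonneg ht, Real.norm_of_nonneg (sub_nonneg.2 ht')]
  nlinarith

/-- Within a cell the difference of the two curves is affine and the norm is convex, so the straight
segment between two free points stays free. The order of the coordinates makes it monotone. -/
theorem Joined.cell {d n m : ℕ} {p : Fin n → Pt d} {q : Fin m → Pt d} {δ x y x' y' : ℝ} (a b : ℕ)
    (hx : (a : ℝ) ≤ x) (hxx : x ≤ x') (hx' : x' ≤ a + 1) (hy : (b : ℝ) ≤ y) (hyy : y ≤ y')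
    (hy' : y' ≤ b + 1) (h : ‖polyline p x - polyline q y‖ ≤ δ)
    (h' : ‖polyline p x' - polyline q y'‖ ≤ δ) : Joined p q δ x y x' y' := by
  refine ⟨fun t => x + t * (x' - x), fun t => y + t * (y' - y), by fun_prop, by fun_prop,
    fun t _ u _ htu => ?_, fun t _ u _ htu => ?_, by simp, by simp, by simp, by simp,
    fun t ht => ?_⟩
  · have := mul_le_mul_of_nonneg_right htu (sub_nonneg.2 hxx)
    simpa using this
  · have := mul_le_mul_of_nonneg_right htu (sub_nonneg.2 hyy)
    simpa using this
  · rw [polyline_segment p hx (by linarith) (by linarith) hx' ht.1 ht.2,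
      polyline_segment q hy (by linarith) (by linarith) hy' ht.1 ht.2]
    exact norm_seg_sub_seg_le h h' ht.1 ht.2

/-- Every pair of re-parametrizations has a width. -/
theorem exists_isWidth {d n m : ℕ} (p : Fin n → Pt d) (q : Fin m → Pt d) {σ θ : ℝ → ℝ}
    (hσ : IsReparam n σ) (hθ : IsReparam m θ) : ∃ w, IsWidth p q σ θ w := by
  have aux : ∀ {k : ℕ} (r : Fin k → Pt d) {τ : ℝ → ℝ}, IsReparam k τ →
      ContinuousOn (fun t => polyline r (τ t)) (Icc 0 1) := by
    intro k r τ hτ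
    refine (continuousOn_polyline r k).comp hτ.continuousOn fun t ht => ⟨?_, ?_⟩
    · rw [← hτ.map_zero]
      exact hτ.monotoneOn ⟨le_rfl, zero_le_one⟩ ht ht.1
    · have := hτ.monotoneOn ht ⟨zero_le_one, le_rfl⟩ ht.2
      rw [hτ.map_one] at this
      linarith
  exact (isCompact_Icc.image_of_continuousOn ((aux p hσ).sub (aux q hθ)).norm).exists_isGreatest
    ⟨_, mem_image_of_mem _ ⟨le_rfl, zero_le_one⟩⟩

theorem frechetDist_le {d n m : ℕ} {p : Fin n → Pt d} {q : Fin m → Pt d} {δ : ℝ}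
    (h : Joined p q δ 0 0 ((n : ℝ) - 1) ((m : ℝ) - 1)) : frechetDist p q ≤ δ := by
  obtain ⟨σ, θ, c1, c2, m1, m2, e1, e2, e3, e4, hw⟩ := h
  have hσ : IsReparam n σ := ⟨c1, m1, e1, e3⟩
  have hθ : IsReparam m θ := ⟨c2, m2, e2, e4⟩
  obtain ⟨w, hw'⟩ := exists_isWidth p q hσ hθ
  unfold frechetDist
  refine csInf_le_of_le (b := w) ⟨0, ?_⟩ ⟨σ, θ, hσ, hθ, hw'⟩ ?_
  · rintro w ⟨σ, θ, -, -, ⟨t, -, rfl⟩, -⟩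
    exact norm_nonneg _
  · obtain ⟨t, ht, rfl⟩ := hw'.1
    exact hw t ht

theorem isReparam_linear {n : ℕ} (hn : 1 ≤ n) : IsReparam n fun t => t * ((n : ℝ) - 1) := by
  have : (1 : ℝ) ≤ n := by exact_mod_cast hn
  exact ⟨by fun_prop, fun t _ u _ h => mul_le_mul_of_nonneg_right h (by linarith), by simp, by simp⟩

/-- The slack `δ < D` is needed because the infimum is not yet known to be attained. Nonempty curves
have matchings, which rules out the default value of `sInf` on the empty set. -/
theorem exists_matching {d n m : ℕ} {p : Fin n → Pt d} {q : Fin m → Pt d} {δ D : ℝ} (hn : 1 ≤ n)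
    (hm : 1 ≤ m) (h : frechetDist p q ≤ δ) (hD : δ < D) : ∃ σ θ : ℝ → ℝ, IsReparam n σ ∧
      IsReparam m θ ∧ ∀ t ∈ Icc (0 : ℝ) 1, ‖polyline p (σ t) - polyline q (θ t)‖ ≤ D := by
  have hne : {w : ℝ | ∃ σ θ : ℝ → ℝ, IsReparam n σ ∧ IsReparam m θ ∧
      IsWidth p q σ θ w}.Nonempty := by
    obtain ⟨w, hw⟩ := exists_isWidth p q (isReparam_linear hn) (isReparam_linear hm)
    exact ⟨w, _, _, isReparam_linear hn, isReparam_linear hm, hw⟩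
  obtain ⟨w, ⟨σ, θ, hσ, hθ, hw⟩, hwD⟩ := exists_lt_of_csInf_lt hne (h.trans_lt hD)
  exact ⟨σ, θ, hσ, hθ, fun t ht => (hw.2 (mem_image_of_mem _ ht)).trans hwD.le⟩

/-! ### Links -/

/-- A monotone path in the strip between the curve and the segment from vertex `i'` to vertex `i`
may lead from cell `j'` to cell `j`: the `y m` are its heights above the vertices in between. -/
def Pass {d n : ℕ} (p : Fin n → Pt d) (δ : ℝ) (i' i j' j : ℕ) : Prop :=
  ∃ y : ℕ → ℝ, (∀ m, j' < m → m ≤ j → 0 ≤ y m ∧ y m ≤ 1 ∧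
    ‖vertex p m - seg (vertex p i') (vertex p i) (y m)‖ ≤ δ) ∧
    ∀ m, j' < m → m < j → y m ≤ y (m + 1)

/-- A segment from vertex `i'`, matched with parameter `x'` in cell `j'`, to vertex `i`, matched
with parameter `x` in cell `j`. -/
structure Link {d n : ℕ} (p : Fin n → Pt d) (δ : ℝ) (i' j' : ℕ) (x' : ℝ) (i j : ℕ) (x : ℝ) :
    Prop where
  lt : i' < i
  lt_card : i < n
  cell_lt : j + 1 < n
  le : (j : ℝ) ≤ x
  le_succ : x ≤ j + 1
  free : ‖polyline p x - vertex p i‖ ≤ δ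
  step : (j' = j ∧ x' ≤ x) ∨ (j' < j ∧ Pass p δ i' i j' j)

/-- The path visits the points above the vertices `j' + 1, …, j` at the prescribed heights and is
straight in each cell. Convexity of the cells makes the first and the last piece possible for every
choice of `x'` and `x`. -/
theorem Link.joined {d n k : ℕ} {p : Fin n → Pt d} {δ : ℝ} {q : Fin k → Pt d} {i' j' i j t : ℕ}
    {x' x : ℝ} (h : Link p δ i' j' x' i j x) (h1 : (j' : ℝ) ≤ x') (h2 : x' ≤ j' + 1)
    (h3 : ‖polyline p x' - vertex p i'‖ ≤ δ) (hq : vertex q t = vertex p i')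
    (hq' : vertex q (t + 1) = vertex p i) :
    Joined p q δ x' t x ((t + 1 : ℕ) : ℝ) := by
  have f1 : ‖polyline p x' - polyline q t‖ ≤ δ := by rwa [polyline_natCast, hq]
  have f2 : ‖polyline p x - polyline q ((t + 1 : ℕ) : ℝ)‖ ≤ δ := by
    rw [polyline_natCast, hq']; exact h.free
  rcases h.step with ⟨rfl, hx⟩ | ⟨hj, y, hy, hy'⟩
  · exact Joined.cell j' t h1 hx h.le_succ le_rfl (by simp) (by simp) f1 f2
  · have free : ∀ m, j' < m → m ≤ j → ‖polyline p (m : ℝ) - polyline q ((t : ℝ) + y m)‖ ≤ δ := by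
      intro m hm hm'
      obtain ⟨a, b, c⟩ := hy m hm hm'
      rw [polyline_natCast, polyline_cell q t (by linarith) (by linarith), hq, hq']
      simpa using c
    have key : ∀ m, j' < m → m ≤ j → Joined p q δ x' t (m : ℝ) ((t : ℝ) + y m) := by
      intro m hm
      induction m, hm using Nat.le_induction with
      | base =>
        intro hm'
        obtain ⟨a, b, -⟩ := hy (j' + 1) (by omega) hm'
        exact Joined.cell j' t h1 (by push_cast; exact h2) (by push_cast; rfl) le_rfl (by linarith)
          (by linarith) f1 (free _ (by omega) hm')
      | succ m hm ih =>
        intro hm'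
        obtain ⟨a, b, -⟩ := hy m hm (by omega)
        obtain ⟨a', b', -⟩ := hy (m + 1) (by omega) hm'
        exact (ih (by omega)).trans (Joined.cell m t le_rfl (by simp) (by simp) (by linarith)
          (by linarith [hy' m hm (by omega)]) (by linarith) (free m hm (by omega))
          (free _ (by omega) hm'))
    obtain ⟨a, b, -⟩ := hy j hj le_rfl
    exact (key j hj le_rfl).trans (Joined.cell j t le_rfl h.le h.le_succ (by linarith)
      (by push_cast; linarith) (by push_cast; rfl) (free j hj le_rfl) f2)

/-- A chain of links from the first to the last vertex yields a simplification. -/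
theorem isSimplification_of_links {d n k : ℕ} {p : Fin n → Pt d} {δ : ℝ} (hδ : 0 ≤ δ)
    (s : Fin k → Fin n) (hk : 0 < k) (i j : ℕ → ℕ) (x : ℕ → ℝ) (hs : ∀ t, (s t : ℕ) = i t)
    (hi : i 0 = 0) (hj : j 0 = 0) (hx : x 0 = 0) (hlast : i (k - 1) + 1 = n)
    (hxlast : x (k - 1) = (n : ℝ) - 1)
    (h : ∀ t, t + 1 < k → Link p δ (i t) (j t) (x t) (i (t + 1)) (j (t + 1)) (x (t + 1))) :
    IsSimplification p δ s := by
  have hv : ∀ t, t < k → vertex (p ∘ s) t = vertex p (i t) := by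
    intro t ht
    rw [vertex_of_lt _ ht, ← hs ⟨t, ht⟩, vertex_of_lt _ (s ⟨t, ht⟩).2]
    rfl
  refine ⟨⟨?_, hk, by rw [hs]; exact hi, by rw [hs]; exact hlast⟩, ?_⟩
  · have : ∀ t u, t < u → u < k → i t < i u := by
      intro t u htu
      induction u, htu using Nat.le_induction with
      | base => exact fun hu => (h t hu).lt
      | succ u hu ih => exact fun hu' => (ih (by omega)).trans (h u hu').lt
    intro t u htu
    rw [Fin.lt_def, hs, hs]
    exact this _ _ htu u.2
  · have key : ∀ t, t < k → Joined p (p ∘ s) δ 0 0 (x t) t ∧ (j t : ℝ) ≤ x t ∧ x t ≤ j t + 1 ∧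
        ‖polyline p (x t) - vertex p (i t)‖ ≤ δ := by
      intro t
      induction t with
      | zero =>
        intro ht
        have h0 : polyline p 0 = vertex p 0 := by exact_mod_cast polyline_natCast p 0
        have h0' : polyline (p ∘ s) 0 = vertex p 0 := by
          rw [← hi, ← hv 0 ht]; exact_mod_cast polyline_natCast (p ∘ s) 0
        have : ‖polyline p 0 - polyline (p ∘ s) 0‖ ≤ δ := by rw [h0, h0']; simpa
        refine ⟨?_, by simp [hj, hx], by simp [hj, hx], ?_⟩
        · rw [hx]
          exact Joined.cell 0 0 (by simp) (by simp) (by simp) (by simp) (by simp) (by simp) this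
            (by simpa using this)
        · rw [hx, hi, h0]; simpa
      | succ t ih =>
        intro ht
        obtain ⟨a, b, c, e⟩ := ih (by omega)
        have hl := h t ht
        exact ⟨a.trans (hl.joined b c e (hv t (by omega)) (hv (t + 1) ht)), hl.le, hl.le_succ,
          hl.free⟩
    have := (key (k - 1) (by omega)).1
    rw [hxlast, Nat.cast_pred hk] at this
    exact frechetDist_le this

end CurveSimp

/-! ### From matchings to links: certificates and compactness -/

namespace CurveSimp

open Set

/-- Times at which the vertices are visited exist by the intermediate value theorem. Those of the
first and the last vertex are pinned to `0` and `1`, where a general choice could differ. -/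
theorem exists_times {n : ℕ} (hn : 2 ≤ n) {σ : ℝ → ℝ} (h : IsReparam n σ) :
    ∃ τ : ℕ → ℝ, τ 0 = 0 ∧ τ (n - 1) = 1 ∧ ∀ m < n, τ m ∈ Icc (0 : ℝ) 1 ∧ σ (τ m) = m := by
  have ivt : ∀ m : ℕ, ∃ t, m < n → t ∈ Icc (0 : ℝ) 1 ∧ σ t = m := by
    intro m
    by_cases hm : m < n
    · have := intermediate_value_Icc zero_le_one h.continuousOn
      rw [h.map_zero, h.map_one] at this
      have hm' : ((m + 1 : ℕ) : ℝ) ≤ n := by exact_mod_cast hm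
      push_cast at hm'
      obtain ⟨t, ht, e⟩ := this ⟨Nat.cast_nonneg m, by linarith⟩
      exact ⟨t, fun _ => ⟨ht, e⟩⟩
    · exact ⟨0, fun h => absurd h hm⟩
  choose τ hτ using ivt
  refine ⟨fun m => if m = 0 then 0 else if m = n - 1 then 1 else τ m, by simp, ?_, fun m hm => ?_⟩
  · simp [show n - 1 ≠ 0 by omega]
  · by_cases h0 : m = 0
    · subst h0; simp [h.map_zero]
    · by_cases h1 : m = n - 1
      · subst h1
        simp only [h0, if_false, if_true]
        refine ⟨⟨zero_le_one, le_rfl⟩, ?_⟩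
        rw [h.map_one, Nat.cast_pred (by omega)]
      · simpa [h0, h1] using hτ m hm

theorem lt_of_map_lt {σ : ℝ → ℝ} (h : MonotoneOn σ (Icc 0 1)) {a b : ℝ} (ha : a ∈ Icc (0 : ℝ) 1)
    (hb : b ∈ Icc (0 : ℝ) 1) (hab : σ a < σ b) : a < b := by
  by_contra! hba
  exact absurd (h hb ha hba) (not_le.2 hab)

/-- A combinatorial description of the matchings of width at most `D` of the curve and its
subsequence `i`: vertex `i t` of the latter is matched with parameter `x t` in cell `j t`, and vertex
`m` of the former with parameter `y m`. -/
structure Certificate {d n : ℕ} (p : Fin n → Pt d) (k : ℕ) (i : ℕ → ℕ) (D : ℝ) (j : ℕ → ℕ)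
    (x y : ℕ → ℝ) : Prop where
  mem : ∀ t < k, (j t : ℝ) ≤ x t ∧ x t ≤ j t + 1
  free : ∀ t < k,
    ‖seg (vertex p (j t)) (vertex p (j t + 1)) (x t - j t) - vertex p (i t)‖ ≤ D
  mono : ∀ t, t + 1 < k → x t ≤ x (t + 1)
  pass : ∀ t, t + 1 < k → ∀ m, j t < m → m ≤ j (t + 1) → (t : ℝ) ≤ y m ∧ y m ≤ t + 1 ∧
    ‖vertex p m - seg (vertex p (i t)) (vertex p (i (t + 1))) (y m - t)‖ ≤ D
  pass_mono : ∀ m, m + 1 < n → y m ≤ y (m + 1)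
  range : (∀ t, x t ∈ Icc (0 : ℝ) n) ∧ ∀ m, y m ∈ Icc (0 : ℝ) k

/-- The discrete part of a certificate. -/
def CellPath (n k : ℕ) (j : ℕ → ℕ) : Prop :=
  j 0 = 0 ∧ j (k - 1) = n - 2 ∧ (∀ t, j t ≤ n - 2) ∧ (∀ t, t + 1 < k → j t ≤ j (t + 1)) ∧
    ∀ t, k ≤ t → j t = 0

/-- A matching is sampled at times `τ m` and `ω t` when it visits the vertices of the curve and of
the subsequence. -/
theorem exists_certificate {d n k : ℕ} {p : Fin n → Pt d} {q : Fin k → Pt d} {i : ℕ → ℕ} {δ D : ℝ}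
    (hn : 2 ≤ n) (hk : 2 ≤ k) (hq : ∀ t < k, vertex q t = vertex p (i t))
    (h : frechetDist p q ≤ δ) (hD : δ < D) :
    ∃ j x y, CellPath n k j ∧ Certificate p k i D j x y := by
  obtain ⟨σ, θ, hσ, hθ, hw⟩ := exists_matching (by omega) (by omega) h hD
  obtain ⟨τ, τ0, τ1, hτ⟩ := exists_times hn hσ
  obtain ⟨ω, ω0, ω1, hω⟩ := exists_times hk hθ
  have τlt : ∀ m, m + 1 < n → τ m < τ (m + 1) := fun m hm =>
    lt_of_map_lt hσ.monotoneOn (hτ m (by omega)).1 (hτ _ hm).1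
      (by rw [(hτ m (by omega)).2, (hτ _ hm).2]; simp)
  have ωlt : ∀ m, m + 1 < k → ω m < ω (m + 1) := fun m hm =>
    lt_of_map_lt hθ.monotoneOn (hω m (by omega)).1 (hω _ hm).1
      (by rw [(hω m (by omega)).2, (hω _ hm).2]; simp)
  classical
  -- The cell is determined by comparing times rather than parameters, which settles ties at
  -- vertices consistently: the vertices passed between `t` and `t + 1` are those with `ω t < τ m ≤
  -- ω (t + 1)`. The cap `n - 2` assigns the end of the curve to the last cell.
  set g : ℕ → ℕ := fun t => Nat.findGreatest (fun m => τ m ≤ ω t) (n - 2) with hg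
  have gle : ∀ t, g t ≤ n - 2 := fun t => Nat.findGreatest_le _
  have gspec : ∀ t < k, τ (g t) ≤ ω t := fun t ht =>
    Nat.findGreatest_spec (P := fun m => τ m ≤ ω t) (Nat.zero_le (n - 2))
      (by rw [τ0]; exact (hω t ht).1.1)
  have ggt : ∀ t < k, ∀ m, g t < m → m ≤ n - 2 → ω t < τ m := fun t _ m hm hm' =>
    not_le.1 (Nat.findGreatest_is_greatest (P := fun m => τ m ≤ ω t) hm hm')
  have σmem : ∀ t ∈ Icc (0 : ℝ) 1, 0 ≤ σ t ∧ σ t ≤ n - 1 := fun t ht => by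
    rw [← hσ.map_one, ← hσ.map_zero]
    exact ⟨hσ.monotoneOn ⟨le_rfl, zero_le_one⟩ ht ht.1,
      hσ.monotoneOn ht ⟨zero_le_one, le_rfl⟩ ht.2⟩
  have θmem : ∀ t ∈ Icc (0 : ℝ) 1, 0 ≤ θ t ∧ θ t ≤ k - 1 := fun t ht => by
    rw [← hθ.map_one, ← hθ.map_zero]
    exact ⟨hθ.monotoneOn ⟨le_rfl, zero_le_one⟩ ht ht.1,
      hθ.monotoneOn ht ⟨zero_le_one, le_rfl⟩ ht.2⟩
  have cell : ∀ t < k, (g t : ℝ) ≤ σ (ω t) ∧ σ (ω t) ≤ g t + 1 := by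
    intro t ht
    have hgt := gle t
    constructor
    · rw [← (hτ (g t) (by omega)).2]
      exact hσ.monotoneOn (hτ _ (by omega)).1 (hω t ht).1 (gspec t ht)
    · rcases hgt.eq_or_lt with e | hlt
      · refine (σmem _ (hω t ht).1).2.trans ?_
        rw [e, Nat.cast_sub hn]
        push_cast; linarith
      · rw [← Nat.cast_succ, ← (hτ (g t + 1) (by omega)).2]
        exact hσ.monotoneOn (hω t ht).1 (hτ _ (by omega)).1 (ggt t ht _ (by omega) (by omega)).le
  -- Irrelevant indices get the value `0`, so that there are finitely many cell paths and the
  -- parameters lie in a compact product.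
  refine ⟨fun t => if t < k then g t else 0, fun t => if t < k then σ (ω t) else 0,
    fun m => if m < n then θ (τ m) else 0, ⟨?_, ?_, ?_, ?_, ?_⟩, ?_, ?_, ?_, ?_, ?_, ?_, ?_⟩
  · simp only [show 0 < k by omega, if_true]
    refine Nat.findGreatest_eq_zero_iff.2 fun m hm hm' => ?_
    rw [ω0, not_le]
    refine lt_of_map_lt hσ.monotoneOn ⟨le_rfl, zero_le_one⟩ (hτ m (by omega)).1 ?_
    rw [hσ.map_zero, (hτ m (by omega)).2]
    exact_mod_cast hm
  · simp only [show k - 1 < k by omega, if_true]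
    refine le_antisymm (gle _) (Nat.le_findGreatest le_rfl ?_)
    rw [ω1]
    exact (hτ _ (by omega)).1.2
  · intro t
    dsimp only
    split_ifs
    exacts [gle t, Nat.zero_le _]
  · intro t ht
    simp only [ht, show t < k by omega, if_true]
    exact Nat.le_findGreatest (gle t) ((gspec t (by omega)).trans (ωlt t ht).le)
  · intro t ht
    exact if_neg (by omega)
  · intro t ht
    simp only [if_pos ht]
    exact cell t ht
  · intro t ht
    simp only [if_pos ht]
    rw [← polyline_cell p (g t) (cell t ht).1 (cell t ht).2, ← hq t ht, ← polyline_natCast q,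
      ← (hω t ht).2]
    exact hw _ (hω t ht).1
  · intro t ht
    rw [if_pos (by omega), if_pos ht]
    exact hσ.monotoneOn (hω t (by omega)).1 (hω _ ht).1 (ωlt t ht).le
  · intro t ht m hm hm'
    rw [if_pos (by omega)] at hm
    rw [if_pos ht] at hm'
    have hmn := hm'.trans (gle _)
    rw [if_pos (by omega)]
    have a : (t : ℝ) ≤ θ (τ m) := by
      rw [← (hω t (by omega)).2]
      exact hθ.monotoneOn (hω t (by omega)).1 (hτ m (by omega)).1 (ggt t (by omega) m hm hmn).le
    have b : θ (τ m) ≤ t + 1 := by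
      rw [← Nat.cast_succ, ← (hω (t + 1) ht).2]
      refine hθ.monotoneOn (hτ m (by omega)).1 (hω _ ht).1 (le_trans ?_ (gspec _ ht))
      rcases hm'.eq_or_lt with rfl | hlt
      · exact le_rfl
      · refine (lt_of_map_lt hσ.monotoneOn (hτ m (by omega)).1 (hτ _ (by have := gle (t+1); omega)).1 ?_).le
        rw [(hτ m (by omega)).2, (hτ _ (by have := gle (t+1); omega)).2]
        exact_mod_cast hlt
    refine ⟨a, b, ?_⟩
    rw [← hq t (by omega), ← hq (t + 1) ht, ← polyline_cell q t a b, ← polyline_natCast p,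
      ← (hτ m (by omega)).2]
    exact hw _ (hτ m (by omega)).1
  · intro m hm
    rw [if_pos (by omega), if_pos hm]
    exact hθ.monotoneOn (hτ m (by omega)).1 (hτ _ hm).1 (τlt m hm).le
  · intro t
    split_ifs with ht
    · exact ⟨(σmem _ (hω t ht).1).1, by linarith [(σmem _ (hω t ht).1).2]⟩
    · exact ⟨le_rfl, Nat.cast_nonneg _⟩
  · intro m
    split_ifs with hm
    · exact ⟨(θmem _ (hτ m hm).1).1, by linarith [(θmem _ (hτ m hm).1).2]⟩
    · exact ⟨le_rfl, Nat.cast_nonneg _⟩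

/-- For fixed cells, a certificate is a conjunction of non-strict inequalities between continuous
functions of finitely many coordinates each. -/
theorem isClosed_certificate {d n : ℕ} (p : Fin n → Pt d) (k : ℕ) (i : ℕ → ℕ) (D : ℝ)
    (j : ℕ → ℕ) : IsClosed {z : (ℕ → ℝ) × (ℕ → ℝ) | Certificate p k i D j z.1 z.2} := by
  have : {z : (ℕ → ℝ) × (ℕ → ℝ) | Certificate p k i D j z.1 z.2} =
      {z : (ℕ → ℝ) × (ℕ → ℝ) | (∀ t < k, (j t : ℝ) ≤ z.1 t ∧ z.1 t ≤ (j t : ℝ) + 1) ∧ (∀ t < k,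
        ‖seg (vertex p (j t)) (vertex p (j t + 1)) (z.1 t - j t) - vertex p (i t)‖ ≤ D) ∧
        (∀ t, t + 1 < k → z.1 t ≤ z.1 (t + 1)) ∧
        (∀ t, t + 1 < k → ∀ m, j t < m → m ≤ j (t + 1) → (t : ℝ) ≤ z.2 m ∧ z.2 m ≤ (t : ℝ) + 1 ∧
        ‖vertex p m - seg (vertex p (i t)) (vertex p (i (t + 1))) (z.2 m - t)‖ ≤ D) ∧
        (∀ m, m + 1 < n → z.2 m ≤ z.2 (m + 1)) ∧
        (∀ t, 0 ≤ z.1 t ∧ z.1 t ≤ (n : ℝ)) ∧ ∀ m, 0 ≤ z.2 m ∧ z.2 m ≤ (k : ℝ)} := by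
    ext z
    exact ⟨fun ⟨a, b, c, d, e, f⟩ => ⟨a, b, c, d, e, f⟩,
      fun ⟨a, b, c, d, e, f⟩ => ⟨a, b, c, d, e, f⟩⟩
  rw [this]
  simp only [seg, ofPred_and, ofPred_forall]
  repeat' first
    | apply IsClosed.inter
    | refine isClosed_iInter fun _ => ?_
    | exact isClosed_le (by fun_prop) (by fun_prop)

theorem Certificate.mono_width {d n k : ℕ} {p : Fin n → Pt d} {i j : ℕ → ℕ} {D D' : ℝ}
    {x y : ℕ → ℝ} (h : Certificate p k i D j x y) (hD : D ≤ D') : Certificate p k i D' j x y where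
  mem := h.mem
  free t ht := (h.free t ht).trans hD
  mono := h.mono
  pass t ht m hm hm' :=
    ⟨(h.pass t ht m hm hm').1, (h.pass t ht m hm hm').2.1, (h.pass t ht m hm hm').2.2.trans hD⟩
  pass_mono := h.pass_mono
  range := h.range

theorem finite_cellPath (n k : ℕ) : {j : ℕ → ℕ | CellPath n k j}.Finite := by
  refine Set.Finite.of_finite_image
    (f := fun (j : ℕ → ℕ) (t : Fin k) => (⟨min (j t) (n - 2), by omega⟩ : Fin (n - 2 + 1)))
    (Set.toFinite _) ?_
  rintro j hj j' hj' h
  funext t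
  by_cases ht : t < k
  · have := congrFun h ⟨t, ht⟩
    simpa [hj.2.2.1 t, hj'.2.2.1 t] using this
  · rw [hj.2.2.2.2 t (by omega), hj'.2.2.2.2 t (by omega)]

/-- The limit of the widths `δ + 1 / (N + 1)`: pigeonhole for the cells, compactness for the real
parameters. -/
theorem exists_certificate_self {d n k : ℕ} {p : Fin n → Pt d} {q : Fin k → Pt d} {i : ℕ → ℕ}
    {δ : ℝ} (hn : 2 ≤ n) (hk : 2 ≤ k) (hq : ∀ t < k, vertex q t = vertex p (i t))
    (h : frechetDist p q ≤ δ) : ∃ j x y, CellPath n k j ∧ Certificate p k i δ j x y := by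
  have hpos : ∀ N : ℕ, δ < δ + 1 / ((N : ℝ) + 1) := fun N => lt_add_of_pos_right _ Nat.one_div_pos_of_nat
  have anti : ∀ N N' : ℕ, N ≤ N' → δ + 1 / ((N' : ℝ) + 1) ≤ δ + 1 / ((N : ℝ) + 1) := fun N N' hN =>
    add_le_add_right (Nat.one_div_le_one_div hN) δ
  obtain ⟨j, hj, hall⟩ : ∃ j, CellPath n k j ∧
      ∀ N : ℕ, ∃ x y, Certificate p k i (δ + 1 / ((N : ℝ) + 1)) j x y := by
    -- If each cell path failed for some `N`, all these `N` would be bounded by some `B`. The cell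
    -- path of a certificate for `B` then contradicts its own failure, since certificates persist
    -- for larger widths.
    by_contra! hcon
    choose! N hN using hcon
    obtain ⟨B, hB⟩ := ((finite_cellPath n k).image N).bddAbove
    obtain ⟨j, x, y, hj, hc⟩ := exists_certificate hn hk hq h (hpos B)
    exact hN j hj x y (hc.mono_width (anti _ _ (hB (mem_image_of_mem N hj))))
  have hcomp : IsCompact ((Set.pi univ fun _ : ℕ => Icc (0 : ℝ) n) ×ˢ
      (Set.pi univ fun _ : ℕ => Icc (0 : ℝ) k)) :=
    (isCompact_univ_pi fun _ => isCompact_Icc).prod (isCompact_univ_pi fun _ => isCompact_Icc)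
  -- The certificates for decreasing widths form a nested sequence of nonempty compact sets.
  obtain ⟨z, hz⟩ := IsCompact.nonempty_iInter_of_sequence_nonempty_isCompact_isClosed
    (fun N : ℕ => {z : (ℕ → ℝ) × (ℕ → ℝ) | Certificate p k i (δ + 1 / ((N : ℝ) + 1)) j z.1 z.2})
    (fun N z hz => Certificate.mono_width hz (by exact_mod_cast anti N (N + 1) (Nat.le_succ N)))
    (fun N => by obtain ⟨x, y, hc⟩ := hall N; exact ⟨(x, y), hc⟩)
    (hcomp.of_isClosed_subset (isClosed_certificate p k i _ j)
      fun z hz => ⟨fun t _ => hz.range.1 t, fun t _ => hz.range.2 t⟩)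
    (fun N => isClosed_certificate p k i _ j)
  rw [mem_iInter] at hz
  have lim : ∀ {a : ℝ}, (∀ N : ℕ, a ≤ δ + 1 / ((N : ℝ) + 1)) → a ≤ δ := by
    intro a ha
    refine le_of_forall_pos_le_add fun ε hε => ?_
    obtain ⟨N, hN⟩ := exists_nat_one_div_lt hε
    linarith [ha N]
  refine ⟨j, z.1, z.2, hj, (hz 0).mem, fun t ht => lim fun N => (hz N).free t ht, (hz 0).mono,
    fun t ht m hm hm' => ⟨((hz 0).pass t ht m hm hm').1, ((hz 0).pass t ht m hm hm').2.1,
      lim fun N => ((hz N).pass t ht m hm hm').2.2⟩, (hz 0).pass_mono, (hz 0).range⟩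

/-- A simplification yields a chain of links from the first to the last vertex. -/
theorem exists_links {d n k : ℕ} {p : Fin n → Pt d} {δ : ℝ} (hn : 2 ≤ n) {s : Fin k → Fin n}
    (h : IsSimplification p δ s) : 0 < k ∧ ∃ (i j : ℕ → ℕ) (x : ℕ → ℝ), i 0 = 0 ∧ j 0 = 0 ∧
      0 ≤ x 0 ∧ i (k - 1) + 1 = n ∧ j (k - 1) = n - 2 ∧
      ∀ t, t + 1 < k → Link p δ (i t) (j t) (x t) (i (t + 1)) (j (t + 1)) (x (t + 1)) := by
  obtain ⟨⟨hs, hk, s0, s1⟩, hF⟩ := h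
  -- With `k = 1` the only selected vertex would be both the first and the last one, which excludes
  -- `n ≥ 2`.
  have hk2 : 2 ≤ k := by
    by_contra! hlt
    obtain rfl : k = 1 := by omega
    simp only [Nat.sub_self] at s1
    omega
  set i : ℕ → ℕ := fun t => if h : t < k then (s ⟨t, h⟩ : ℕ) else 0 with hi
  have ilt : ∀ t, i t < n := fun t => by
    simp only [hi]; split_ifs; exacts [(s _).2, by omega]
  have hq : ∀ t < k, vertex (p ∘ s) t = vertex p (i t) := by
    intro t ht
    rw [vertex_of_lt _ ht, vertex_of_lt _ (ilt t)]
    simp [hi, ht]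
  obtain ⟨j, x, y, ⟨j0, j1, jle, jmono, -⟩, hc⟩ := exists_certificate_self hn hk2 hq hF
  refine ⟨hk, i, j, x, by simp [hi, hk, s0], j0, (hc.range.1 0).1, ?_, j1, fun t ht => ?_⟩
  · simp only [hi, Nat.sub_lt hk Nat.one_pos, dite_true, s1]
  · have hj1 := jle (t + 1)
    obtain ⟨m1, m2⟩ := hc.mem (t + 1) ht
    refine ⟨?_, ilt _, by omega, m1, m2, ?_, ?_⟩
    · simp only [hi, ht, show t < k by omega, dite_true]
      exact hs (by simp [Fin.lt_def])
    · rw [polyline_cell p _ m1 m2]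
      exact hc.free (t + 1) ht
    · rcases (jmono t ht).eq_or_lt with e | hlt
      · exact Or.inl ⟨e, hc.mono t ht⟩
      -- The certificate records parameters of the whole subsequence; heights in a strip are
      -- relative to its segment.
      · refine Or.inr ⟨hlt, fun m => y m - t, fun m hm hm' => ?_, fun m hm hm' => ?_⟩
        · obtain ⟨a, b, c⟩ := hc.pass t ht m hm hm'
          exact ⟨by linarith, by linarith, c⟩
        · have := hc.pass_mono m (by omega)
          linarith

end CurveSimp

/-! ### Shortest paths in the graph of vertex-cell pairs -/

namespace CurveSimp

open Set

/-- `[lo q u v, hi q u v]` is the set of parameters of the points of the segment from vertex `u` to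
vertex `v` that are within distance `δ` of vertex `q`. -/
def IsIntervalTable {d n : ℕ} (p : Fin n → Pt d) (δ : ℝ) (lo hi : ℕ → ℕ → ℕ → ℝ) : Prop :=
  ∀ q u v, q < n → u < n → v < n → ∀ y, (lo q u v ≤ y ∧ y ≤ hi q u v ↔
    0 ≤ y ∧ y ≤ 1 ∧ ‖vertex p q - seg (vertex p u) (vertex p v) y‖ ≤ δ)

/-- There are nondecreasing heights in the intervals `[α m, β m]`, `a < m ≤ b`. -/
def Heights (α β : ℕ → ℝ) (a b : ℕ) : Prop :=
  ∃ y : ℕ → ℝ, (∀ m, a < m → m ≤ b → α m ≤ y m ∧ y m ≤ β m) ∧ ∀ m, a < m → m < b → y m ≤ y (m + 1)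

theorem IsIntervalTable.pass_iff {d n : ℕ} {p : Fin n → Pt d} {δ : ℝ} {lo hi : ℕ → ℕ → ℕ → ℝ}
    (h : IsIntervalTable p δ lo hi) {i' i j' j : ℕ} (hin' : i' < n) (hin : i < n) (hj : j < n) :
    Pass p δ i' i j' j ↔ Heights (fun m => lo m i' i) (fun m => hi m i' i) j' j := by
  constructor
  · rintro ⟨y, hy, hy'⟩
    exact ⟨y, fun m hm hm' => (h m i' i (by omega) hin' hin _).2 (hy m hm hm'), hy'⟩
  · rintro ⟨y, hy, hy'⟩
    exact ⟨y, fun m hm hm' => (h m i' i (by omega) hin' hin _).1 (hy m hm hm'), hy'⟩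

theorem IsIntervalTable.free_iff {d n : ℕ} {p : Fin n → Pt d} {δ : ℝ} {lo hi : ℕ → ℕ → ℕ → ℝ}
    (h : IsIntervalTable p δ lo hi) {i j : ℕ} (hin : i < n) (hj : j + 1 < n) (x : ℝ) :
    (lo i j (j + 1) ≤ x - j ∧ x - j ≤ hi i j (j + 1)) ↔
      ((j : ℝ) ≤ x ∧ x ≤ j + 1 ∧ ‖polyline p x - vertex p i‖ ≤ δ) := by
  rw [h i j (j + 1) hin (by omega) hj]
  constructor
  · rintro ⟨a, b, c⟩
    refine ⟨by linarith, by linarith, ?_⟩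
    rwa [polyline_cell p j (by linarith) (by linarith), norm_sub_rev]
  · rintro ⟨a, b, c⟩
    refine ⟨by linarith, by linarith, ?_⟩
    rwa [← polyline_cell p j a b, norm_sub_rev]

/-- The number of a node: a vertex `i` matched with a point of cell `j`. Kind `0` means that the cell
was entered along the link that ends in `i`, kind `1` that any matching is allowed. -/
def node (n τ i j : ℕ) : ℕ := (i * n + j) * 2 + τ

/-- Number of nodes. -/
def numNodes (n : ℕ) : ℕ := 2 * (n * n)

theorem node_lt {n τ i j : ℕ} (hτ : τ < 2) (hi : i < n) (hj : j < n) :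
    node n τ i j < numNodes n := by
  have : i * n + j + 1 ≤ n * n := by nlinarith
  unfold node numNodes
  omega

theorem node_mod {n τ i j : ℕ} (hτ : τ < 2) (hj : j < n) : node n τ i j % (2 * n) = 2 * j + τ := by
  have h1 : node n τ i j = (2 * j + τ) + (2 * n) * i := by unfold node; ring
  rw [h1, Nat.add_mul_mod_self_left, Nat.mod_eq_of_lt (by omega)]

theorem node_div {n τ i j : ℕ} (hτ : τ < 2) (hj : j < n) : node n τ i j / (2 * n) = i := by
  have h1 : node n τ i j = (2 * j + τ) + (2 * n) * i := by unfold node; ring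
  rw [h1, Nat.add_mul_div_left _ _ (by omega), Nat.div_eq_of_lt (by omega), zero_add]

/-- The number of vertices of a shortest chain that ends in node `u`, if `V u` encodes this number
and the predecessor of `u`. -/
def cost (n : ℕ) (V : ℕ → ℕ) (u : ℕ) : ℕ := V u / numNodes n + 1

/-- The value of a node whose predecessor is `u`. -/
def succValue (n : ℕ) (V : ℕ → ℕ) (u : ℕ) : ℕ := cost n V u * numNodes n + u

/-- The value of nodes that have not been reached. -/
def unreached (n : ℕ) : ℕ := (n + 1) * numNodes n

/-- Some link from vertex `i'` that enters cell `j` before it ends in vertex `i` yields value at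
most `w`. -/
def FreshPred (n : ℕ) (lo hi : ℕ → ℕ → ℕ → ℝ) (V : ℕ → ℕ) (w i' i j : ℕ) : Prop :=
  lo i j (j + 1) ≤ hi i j (j + 1) ∧ ∃ j' < j,
    Heights (fun m => lo m i' i) (fun m => hi m i' i) j' j ∧ succValue n V (node n 1 i' j') ≤ w

/-- A link from vertex `i'` to vertex `i` within cell `j` yields value at most `w`. -/
def SamePred (n : ℕ) (lo hi : ℕ → ℕ → ℕ → ℝ) (V : ℕ → ℕ) (w i' i j : ℕ) : Prop :=
  lo i' j (j + 1) ≤ hi i j (j + 1) ∧ lo i j (j + 1) ≤ hi i j (j + 1) ∧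
    succValue n V (node n 0 i' j) ≤ w

/-- The values of the nodes with vertex `i` take into account all links from vertices below `b`. -/
def RowSpec (n : ℕ) (lo hi : ℕ → ℕ → ℕ → ℝ) (V : ℕ → ℕ) (i b : ℕ) : Prop :=
  ∀ j, j + 1 < n → ∀ w < unreached n,
    (V (node n 0 i j) ≤ w ↔ (i = 0 ∧ j = 0) ∨ ∃ i' < b, FreshPred n lo hi V w i' i j) ∧
    (V (node n 1 i j) ≤ w ↔ (i = 0 ∧ j = 0) ∨
      ∃ i' < b, FreshPred n lo hi V w i' i j ∨ SamePred n lo hi V w i' i j)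

/-- `V` holds the values of all nodes. -/
structure IsValueTable (n : ℕ) (lo hi : ℕ → ℕ → ℕ → ℝ) (V : ℕ → ℕ) : Prop where
  start : V (node n 1 0 0) = 0
  row : ∀ i < n, RowSpec n lo hi V i i

theorem unreached_pos {n : ℕ} (hn : 0 < n) : 0 < unreached n := by
  unfold unreached numNodes; positivity

theorem cost_le_iff {n : ℕ} (hn : 0 < n) (V : ℕ → ℕ) (u c : ℕ) :
    cost n V u ≤ c ↔ V u < c * numNodes n := by
  have : 0 < numNodes n := by unfold numNodes; positivity
  rw [cost, Nat.succ_le_iff, Nat.div_lt_iff_lt_mul this]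

theorem succValue_lt {n : ℕ} {V : ℕ → ℕ} {u c : ℕ} (hu : u < numNodes n)
    (h : cost n V u ≤ c) : succValue n V u < (c + 1) * numNodes n := by
  unfold succValue
  nlinarith [Nat.mul_le_mul_right (numNodes n) h]

/-- Thresholds are meaningful only below `unreached n`. The bound `c ≤ n` keeps the value `succValue
n V u`, which is below `(c + 1) * numNodes n`, in this range. -/
theorem cost_succ_le {n : ℕ} (hn : 0 < n) {V : ℕ → ℕ} {u v c : ℕ} (hu : u < numNodes n)
    (hc : c ≤ n) (h : cost n V u ≤ c)
    (huv : ∀ w < unreached n, succValue n V u ≤ w → V v ≤ w) : cost n V v ≤ c + 1 := by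
  rw [cost_le_iff hn]
  have h1 := succValue_lt hu h
  refine (huv _ (h1.trans_le ?_) le_rfl).trans_lt h1
  exact Nat.mul_le_mul_right _ (by omega)

/-! ### Optimality and soundness of the node values -/

section
variable {d n : ℕ} {p : Fin n → Pt d} {δ : ℝ} {lo hi : ℕ → ℕ → ℕ → ℝ} {V : ℕ → ℕ}

/-- The exchange argument. Besides the node of the chain, the induction follows a vertex `i₀` with
which the current cell was entered, no more expensive than the chain itself and with its lowest free
point not beyond `x t`. A link within the cell is replaced by a link from `i₀`; a link into a later
cell makes its own end the new `i₀`. -/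
theorem cost_le_of_links (hδ : 0 ≤ δ) (hn : 2 ≤ n) (hI : IsIntervalTable p δ lo hi)
    (hV : IsValueTable n lo hi V) {k : ℕ} {i j : ℕ → ℕ} {x : ℕ → ℝ} (hi0 : i 0 = 0)
    (hj0 : j 0 = 0) (hx0 : 0 ≤ x 0)
    (h : ∀ t, t + 1 < k → Link p δ (i t) (j t) (x t) (i (t + 1)) (j (t + 1)) (x (t + 1))) :
    ∀ t < k, cost n V (node n 1 (i t) (j t)) ≤ t + 1 := by
  have hin : ∀ t < k, t ≤ i t ∧ i t < n ∧ j t + 1 < n := by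
    intro t
    induction t with
    | zero => intro _; rw [hi0, hj0]; omega
    | succ t ih =>
      intro ht
      have := ih (by omega)
      have hl := h t ht
      exact ⟨by have := hl.lt; omega, hl.lt_card, hl.cell_lt⟩
  have hfree : ∀ t, t + 1 < k → lo (i (t + 1)) (j (t + 1)) (j (t + 1) + 1) ≤ x (t + 1) - j (t + 1) ∧
      x (t + 1) - j (t + 1) ≤ hi (i (t + 1)) (j (t + 1)) (j (t + 1) + 1) := fun t ht =>
    (hI.free_iff (h t ht).lt_card (h t ht).cell_lt _).2 ⟨(h t ht).le, (h t ht).le_succ, (h t ht).free⟩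
  have f00 : lo 0 0 1 ≤ 0 ∧ 0 ≤ hi 0 0 1 :=
    (hI 0 0 1 (by omega) (by omega) (by omega) 0).2 ⟨le_rfl, zero_le_one, by simpa [seg] using hδ⟩
  have key : ∀ t < k, cost n V (node n 1 (i t) (j t)) ≤ t + 1 ∧ ∃ i₀ ≤ i t,
      lo i₀ (j t) (j t + 1) ≤ x t - j t ∧ cost n V (node n 0 i₀ (j t)) ≤ t + 1 := by
    intro t
    induction t with
    | zero =>
      intro _
      rw [hi0, hj0]
      -- The start counts as fresh in cell `0`; its lowest free point is at most `0` by `f00`.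
      have h0 := ((hV.row 0 (by omega) 0 (by omega) 0 (unreached_pos (by omega))).1.2
        (Or.inl ⟨rfl, rfl⟩))
      have h0' : V (node n 0 0 0) = 0 := by omega
      refine ⟨by simp [cost, hV.start], 0, le_rfl, ?_, by simp [cost, h0']⟩
      simp only [Nat.cast_zero, sub_zero]
      exact f00.1.trans hx0
    | succ t ih =>
      intro ht
      obtain ⟨c1, i₀, hi₀, hlo, c0⟩ := ih (by omega)
      obtain ⟨g1, g2, g3⟩ := hin t (by omega)
      obtain ⟨g1', g2', g3'⟩ := hin (t + 1) ht
      have hlt := (h t ht).lt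
      obtain ⟨b1, b2⟩ := hfree t ht
      rcases (h t ht).step with ⟨e, hxx⟩ | ⟨hj, hP⟩
      · rw [e] at hlo c0
        have hlo' : lo i₀ (j (t + 1)) (j (t + 1) + 1) ≤ x (t + 1) - j (t + 1) := by linarith
        refine ⟨cost_succ_le (by omega) (node_lt (by omega) (by omega) (by omega)) (by omega) c0
          fun w hw hs => ?_, i₀, by omega, hlo', by omega⟩
        exact (hV.row _ g2' _ g3' w hw).2.2
          (Or.inr ⟨i₀, by omega, Or.inr ⟨hlo'.trans b2, b1.trans b2, hs⟩⟩)
      · have hH := (hI.pass_iff g2 g2' (by omega)).1 hP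
        have hlt1 := node_lt (n := n) (τ := 1) (by omega) g2 (show j t < n by omega)
        refine ⟨cost_succ_le (by omega) hlt1 (by omega) c1
          fun w hw hs => ?_, i (t + 1), le_rfl, b1, cost_succ_le (by omega) hlt1 (by omega) c1
          fun w hw hs => ?_⟩
        · exact (hV.row _ g2' _ g3' w hw).2.2
            (Or.inr ⟨i t, hlt, Or.inl ⟨b1.trans b2, j t, hj, hH, hs⟩⟩)
        · exact (hV.row _ g2' _ g3' w hw).1.2
            (Or.inr ⟨i t, hlt, b1.trans b2, j t, hj, hH, hs⟩)
  exact fun t ht => (key t ht).1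

theorem cost_le_of_isSimplification (hδ : 0 ≤ δ) (hn : 2 ≤ n) (hI : IsIntervalTable p δ lo hi)
    (hV : IsValueTable n lo hi V) {k : ℕ} {s : Fin k → Fin n} (hs : IsSimplification p δ s) :
    cost n V (node n 1 (n - 1) (n - 2)) ≤ k := by
  obtain ⟨hk, i, j, x, i0, j0, x0, i1, j1, hl⟩ := exists_links hn hs
  have := cost_le_of_links hδ hn hI hV i0 j0 x0 hl (k - 1) (by omega)
  rw [j1, show i (k - 1) = n - 1 by omega] at this
  omega

/-- Both curves are traversed along the diagonal. This ensures that the optimum has at most `n`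
vertices, so the values on an optimal chain are below `unreached n`. -/
theorem isSimplification_id (hδ : 0 ≤ δ) (hn : 1 ≤ n) : IsSimplification p δ (id : Fin n → Fin n) := by
  refine ⟨⟨strictMono_id, hn, rfl, by simp; omega⟩, frechetDist_le ?_⟩
  have hfun : ∀ k : ℕ, Joined p (p ∘ id) δ 0 0 k k := by
    intro k
    have hz : ∀ z, ‖polyline p z - polyline (p ∘ id) z‖ ≤ δ := fun z => by simpa using hδ
    induction k with
    | zero => simpa using Joined.cell 0 0 (by simp) (by simp) (by simp) (by simp) (by simp) (by simp) (hz 0) (hz 0)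
    | succ k ih => exact ih.trans (Joined.cell k k le_rfl (by simp) (by simp) le_rfl (by simp) (by simp) (hz _) (hz _))
  have := hfun (n - 1)
  rwa [Nat.cast_pred hn] at this

/-- A node without predecessor is the start, any other value comes from a predecessor. -/
theorem IsValueTable.exists_pred (hV : IsValueTable n lo hi V) {τ i j : ℕ} (hτ : τ < 2)
    (hin : i < n) (hj : j + 1 < n) (h : V (node n τ i j) < unreached n) :
    (i = 0 ∧ j = 0 ∧ V (node n τ i j) = 0) ∨ ∃ τ' i' j', τ' < 2 ∧ i' < i ∧ j' ≤ j ∧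
      V (node n τ i j) = succValue n V (node n τ' i' j') ∧ lo i j (j + 1) ≤ hi i j (j + 1) ∧
      ((j' = j ∧ τ' = 0 ∧ τ = 1 ∧ lo i' j (j + 1) ≤ hi i j (j + 1)) ∨
        (j' < j ∧ Heights (fun m => lo m i' i) (fun m => hi m i' i) j' j)) := by
  have hstart : i = 0 ∧ j = 0 → V (node n τ i j) = 0 := by
    intro e
    have hr := hV.row i hin j hj 0 (unreached_pos (by omega))
    obtain rfl | rfl : τ = 0 ∨ τ = 1 := by omega
    · have := hr.1.2 (Or.inl e); omega
    · have := hr.2.2 (Or.inl e); omega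
  by_cases he : i = 0 ∧ j = 0
  · exact Or.inl ⟨he.1, he.2, hstart he⟩
  right
  have hr := hV.row i hin j hj _ h
  -- A predecessor that witnesses the threshold `V (node n τ i j)` also witnesses the threshold
  -- given by its own successor value, so the two are equal.
  have key : ∀ u, succValue n V u ≤ V (node n τ i j) →
      (∀ w < unreached n, succValue n V u ≤ w → V (node n τ i j) ≤ w) →
      V (node n τ i j) = succValue n V u := fun u hu hw =>
    le_antisymm (hw _ (hu.trans_lt h) le_rfl) hu
  have hF : ∀ i' < i, FreshPred n lo hi V (V (node n τ i j)) i' i j →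
      (∀ w < unreached n, FreshPred n lo hi V w i' i j → V (node n τ i j) ≤ w) → _ :=
    fun i' hi' ⟨h1, j', h2, h3, h4⟩ hw =>
      (⟨1, i', j', by omega, hi', h2.le, key _ h4 fun w hwu hs => hw w hwu ⟨h1, j', h2, h3, hs⟩, h1,
        Or.inr ⟨h2, h3⟩⟩ : ∃ τ' i' j', τ' < 2 ∧ i' < i ∧ j' ≤ j ∧
      V (node n τ i j) = succValue n V (node n τ' i' j') ∧ lo i j (j + 1) ≤ hi i j (j + 1) ∧
      ((j' = j ∧ τ' = 0 ∧ τ = 1 ∧ lo i' j (j + 1) ≤ hi i j (j + 1)) ∨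
        (j' < j ∧ Heights (fun m => lo m i' i) (fun m => hi m i' i) j' j)))
  obtain rfl | rfl : τ = 0 ∨ τ = 1 := by omega
  · obtain h0 | ⟨i', hi', hf⟩ := hr.1.1 le_rfl
    · exact absurd h0 he
    · exact hF i' hi' hf fun w hw hf' => (hV.row i hin j hj w hw).1.2 (Or.inr ⟨i', hi', hf'⟩)
  · obtain h0 | ⟨i', hi', hf | ⟨h1, h2, h3⟩⟩ := hr.2.1 le_rfl
    · exact absurd h0 he
    · exact hF i' hi' hf fun w hw hf' =>
        (hV.row i hin j hj w hw).2.2 (Or.inr ⟨i', hi', Or.inl hf'⟩)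
    · exact ⟨0, i', j, by omega, hi', le_rfl, key _ h3 fun w hw hs =>
        (hV.row i hin j hj w hw).2.2 (Or.inr ⟨i', hi', Or.inr ⟨h1, h2, hs⟩⟩), h2,
        Or.inl ⟨rfl, rfl, rfl, h1⟩⟩

theorem succValue_mod {u : ℕ} (hu : u < numNodes n) : succValue n V u % numNodes n = u := by
  rw [succValue, Nat.mul_add_mod', Nat.mod_eq_of_lt hu]

theorem cost_of_eq_succValue {u v : ℕ} (hu : u < numNodes n) (h : V v = succValue n V u) :
    cost n V v = cost n V u + 1 := by
  rw [cost, h, succValue, Nat.mul_comm, Nat.mul_add_div (by omega), Nat.div_eq_of_lt hu, add_zero]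

/-- Following the predecessors from the goal one gets an optimal simplification. -/
theorem isMinSimplification_of_pred (hδ : 0 ≤ δ) (hn : 1 ≤ n) (hI : IsIntervalTable p δ lo hi)
    (hV : IsValueTable n lo hi V) {k : ℕ} (s : Fin k → Fin n) (u : ℕ → ℕ)
    (hk : k = cost n V (node n 1 (n - 1) (n - 2))) (hgoal : u (k - 1) = node n 1 (n - 1) (n - 2))
    (hu : ∀ t, t + 1 < k → u t = V (u (t + 1)) % numNodes n)
    (hs : ∀ t, (s t : ℕ) = u t / (2 * n)) : IsMinSimplification p δ s := by
  -- For `n = 1` there are no cells; truncated subtraction makes the goal coincide with the start,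
  -- whose cost is `1`.
  obtain rfl | hn2 : n = 1 ∨ 2 ≤ n := by omega
  · obtain rfl : k = 1 := by rw [hk, cost, hV.start, Nat.zero_div]
    refine ⟨isSimplification_of_links hδ s one_pos (fun t => u t / (2 * 1)) (fun _ => 0) (fun _ => 0)
      hs ?_ rfl rfl ?_ (by simp) fun t ht => absurd ht (by omega),
      fun k' s' h' => h'.1.2.choose⟩
    · have := (s 0).2
      have := hs 0
      simp at this ⊢; omega
    · have := (s 0).2
      have := hs 0
      simp at this ⊢; omega
  have hmin : ∀ (k' : ℕ) (s' : Fin k' → Fin n), IsSimplification p δ s' → k ≤ k' :=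
    fun k' s' h' => hk ▸ cost_le_of_isSimplification hδ hn2 hI hV h'
  have hkn : k ≤ n := hmin n id (isSimplification_id hδ hn)
  have hkpos : 0 < k := by rw [hk]; exact Nat.succ_pos _
  refine ⟨?_, hmin⟩
  have hcost : ∀ v c, c ≤ n → cost n V v = c → V v < unreached n := fun v c hc hv =>
    ((cost_le_iff hn V v c).1 hv.le).trans_le (Nat.mul_le_mul_right _ (by omega))
  -- node `t` of the chain
  have hnode : ∀ m t, m + t + 1 = k → ∃ τ i j, τ < 2 ∧ i < n ∧ j + 1 < n ∧ u t = node n τ i j ∧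
      cost n V (u t) = t + 1 := by
    intro m
    induction m with
    | zero =>
      intro t ht
      obtain rfl : t = k - 1 := by omega
      exact ⟨1, n - 1, n - 2, by omega, by omega, by omega, hgoal, by rw [hgoal]; omega⟩
    | succ m ih =>
      intro t ht
      obtain ⟨τ, i, j, hτ, hi, hj, e, hc⟩ := ih (t + 1) (by omega)
      rw [e] at hc
      have hlt := hcost _ _ (by omega) hc
      obtain ⟨-, -, h0⟩ | ⟨τ', i', j', hτ', hi', hj', e', -⟩ := hV.exists_pred hτ hi hj hlt
      · simp [cost, h0] at hc
      · have hl := node_lt (n := n) hτ' (hi'.trans hi) (show j' < n by omega)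
        have := cost_of_eq_succValue hl e'
        refine ⟨τ', i', j', hτ', hi'.trans hi, by omega, ?_, ?_⟩
        · rw [hu t (by omega), e, e', succValue_mod hl]
        · rw [hu t (by omega), e, e', succValue_mod hl]; omega
  have hnode' : ∀ t < k, ∃ τ i j, τ < 2 ∧ i < n ∧ j + 1 < n ∧ u t = node n τ i j ∧
      cost n V (u t) = t + 1 := fun t ht => hnode (k - 1 - t) t (by omega)
  have hpred : ∀ t, t + 1 < k → ∀ τ i j, τ < 2 → i < n → j + 1 < n → u (t + 1) = node n τ i j →
      ∃ τ' i' j', τ' < 2 ∧ i' < i ∧ j' ≤ j ∧ u t = node n τ' i' j' ∧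
      lo i j (j + 1) ≤ hi i j (j + 1) ∧
      ((j' = j ∧ τ' = 0 ∧ τ = 1 ∧ lo i' j (j + 1) ≤ hi i j (j + 1)) ∨
        (j' < j ∧ Heights (fun m => lo m i' i) (fun m => hi m i' i) j' j)) := by
    intro t ht τ i j hτ hi hj e
    obtain ⟨_, _, _, -, -, -, -, hc⟩ := hnode' (t + 1) ht
    have hlt := hcost _ _ (by omega) hc
    rw [e] at hlt hc
    obtain ⟨-, -, h0⟩ | ⟨τ', i', j', hτ', hi', hj', e', h⟩ := hV.exists_pred hτ hi hj hlt
    · simp [cost, h0] at hc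
    · have hl := node_lt (n := n) hτ' (hi'.trans hi) (show j' < n by omega)
      exact ⟨τ', i', j', hτ', hi', hj', by rw [hu t ht, e, e', succValue_mod hl], h⟩
  set i : ℕ → ℕ := fun t => u t / (2 * n) with hidef
  set j : ℕ → ℕ := fun t => u t % (2 * n) / 2 with hjdef
  set τ : ℕ → ℕ := fun t => u t % 2 with hτdef
  have decode : ∀ t τ' i' j', τ' < 2 → j' < n → u t = node n τ' i' j' →
      τ t = τ' ∧ i t = i' ∧ j t = j' := by
    intro t τ' i' j' h1 h2 e
    refine ⟨?_, ?_, ?_⟩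
    · simp only [hτdef, e, node]; omega
    · simp only [hidef, e, node_div h1 h2]
    · simp only [hjdef, e, node_mod h1 h2]; omega
  have hnd : ∀ t < k, τ t < 2 ∧ i t < n ∧ j t + 1 < n ∧ u t = node n (τ t) (i t) (j t) := by
    intro t ht
    obtain ⟨τ', i', j', h1, h2, h3, e, -⟩ := hnode' t ht
    obtain ⟨e1, e2, e3⟩ := decode t τ' i' j' h1 (by omega) e
    rw [e1, e2, e3]
    exact ⟨h1, h2, h3, e⟩
  have hp : ∀ t, t + 1 < k → i t < i (t + 1) ∧ lo (i (t + 1)) (j (t + 1)) (j (t + 1) + 1) ≤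
      hi (i (t + 1)) (j (t + 1)) (j (t + 1) + 1) ∧ ((j t = j (t + 1) ∧ τ t = 0 ∧ τ (t + 1) = 1 ∧
      lo (i t) (j (t + 1)) (j (t + 1) + 1) ≤ hi (i (t + 1)) (j (t + 1)) (j (t + 1) + 1)) ∨
      (j t < j (t + 1) ∧ Heights (fun m => lo m (i t) (i (t + 1)))
        (fun m => hi m (i t) (i (t + 1))) (j t) (j (t + 1)))) := by
    intro t ht
    obtain ⟨h1, h2, h3, e⟩ := hnd (t + 1) ht
    obtain ⟨τ', i', j', g1, g2, g3, e', g4, g5⟩ := hpred t ht _ _ _ h1 h2 h3 e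
    obtain ⟨e1, e2, e3⟩ := decode t τ' i' j' g1 (by omega) e'
    rw [e1, e2, e3]
    exact ⟨g2, g4, g5⟩
  have hend : i (k - 1) = n - 1 ∧ j (k - 1) = n - 2 :=
    (decode _ _ _ _ (by omega) (by omega) hgoal).2
  -- Node `0` has cost `1`, so a predecessor would have cost `0`, while costs are positive.
  have h00 : i 0 = 0 ∧ j 0 = 0 := by
    obtain ⟨h1, h2, h3, e⟩ := hnd 0 hkpos
    obtain ⟨_, _, _, -, -, -, -, hc⟩ := hnode' 0 hkpos
    have hlt := hcost _ _ (by omega) hc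
    rw [e] at hlt hc
    obtain ⟨e1, e2, -⟩ | ⟨τ', i', j', hτ', hi', hj', e', -⟩ := hV.exists_pred h1 h2 h3 hlt
    · exact ⟨e1, e2⟩
    · have := cost_of_eq_succValue (node_lt hτ' (hi'.trans h2) (show j' < n by omega)) e'
      have : 0 < cost n V (node n τ' i' j') := Nat.succ_pos _
      omega
  have hk2 : 2 ≤ k := by
    by_contra! hlt
    obtain rfl : k = 1 := by omega
    have := hend.1
    rw [Nat.sub_self, h00.1] at this
    omega
  -- the matched parameters, relative to their cells
  set L : ℕ → ℝ := fun t => lo (i t) (j t) (j t + 1) with hL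
  set c : ℕ → ℝ := fun t => if t = 0 then 0 else if τ t = 0 then L t else
    if j (t - 1) = j t then max (L (t - 1)) (L t) else L t with hc
  -- A fresh node takes its lowest free point. A node that stays in the cell of its predecessor
  -- takes the lowest free point that is not below the lowest one of the predecessor; the latter has
  -- kind `0`, so this is its own choice unless it is the start, which takes `0`.
  have hcell : ∀ t, t + 1 < k → 0 ≤ L (t + 1) ∧ L (t + 1) ≤ c (t + 1) ∧
      c (t + 1) ≤ hi (i (t + 1)) (j (t + 1)) (j (t + 1) + 1) ∧ c (t + 1) ≤ 1 ∧
      (j t = j (t + 1) → c t ≤ c (t + 1)) := by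
    intro t ht
    obtain ⟨h1, h2, h3, -⟩ := hnd (t + 1) ht
    obtain ⟨g1, g2, g3⟩ := hp t ht
    have hle : L (t + 1) ≤ c (t + 1) := by
      simp only [hc, Nat.add_one_ne_zero, if_false, Nat.add_sub_cancel]
      split_ifs
      exacts [le_rfl, le_max_right _ _, le_rfl]
    have hhi : c (t + 1) ≤ hi (i (t + 1)) (j (t + 1)) (j (t + 1) + 1) := by
      simp only [hc, Nat.add_one_ne_zero, if_false, Nat.add_sub_cancel]
      split_ifs with q1 q2
      · exact g2
      · rcases g3 with ⟨e, -, -, hl⟩ | ⟨hlt, -⟩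
        · refine max_le ?_ g2
          simp only [hL, e]
          exact hl
        · omega
      · exact g2
    have q0 := (hI _ _ _ h2 (show j (t + 1) < n by omega) h3 _).1 ⟨le_rfl, g2⟩
    have q1 := (hI _ _ _ h2 (show j (t + 1) < n by omega) h3 _).1 ⟨hle, hhi⟩
    refine ⟨q0.1, hle, hhi, q1.2.1, fun e => ?_⟩
    by_cases ht0 : t = 0
    · subst ht0
      simpa [hc] using q0.1.trans hle
    · rcases g3 with ⟨-, e1, e2, -⟩ | ⟨hlt, -⟩
      · simp [hc, ht0, e1, e2, e]
      · omega
  have hfree : ∀ t, t + 1 < k → ((j (t + 1) : ℝ) ≤ j (t + 1) + c (t + 1) ∧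
      j (t + 1) + c (t + 1) ≤ (j (t + 1) : ℝ) + 1 ∧
      ‖polyline p (j (t + 1) + c (t + 1)) - vertex p (i (t + 1))‖ ≤ δ) := by
    intro t ht
    obtain ⟨h1, h2, h3, -⟩ := hnd (t + 1) ht
    refine (hI.free_iff h2 h3 _).1 ?_
    rw [add_sub_cancel_left]
    exact ⟨(hcell t ht).2.1, (hcell t ht).2.2.1⟩
  have hnj : ((n : ℝ) - 1) = (j (k - 1) : ℝ) + 1 := by
    rw [hend.2, Nat.cast_sub hn2]; push_cast; ring
  -- The last vertex is matched with the end of the curve instead. This is its own position, hence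
  -- free, and only moves the parameter upwards within the last cell.
  refine isSimplification_of_links hδ s hkpos i j
    (fun t => if t + 1 = k then (n : ℝ) - 1 else j t + c t) hs h00.1 h00.2 ?_ (by omega) ?_ ?_
  · rw [if_neg (by omega), h00.2]; simp [hc]
  · rw [if_pos (by omega)]
  · intro t ht
    obtain ⟨h1, h2, h3, -⟩ := hnd (t + 1) ht
    obtain ⟨g1, g2, g3⟩ := hp t ht
    rw [if_neg (by omega)]
    have hstep : ∀ x : ℝ, j (t + 1) + c (t + 1) ≤ x → (j t = j (t + 1) ∧ j t + c t ≤ x) ∨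
        (j t < j (t + 1) ∧ Pass p δ (i t) (i (t + 1)) (j t) (j (t + 1))) := by
      intro x hx
      rcases g3 with ⟨e, -⟩ | ⟨hlt, hH⟩
      · refine Or.inl ⟨e, ?_⟩
        have := (hcell t ht).2.2.2.2 e
        rw [e]; linarith
      · exact Or.inr ⟨hlt, (hI.pass_iff (g1.trans h2) h2 (by omega)).2 hH⟩
    split_ifs with hlast
    · have e : t + 1 = k - 1 := by omega
      refine ⟨g1, h2, h3, ?_, ?_, ?_, hstep _ ?_⟩
      · rw [hnj, e]; linarith
      · rw [hnj, e]
      · rw [e, hend.1, ← Nat.cast_pred (by omega), polyline_natCast]; simpa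
      · rw [hnj, e]
        have := (hcell t ht).2.2.2.1
        rw [e] at this; linarith
    · obtain ⟨f1, f2, f3⟩ := hfree t ht
      exact ⟨g1, h2, h3, f1, f2, f3, hstep _ le_rfl⟩

end

end CurveSimp

namespace CurveSimp

open Set

/-! ### Reachability in a strip, with a monotone queue -/

/-- Some entry `j' < j` of value at most `v` leads, above vertices `j' + 1, …, j - 1`, to a height
of at most `y`. -/
def StripReach (α β : ℕ → ℝ) (lam : ℕ → ℕ) (v : ℕ) : ℕ → ℝ → Prop
  | 0, _ => False
  | j + 1, y => lam j ≤ v ∨ (α j ≤ β j ∧ α j ≤ y ∧ StripReach α β lam v j (min y (β j)))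

/-- Induction peels off the last vertex. Backwards, all that matters about the heights above it is
the cap `min Y (β j)`, which they impose on the vertex before. -/
theorem stripReach_iff (α β : ℕ → ℝ) (lam : ℕ → ℕ) (v j : ℕ) (Y : ℝ) :
    (α j ≤ β j ∧ α j ≤ Y ∧ StripReach α β lam v j (min Y (β j))) ↔
      ∃ j' < j, lam j' ≤ v ∧ ∃ y : ℕ → ℝ, (∀ m, j' < m → m ≤ j → α m ≤ y m ∧ y m ≤ β m) ∧
        (∀ m, j' < m → m < j → y m ≤ y (m + 1)) ∧ y j ≤ Y := by
  induction j generalizing Y with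
  | zero => simp [StripReach]
  | succ j ih =>
    constructor
    · rintro ⟨h1, h2, h3 | h3⟩
      · refine ⟨j, by omega, h3, fun _ => α (j + 1), fun m hm hm' => ?_, fun _ _ _ => le_rfl, h2⟩
        obtain rfl : m = j + 1 := by omega
        exact ⟨le_rfl, h1⟩
      · obtain ⟨j', hj', hv, y, hy, hy', hY⟩ := (ih _).1 h3
        -- The new height is the least one that is admissible and not below the preceding height.
        refine ⟨j', by omega, hv, fun m => if m = j + 1 then max (α (j + 1)) (y j) else y m,
          fun m hm hm' => ?_, fun m hm hm' => ?_, ?_⟩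
        · beta_reduce
          split_ifs with h
          · subst h
            exact ⟨le_max_left _ _, max_le h1 (hY.trans (min_le_right _ _))⟩
          · exact hy m hm (by omega)
        · beta_reduce
          rw [if_neg (by omega)]
          split_ifs with h
          · obtain rfl : m = j := by omega
            exact le_max_right _ _
          · exact hy' m hm (by omega)
        · beta_reduce
          rw [if_pos rfl]
          exact max_le h2 (hY.trans (min_le_left _ _))
    · rintro ⟨j', hj', hv, y, hy, hy', hY⟩
      obtain ⟨a, b⟩ := hy (j + 1) (by omega) le_rfl
      refine ⟨a.trans b, a.trans hY, ?_⟩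
      rcases Nat.lt_succ_iff_lt_or_eq.1 hj' with hlt | rfl
      · exact Or.inr ((ih _).2 ⟨j', hlt, hv, y, fun m hm hm' => hy m hm (by omega),
          fun m hm hm' => hy' m hm (by omega),
          (hy' j hlt (by omega)).trans (le_min hY b)⟩)
      · exact Or.inl hv

theorem exists_stripReach_iff (α β : ℕ → ℝ) (lam : ℕ → ℕ) (v j : ℕ) :
    (∃ Y, α j ≤ β j ∧ α j ≤ Y ∧ StripReach α β lam v j (min Y (β j))) ↔
      ∃ j' < j, Heights α β j' j ∧ lam j' ≤ v := by
  simp only [stripReach_iff, Heights]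
  constructor
  · rintro ⟨Y, j', h1, h2, y, h3, h4, -⟩
    exact ⟨j', h1, ⟨y, h3, h4⟩, h2⟩
  · rintro ⟨j', h1, ⟨y, h3, h4⟩, h2⟩
    exact ⟨y j, j', h1, h2, y, h3, h4, le_rfl⟩

/-- The queue `(H a, G a)`, `hd ≤ a < tl`, together with the pending value `cur`, describes the
heights at which vertex `j` of the strip may be approached, for values below `N`. -/
structure IsQueue (α β : ℕ → ℝ) (lam : ℕ → ℕ) (N : ℕ) (H : ℕ → ℝ) (G : ℕ → ℕ)
    (j hd tl cur : ℕ) : Prop where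
  sorted : ∀ a b, hd ≤ a → a < b → b < tl → H b < H a ∧ G a < G b
  reach : ∀ v < N, ∀ y, α j ≤ y → y ≤ β j →
    ((cur ≤ v ∨ ∃ a, hd ≤ a ∧ a < tl ∧ H a ≤ y ∧ G a ≤ v) ↔ StripReach α β lam v j y)

section
variable {α β : ℕ → ℝ} {lam : ℕ → ℕ} {N : ℕ} {H : ℕ → ℝ} {G : ℕ → ℕ} {j hd tl cur : ℕ}

/-- The head requires a height above the interval of vertex `j`, so it can no longer be used. -/
theorem IsQueue.popFront (h : IsQueue α β lam N H G j hd tl cur) (hH : β j < H hd) :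
    IsQueue α β lam N H G j (hd + 1) tl cur := by
  refine ⟨fun a b ha => h.sorted a b (by omega), fun v hv y hy hy' => ?_⟩
  rw [← h.reach v hv y hy hy']
  refine or_congr Iff.rfl ⟨fun ⟨a, h1, h2⟩ => ⟨a, by omega, h2⟩, fun ⟨a, h1, h2, h3, h4⟩ => ?_⟩
  refine ⟨a, ?_, h2, h3, h4⟩
  rcases h1.eq_or_lt with rfl | h1
  · linarith
  · exact h1

/-- The pending entry is available at all admissible heights, so it dominates an element of no
smaller value. -/
theorem IsQueue.popBack_of_le (h : IsQueue α β lam N H G j hd (tl + 1) cur) (hG : cur ≤ G tl) :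
    IsQueue α β lam N H G j hd tl cur := by
  refine ⟨fun a b ha hab hb => h.sorted a b ha hab (by omega), fun v hv y hy hy' => ?_⟩
  rw [← h.reach v hv y hy hy']
  constructor
  · rintro (h1 | ⟨a, h1, h2, h3⟩)
    exacts [Or.inl h1, Or.inr ⟨a, h1, by omega, h3⟩]
  · rintro (h1 | ⟨a, h1, h2, h3, h4⟩)
    · exact Or.inl h1
    · rcases Nat.lt_succ_iff_lt_or_eq.1 h2 with h2 | rfl
      · exact Or.inr ⟨a, h1, h2, h3, h4⟩
      · exact Or.inl (hG.trans h4)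

/-- An element of height at most `α j` has become available at all admissible heights. If its value
is no worse, it takes over the role of the pending entry. -/
theorem IsQueue.popBack_of_low (h : IsQueue α β lam N H G j hd (tl + 1) cur) (hd_le : hd ≤ tl)
    (hG : G tl ≤ cur) (hH : H tl ≤ α j) : IsQueue α β lam N H G j hd tl (G tl) := by
  refine ⟨fun a b ha hab hb => h.sorted a b ha hab (by omega), fun v hv y hy hy' => ?_⟩
  rw [← h.reach v hv y hy hy']
  constructor
  · rintro (h1 | ⟨a, h1, h2, h3⟩)
    exacts [Or.inr ⟨tl, hd_le, by omega, hH.trans hy, h1⟩, Or.inr ⟨a, h1, by omega, h3⟩]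
  · rintro (h1 | ⟨a, h1, h2, h3, h4⟩)
    · exact Or.inl (hG.trans h1)
    · rcases Nat.lt_succ_iff_lt_or_eq.1 h2 with h2 | rfl
      · exact Or.inr ⟨a, h1, h2, h3, h4⟩
      · exact Or.inl h4

/-- The situation after vertex `j` has been passed: the first element of the queue has the smallest
value. -/
structure IsPassed (α β : ℕ → ℝ) (lam : ℕ → ℕ) (N : ℕ) (H : ℕ → ℝ) (G : ℕ → ℕ)
    (j hd tl : ℕ) : Prop where
  sorted : ∀ a b, hd ≤ a → a < b → b < tl → H b < H a ∧ G a < G b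
  reach : ∀ v < N, ∀ y, ((∃ a, hd ≤ a ∧ a < tl ∧ H a ≤ y ∧ G a ≤ v) ↔
    (α j ≤ β j ∧ α j ≤ y ∧ StripReach α β lam v j (min y (β j))))

/-- When no pop applies, the pending entry is lower in height and larger in value than everything in
the queue. Appending it at height `α j` keeps the queue sorted. -/
theorem IsQueue.push (h : IsQueue α β lam N H G j hd tl cur) (hab : α j ≤ β j)
    (hf : hd < tl → H hd ≤ β j) (hl : hd < tl → G (tl - 1) < cur ∧ α j < H (tl - 1))
    (hle : hd ≤ tl) :
    IsPassed α β lam N (Function.update H tl (α j)) (Function.update G tl cur) j hd (tl + 1) := by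
  have hlow : ∀ a, hd ≤ a → a < tl → G a < cur ∧ α j < H a := by
    intro a ha hat
    obtain ⟨h1, h2⟩ := hl (by omega)
    rcases (show a ≤ tl - 1 by omega).eq_or_lt with rfl | hlt
    · exact ⟨h1, h2⟩
    · obtain ⟨h3, h4⟩ := h.sorted a (tl - 1) ha hlt (by omega)
      exact ⟨h4.trans h1, h2.trans h3⟩
  have hhigh : ∀ a, hd ≤ a → a < tl → H a ≤ β j := by
    intro a ha hat
    rcases ha.eq_or_lt with rfl | hlt
    · exact hf hat
    · exact (h.sorted hd a le_rfl hlt hat).1.le.trans (hf (by omega))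
  refine ⟨fun a b ha hlt hb => ?_, fun v hv y => ?_⟩
  · rw [Function.update_of_ne (show a ≠ tl by omega), Function.update_of_ne (show a ≠ tl by omega)]
    rcases Nat.lt_succ_iff_lt_or_eq.1 hb with hb | rfl
    · rw [Function.update_of_ne (show b ≠ tl by omega), Function.update_of_ne (show b ≠ tl by omega)]
      exact h.sorted a b ha hlt hb
    · rw [Function.update_self, Function.update_self]
      exact (hlow a ha hlt).symm
  · constructor
    · rintro ⟨a, h1, h2, h3, h4⟩
      rcases Nat.lt_succ_iff_lt_or_eq.1 h2 with h2 | rfl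
      · rw [Function.update_of_ne (show a ≠ tl by omega)] at h3 h4
        have h5 := (hlow a h1 h2).2
        refine ⟨hab, h5.le.trans h3, ?_⟩
        rw [← h.reach v hv _ (le_min (h5.le.trans h3) hab) (min_le_right _ _)]
        exact Or.inr ⟨a, h1, h2, le_min h3 (hhigh a h1 h2), h4⟩
      · rw [Function.update_self] at h3 h4
        refine ⟨hab, h3, ?_⟩
        rw [← h.reach v hv _ (le_min h3 hab) (min_le_right _ _)]
        exact Or.inl h4
    · rintro ⟨-, h1, h2⟩
      rw [← h.reach v hv _ (le_min h1 hab) (min_le_right _ _)] at h2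
      rcases h2 with h2 | ⟨a, h2, h3, h4, h5⟩
      · exact ⟨tl, hle, by omega, by rwa [Function.update_self], by rwa [Function.update_self]⟩
      · refine ⟨a, h2, by omega, ?_, ?_⟩ <;> rw [Function.update_of_ne (show a ≠ tl by omega)]
        exacts [h4.trans (min_le_left _ _), h5]

theorem IsPassed.empty (hab : β j < α j) (hd : ℕ) : IsPassed α β lam N H G j hd hd :=
  ⟨fun a b _ _ _ => by omega, fun v _ y =>
    ⟨fun ⟨a, h1, h2, _⟩ => by omega, fun h => absurd h.1 (not_le.2 hab)⟩⟩

theorem IsPassed.next (h : IsPassed α β lam N H G j hd tl) :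
    IsQueue α β lam N H G (j + 1) hd tl (lam j) :=
  ⟨h.sorted, fun v hv y _ _ => or_congr Iff.rfl (h.reach v hv y)⟩

/-- The payoff of the order: the best entry is read off at the head in constant time. -/
theorem IsPassed.head_le_iff (h : IsPassed α β lam N H G j hd tl) {v : ℕ} (hv : v < N) :
    (hd < tl ∧ G hd ≤ v) ↔ ∃ j' < j, Heights α β j' j ∧ lam j' ≤ v := by
  rw [← exists_stripReach_iff]
  constructor
  · rintro ⟨h1, h2⟩
    exact ⟨H hd, (h.reach v hv _).1 ⟨hd, le_rfl, h1, le_rfl, h2⟩⟩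
  · rintro ⟨Y, hY⟩
    obtain ⟨a, h1, h2, -, h4⟩ := (h.reach v hv _).2 hY
    refine ⟨by omega, ?_⟩
    rcases h1.eq_or_lt with rfl | hlt
    · exact h4
    · exact (h.sorted hd a le_rfl hlt h2).2.le.trans h4

/-- No entry precedes vertex `0`. Only values below `N` are compared, so the pending value `N` acts
as infinity. -/
theorem isQueue_init (α β : ℕ → ℝ) (lam : ℕ → ℕ) (N : ℕ) (H : ℕ → ℝ) (G : ℕ → ℕ) :
    IsQueue α β lam N H G 0 0 0 N :=
  ⟨fun a b _ _ _ => by omega, fun v hv y _ _ =>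
    ⟨fun h => by rcases h with h | ⟨a, h1, h2, _⟩ <;> omega, False.elim⟩⟩

end

/-! ### Intersection of a segment and a ball -/

/-- Smallest solution in `[0, 1]` of `a y ^ 2 + 2 b y + c ≤ 0`. -/
noncomputable def quadLo (a b c : ℝ) : ℝ :=
  if 0 < a then if b * b - a * c < 0 then 1 else max ((0 - b - √(b * b - a * c)) / a) 0
  else if 0 < c then 1 else 0

/-- Largest solution in `[0, 1]` of `a y ^ 2 + 2 b y + c ≤ 0`. -/
noncomputable def quadHi (a b c : ℝ) : ℝ :=
  if 0 < a then if b * b - a * c < 0 then 0 else min ((√(b * b - a * c) - b) / a) 1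
  else if 0 < c then 0 else 1

/-- Multiplied by `a`, the polynomial is `(a * y + b) ^ 2 - (b * b - a * c)`. An empty solution set
appears as an interval whose lower end exceeds its upper end. -/
theorem quad_iff {a b c : ℝ} (hb : ¬ 0 < a → a = 0 ∧ b = 0) (y : ℝ) :
    (quadLo a b c ≤ y ∧ y ≤ quadHi a b c) ↔
      0 ≤ y ∧ y ≤ 1 ∧ a * y ^ 2 + 2 * b * y + c ≤ 0 := by
  unfold quadLo quadHi
  split_ifs with h1 h2 h3
  · refine ⟨fun ⟨h, h'⟩ => by linarith, fun ⟨_, _, h⟩ => ?_⟩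
    nlinarith [sq_nonneg (a * y + b)]
  · push Not at h2
    rw [max_le_iff, le_min_iff, div_le_iff₀ h1, le_div_iff₀ h1]
    have key : a * y ^ 2 + 2 * b * y + c ≤ 0 ↔ |a * y + b| ≤ √(b * b - a * c) := by
      rw [← sq_le_sq₀ (abs_nonneg _) (Real.sqrt_nonneg _), Real.sq_sqrt h2, sq_abs]
      constructor
      · intro h; nlinarith
      · intro h
        by_contra! h3
        nlinarith [mul_pos h1 h3]
    rw [key, abs_le]
    constructor
    · rintro ⟨⟨h3, h4⟩, h5, h6⟩
      exact ⟨h4, h6, by linarith, by linarith⟩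
    · rintro ⟨h3, h4, h5, h6⟩
      exact ⟨⟨by linarith, h3⟩, by linarith, h4⟩
  · refine ⟨fun ⟨h, h'⟩ => by linarith, fun ⟨_, _, h⟩ => ?_⟩
    obtain ⟨rfl, rfl⟩ := hb h1
    linarith
  · obtain ⟨rfl, rfl⟩ := hb h1
    constructor
    · exact fun ⟨h, h'⟩ => ⟨h, h', by linarith⟩
    · exact fun ⟨h, h', _⟩ => ⟨h, h'⟩

/-- Coordinate `c` of vertex `i`. -/
noncomputable def coord {d n : ℕ} (p : Fin n → Pt d) (i : ℕ) (c : Fin d) : ℝ := vertex p i c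

noncomputable def quadA {d n : ℕ} (p : Fin n → Pt d) (u v : ℕ) : ℝ :=
  ∑ c, (coord p v c - coord p u c) * (coord p v c - coord p u c)

noncomputable def quadB {d n : ℕ} (p : Fin n → Pt d) (q u v : ℕ) : ℝ :=
  ∑ c, (coord p u c - coord p q c) * (coord p v c - coord p u c)

noncomputable def quadC {d n : ℕ} (p : Fin n → Pt d) (δ : ℝ) (q u : ℕ) : ℝ :=
  ∑ c, (coord p u c - coord p q c) * (coord p u c - coord p q c) - δ * δ

noncomputable def loFun {d n : ℕ} (p : Fin n → Pt d) (δ : ℝ) (q u v : ℕ) : ℝ :=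
  quadLo (quadA p u v) (quadB p q u v) (quadC p δ q u)

noncomputable def hiFun {d n : ℕ} (p : Fin n → Pt d) (δ : ℝ) (q u v : ℕ) : ℝ :=
  quadHi (quadA p u v) (quadB p q u v) (quadC p δ q u)

/-- In coordinates, the squared distance minus `δ ^ 2` is the quadratic polynomial with these
coefficients. For a degenerate segment `quadA` vanishes, hence all coordinate differences and
`quadB` do. -/
theorem isIntervalTable {d n : ℕ} (p : Fin n → Pt d) {δ : ℝ} (hδ : 0 ≤ δ) :
    IsIntervalTable p δ (loFun p δ) (hiFun p δ) := by
  intro q u v _ _ _ y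
  rw [loFun, hiFun, quad_iff]
  · refine and_congr_right fun _ => and_congr_right fun _ => ?_
    have : ‖vertex p q - seg (vertex p u) (vertex p v) y‖ ^ 2 - δ * δ =
        quadA p u v * y ^ 2 + 2 * quadB p q u v * y + quadC p δ q u := by
      rw [EuclideanSpace.norm_sq_eq, quadA, quadB, quadC, Finset.mul_sum, Finset.sum_mul,
        Finset.sum_mul, ← add_sub_assoc, ← Finset.sum_add_distrib, ← Finset.sum_add_distrib]
      congr 1
      refine Finset.sum_congr rfl fun c _ => ?_
      simp only [seg, coord, Real.norm_eq_abs, sq_abs, PiLp.sub_apply, PiLp.add_apply,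
        PiLp.smul_apply, smul_eq_mul]
      ring
    rw [← this, sub_nonpos, ← sq, sq_le_sq₀ (norm_nonneg _) hδ]
  · intro h
    have h0 : quadA p u v = 0 :=
      le_antisymm (not_lt.1 h) (Finset.sum_nonneg fun c _ => mul_self_nonneg _)
    refine ⟨h0, Finset.sum_eq_zero fun c _ => ?_⟩
    have := (Finset.sum_eq_zero_iff_of_nonneg fun c _ => mul_self_nonneg _).1 h0 c
      (Finset.mem_univ c)
    rw [mul_self_eq_zero] at this
    rw [this, mul_zero]

end CurveSimp

/-! ### The program -/

namespace CurveSimp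

open RealPRAM

local notation "xN" => (0 : Fin numVars)
local notation "xT" => (2 : Fin numVars)
local notation "xQ" => (3 : Fin numVars)
local notation "xU" => (4 : Fin numVars)
local notation "xV" => (5 : Fin numVars)
local notation "xX" => (6 : Fin numVars)
local notation "xI" => (7 : Fin numVars)
local notation "xP" => (8 : Fin numVars)
local notation "xJ" => (9 : Fin numVars)
local notation "xHd" => (10 : Fin numVars)
local notation "xTl" => (11 : Fin numVars)
local notation "xCur" => (12 : Fin numVars)
local notation "rA" => (0 : Fin numVars)
local notation "rB" => (1 : Fin numVars)
local notation "rC" => (2 : Fin numVars)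
local notation "rS" => (3 : Fin numVars)
local notation "rLo" => (4 : Fin numVars)
local notation "rHi" => (5 : Fin numVars)

/-- Number of memory cells that the program uses. -/
def space (d n : ℕ) : ℕ := n * d + 2 * (n * n * n) + 2 * (n * n) + 3 * n + 3

/-- A bound on all natural numbers that occur. -/
def wordBound (d n : ℕ) : ℕ := 12 * (n * d + n * n * n + n * n + n + 1) + d

/-- Address of interval end `k` (`0` for the lower one) of vertex `q` and segment `(u, v)`. -/
def tableAddr (d n k q u v : ℕ) : ℕ := n * d + 1 + (2 * ((q * n + u) * n + v) + k)

/-- In real memory the queue heights come after the input and the table of intervals. -/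
def heightAddr (d n a : ℕ) : ℕ := n * d + 1 + (2 * (n * n * n) + a)

/-- Natural cells `0, …, n` are left free for the output. -/
def valueAddr (n u : ℕ) : ℕ := n + 1 + u

def queueAddr (n a : ℕ) : ℕ := n + 1 + (numNodes n + a)

section
variable (d : ℕ)

def nodeE (τ : ℕ) (a b : NExp) : NExp := (a * .var xN + b) * .const 2 + .const τ

def numNodesE : NExp := .const 2 * (.var xN * .var xN)

def unreachedE : NExp := (.var xN + .const 1) * numNodesE

def valueAddrE (e : NExp) : NExp := .var xN + .const 1 + e

def queueAddrE (a : NExp) : NExp := .var xN + .const 1 + (numNodesE + a)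

def heightAddrE (a : NExp) : NExp :=
  .var xN * .const d + .const 1 + (.const 2 * (.var xN * .var xN * .var xN) + a)

def tableAddrE (k : ℕ) (q u v : NExp) : NExp :=
  .var xN * .const d + .const 1 + (.const 2 * ((q * .var xN + u) * .var xN + v) + .const k)

def succValueE (τ : ℕ) (a b : NExp) : NExp :=
  (.load (valueAddrE (nodeE τ a b)) / numNodesE + .const 1) * numNodesE + nodeE τ a b

def coordE (a : NExp) (c : Fin d) : RExp := .load (a * .const d + .const c)

end

/-- The part of the memory that holds values of nodes. -/
def valueMem (n : ℕ) (s : State) : ℕ → ℕ := fun u => s.nm (valueAddr n u)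

def queueMem (n : ℕ) (s : State) : ℕ → ℕ := fun a => s.nm (queueAddr n a)

noncomputable def heightMem (d n : ℕ) (s : State) : ℕ → ℝ := fun a => s.rm (heightAddr d n a)

/-! ### Values and safety of the address expressions -/

section
variable {d n M W : ℕ} {s : State}

@[simp] theorem nodeE_val (hn : s.n xN = n) (τ : ℕ) (a b : NExp) :
    (nodeE τ a b).val s = node n τ (a.val s) (b.val s) := by
  simp [nodeE, node, hn]

@[simp] theorem numNodesE_val (hn : s.n xN = n) : numNodesE.val s = numNodes n := by
  simp [numNodesE, numNodes, hn]

@[simp] theorem unreachedE_val (hn : s.n xN = n) : unreachedE.val s = unreached n := by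
  simp [unreachedE, unreached, hn]

@[simp] theorem valueAddrE_val (hn : s.n xN = n) (e : NExp) :
    (valueAddrE e).val s = valueAddr n (e.val s) := by
  simp [valueAddrE, valueAddr, hn]

@[simp] theorem queueAddrE_val (hn : s.n xN = n) (e : NExp) :
    (queueAddrE e).val s = queueAddr n (e.val s) := by
  simp [queueAddrE, queueAddr, hn]

@[simp] theorem heightAddrE_val (hn : s.n xN = n) (e : NExp) :
    (heightAddrE d e).val s = heightAddr d n (e.val s) := by
  simp [heightAddrE, heightAddr, hn]

@[simp] theorem tableAddrE_val (hn : s.n xN = n) (k : ℕ) (q u v : NExp) :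
    (tableAddrE d k q u v).val s = tableAddr d n k (q.val s) (u.val s) (v.val s) := by
  simp [tableAddrE, tableAddr, hn]

@[simp] theorem succValueE_val (hn : s.n xN = n) (τ : ℕ) (a b : NExp) :
    (succValueE τ a b).val s = succValue n (valueMem n s) (node n τ (a.val s) (b.val s)) := by
  simp [succValueE, succValue, cost, valueMem, hn]

theorem mul_add_lt {n i j : ℕ} (hi : i < n) (hj : j < n) : i * n + j < n * n := by nlinarith

theorem numNodesE_safe (hW : wordBound d n ≤ W) (hn : s.n xN = n) : numNodesE.Safe M W s := by
  unfold wordBound at hW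
  simp only [numNodesE, NExp.safe_mul, NExp.safe_const, NExp.safe_var, NExp.val_mul, NExp.val_const,
    NExp.val_var, hn, true_and]
  omega

theorem unreachedE_safe (hW : wordBound d n ≤ W) (hn : s.n xN = n) : unreachedE.Safe M W s := by
  have h := numNodesE_safe (M := M) hW hn
  unfold wordBound at hW
  have : (n + 1) * numNodes n = 2 * (n * n * n) + 2 * (n * n) := by unfold numNodes; ring
  simp only [unreachedE, NExp.safe_mul, NExp.safe_add, NExp.safe_const, NExp.safe_var,
    NExp.val_add, NExp.val_const, NExp.val_var, hn, true_and, h, numNodesE_val hn, this]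
  omega

theorem nodeE_safe (hW : wordBound d n ≤ W) (hn : s.n xN = n) {τ : ℕ} {a b : NExp} (hτ : τ < 2)
    (ha : a.Safe M W s) (hb : b.Safe M W s) (hA : a.val s < n) (hB : b.val s < n) :
    (nodeE τ a b).Safe M W s := by
  unfold wordBound at hW
  have := mul_add_lt hA hB
  simp only [nodeE, NExp.safe_mul, NExp.safe_add, NExp.safe_const, NExp.safe_var, NExp.val_mul,
    NExp.val_add, NExp.val_const, NExp.val_var, hn, true_and, ha, hb]
  omega

theorem valueAddrE_safe (hW : wordBound d n ≤ W) (hn : s.n xN = n) {e : NExp}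
    (he : e.Safe M W s) (h : e.val s < numNodes n) : (valueAddrE e).Safe M W s := by
  unfold wordBound at hW
  unfold numNodes at h
  simp only [valueAddrE, NExp.safe_add, NExp.safe_const, NExp.safe_var, NExp.val_add,
    NExp.val_const, NExp.val_var, hn, true_and, he]
  omega

theorem valueAddr_lt (hM : space d n ≤ M) {u : ℕ} (h : u < numNodes n) : valueAddr n u < M := by
  unfold space at hM
  unfold numNodes at h
  unfold valueAddr
  omega

theorem queueAddrE_safe (hW : wordBound d n ≤ W) (hn : s.n xN = n) {e : NExp}
    (he : e.Safe M W s) (h : e.val s < n) : (queueAddrE e).Safe M W s := by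
  have h1 := numNodesE_safe (M := M) hW hn
  have h2 : numNodes n = 2 * (n * n) := rfl
  unfold wordBound at hW
  simp only [queueAddrE, NExp.safe_add, NExp.safe_const, NExp.safe_var, NExp.val_add,
    NExp.val_const, NExp.val_var, hn, true_and, he, h1, numNodesE_val hn]
  omega

theorem queueAddr_lt (hM : space d n ≤ M) {a : ℕ} (h : a < n) : queueAddr n a < M := by
  unfold space at hM
  unfold queueAddr numNodes
  omega

theorem heightAddrE_safe (hW : wordBound d n ≤ W) (hn : s.n xN = n) {e : NExp}
    (he : e.Safe M W s) (h : e.val s < n) : (heightAddrE d e).Safe M W s := by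
  unfold wordBound at hW
  simp only [heightAddrE, NExp.safe_add, NExp.safe_mul, NExp.safe_const, NExp.safe_var,
    NExp.val_add, NExp.val_mul, NExp.val_const, NExp.val_var, hn, true_and, he]
  omega

theorem heightAddr_lt (hM : space d n ≤ M) {a : ℕ} (h : a < n) : heightAddr d n a < M := by
  unfold space at hM
  unfold heightAddr
  omega

theorem triple_lt {n q u v : ℕ} (hq : q < n) (hu : u < n) (hv : v < n) :
    (q * n + u) * n + v < n * n * n := by
  have h1 : q * n + u + 1 ≤ n * n := mul_add_lt hq hu
  nlinarith

theorem tableAddrE_safe (hW : wordBound d n ≤ W) (hn : s.n xN = n) {k : ℕ} {q u v : NExp}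
    (hk : k < 2) (hq : q.Safe M W s) (hu : u.Safe M W s) (hv : v.Safe M W s) (hQ : q.val s < n)
    (hU : u.val s < n) (hV : v.val s < n) : (tableAddrE d k q u v).Safe M W s := by
  have h1 := mul_add_lt hQ hU
  have h2 := triple_lt hQ hU hV
  unfold wordBound at hW
  simp only [tableAddrE, NExp.safe_add, NExp.safe_mul, NExp.safe_const, NExp.safe_var,
    NExp.val_add, NExp.val_mul, NExp.val_const, NExp.val_var, hn, true_and, hq, hu, hv]
  omega

theorem tableAddr_lt (hM : space d n ≤ M) {k q u v : ℕ} (hk : k < 2) (hq : q < n) (hu : u < n)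
    (hv : v < n) : tableAddr d n k q u v < M := by
  have := triple_lt hq hu hv
  unfold space at hM
  unfold tableAddr
  omega

theorem succValueE_safe (hM : space d n ≤ M) (hW : wordBound d n ≤ W) (hn : s.n xN = n) {τ : ℕ}
    {a b : NExp} (hτ : τ < 2) (ha : a.Safe M W s) (hb : b.Safe M W s) (hA : a.val s < n)
    (hB : b.val s < n) (hV : ∀ u < numNodes n, valueMem n s u ≤ unreached n) :
    (succValueE τ a b).Safe M W s := by
  have h1 := numNodesE_safe (M := M) hW hn
  have h2 := nodeE_safe hW hn hτ ha hb hA hB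
  have h3 := node_lt hτ hA hB
  have h4 := hV _ h3
  have hpos : 0 < numNodes n := by omega
  -- Even an unreached node has cost at most `n + 2`, so all intermediate results stay cubic.
  have h5 : valueMem n s (node n τ (a.val s) (b.val s)) / numNodes n ≤ n + 1 :=
    (Nat.div_le_div_right h4).trans (by rw [unreached, Nat.mul_div_cancel _ hpos])
  have h6 := Nat.mul_le_mul_right (numNodes n) (Nat.add_le_add_right h5 1)
  have h7 : (n + 1 + 1) * numNodes n = 2 * (n * n * n) + 4 * (n * n) := by unfold numNodes; ring
  have h8 : numNodes n = 2 * (n * n) := rfl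
  have h9 := valueAddrE_safe hW hn h2 (by rw [nodeE_val hn]; exact h3)
  have h10 := valueAddr_lt hM h3
  unfold wordBound at hW
  simp only [succValueE, NExp.safe_add, NExp.safe_mul, NExp.safe_div, NExp.safe_const,
    NExp.safe_load, NExp.val_div, NExp.val_load,
    NExp.val_add, NExp.val_mul, NExp.val_const, true_and, h1, h2, h9, h10, numNodesE_val hn,
    nodeE_val hn, valueAddrE_val hn]
  simp only [valueMem] at h5 h6
  omega

theorem valueAddr_inj {u u' : ℕ} : valueAddr n u = valueAddr n u' ↔ u = u' := by
  unfold valueAddr; omega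

theorem node_inj {τ i j τ' i' j' : ℕ} (hτ : τ < 2) (hj : j < n) (hτ' : τ' < 2) (hj' : j' < n)
    (h : node n τ i j = node n τ' i' j') : τ = τ' ∧ i = i' ∧ j = j' := by
  have h1 := node_div (i := i) hτ hj
  have h2 := node_div (i := i') hτ' hj'
  have h3 := node_mod (i := i) hτ hj
  have h4 := node_mod (i := i') hτ' hj'
  rw [h] at h1 h3
  omega

end

/-! #### The table of intervals -/

/-- The memory holds the input. -/
structure InputMem {d n : ℕ} (p : Fin n → Pt d) (δ : ℝ) (s : State) : Prop where
  n_eq : s.n xN = n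
  coord : ∀ i < n, ∀ c : Fin d, s.rm (i * d + c) = coord p i c
  width : s.rm (n * d) = δ

/-- The memory holds a table of intervals. -/
structure TableMem (d n : ℕ) (lo hi : ℕ → ℕ → ℕ → ℝ) (s : State) : Prop where
  n_eq : s.n xN = n
  lo : ∀ q < n, ∀ u < n, ∀ v < n, s.rm (tableAddr d n 0 q u v) = lo q u v
  hi : ∀ q < n, ∀ u < n, ∀ v < n, s.rm (tableAddr d n 1 q u v) = hi q u v

/-- A single loop over `xT < n * n * n` replaces three nested ones: the triple consists of the
base-`n` digits of the counter. -/
def decodeTriple : Cmd :=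
  .seq (.nset xX (.var xT / .var xN))
  (.seq (.nset xV (.var xT - .var xX * .var xN))
  (.seq (.nset xQ (.var xX / .var xN))
    (.nset xU (.var xX - .var xQ * .var xN))))

def quadCoeffs (d : ℕ) : Cmd :=
  .seq (.rset rA (.sum fun c : Fin d => (coordE d (.var xV) c - coordE d (.var xU) c) *
    (coordE d (.var xV) c - coordE d (.var xU) c)))
  (.seq (.rset rB (.sum fun c : Fin d => (coordE d (.var xU) c - coordE d (.var xQ) c) *
    (coordE d (.var xV) c - coordE d (.var xU) c)))
    (.rset rC (.sum (fun c : Fin d => (coordE d (.var xU) c - coordE d (.var xQ) c) *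
    (coordE d (.var xU) c - coordE d (.var xQ) c)) -
      .load (.var xN * .const d) * .load (.var xN * .const d))))

def quadSolve : Cmd :=
  .ite (.rlt (.const 0) (.var rA))
    (.seq (.rset rS (.var rB * .var rB - .var rA * .var rC))
      (.ite (.rlt (.var rS) (.const 0))
        (.seq (.rset rLo (.const 1)) (.rset rHi (.const 0)))
        (.seq (.rset rLo ((.const 0 - .var rB - .sqrt (.var rS)) / .var rA))
        (.seq (.rset rHi ((.sqrt (.var rS) - .var rB) / .var rA))
        (.seq (.ite (.rlt (.var rLo) (.const 0)) (.rset rLo (.const 0)) .skip)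
          (.ite (.rlt (.const 1) (.var rHi)) (.rset rHi (.const 1)) .skip))))))
    (.ite (.rlt (.const 0) (.var rC))
      (.seq (.rset rLo (.const 1)) (.rset rHi (.const 0)))
      (.seq (.rset rLo (.const 0)) (.rset rHi (.const 1))))

def storeInterval (d : ℕ) : Cmd :=
  .seq (.rstore (tableAddrE d 0 (.var xQ) (.var xU) (.var xV)) (.var rLo))
  (.seq (.rstore (tableAddrE d 1 (.var xQ) (.var xU) (.var xV)) (.var rHi))
    (.nset xT (.var xT + .const 1)))

def makeTableBody (d : ℕ) : Cmd :=
  .seq decodeTriple (.seq (quadCoeffs d) (.seq quadSolve (storeInterval d)))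

def makeTable (d : ℕ) : Cmd :=
  .seq (.nset xT (.const 0))
    (.loop (.nlt (.var xT) (.var xN * .var xN * .var xN)) (makeTableBody d))

section
variable {d n M W : ℕ} {s : State} {p : Fin n → Pt d} {δ : ℝ}

theorem decodeTriple_vc (hW : wordBound d n ≤ W) (hn : s.n xN = n)
    {q u v : ℕ} (hq : q < n) (hu : u < n) (hv : v < n) (hT : s.n xT = (q * n + u) * n + v) :
    decodeTriple.vc M W (fun s' => s'.n xN = n ∧ s'.n xT = s.n xT ∧ s'.n xQ = q ∧ s'.n xU = u ∧
      s'.n xV = v ∧ s'.nm = s.nm ∧ s'.rm = s.rm) s := by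
  have h1 := mul_add_lt hq hu
  have h2 := triple_lt hq hu hv
  have d1 : ((q * n + u) * n + v) / n = q * n + u := by
    rw [Nat.mul_comm, Nat.mul_add_div (by omega), Nat.div_eq_of_lt hv, add_zero]
  have d2 : (q * n + u) / n = q := by
    rw [Nat.mul_comm, Nat.mul_add_div (by omega), Nat.div_eq_of_lt hu, add_zero]
  unfold wordBound at hW
  simp [decodeTriple, Cmd.vc, hn, hT, d1, d2]
  omega

theorem coordE_val (hs : InputMem p δ s) (a : NExp) (ha : a.val s < n) (c : Fin d) :
    (coordE d a c).val s = coord p (a.val s) c := by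
  simp [coordE, hs.coord _ ha]

theorem mul_add_lt_mul {i : ℕ} (hi : i < n) (c : Fin d) : i * d + c < n * d := by
  have := c.2
  nlinarith

theorem coordE_safe (hM : space d n ≤ M) (hW : wordBound d n ≤ W) (a : NExp)
    (ha : a.Safe M W s) (hA : a.val s < n) (c : Fin d) : (coordE d a c).Safe M W s := by
  have h1 := mul_add_lt_mul hA c
  unfold wordBound at hW
  unfold space at hM
  have := c.2
  simp [coordE, ha]
  omega

theorem quadCoeffs_vc (hM : space d n ≤ M) (hW : wordBound d n ≤ W) (hs : InputMem p δ s)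
    (hq : s.n xQ < n) (hu : s.n xU < n) (hv : s.n xV < n) :
    (quadCoeffs d).vc M W (fun s' => s'.n = s.n ∧ s'.nm = s.nm ∧ s'.rm = s.rm ∧
      s'.r rA = quadA p (s.n xU) (s.n xV) ∧ s'.r rB = quadB p (s.n xQ) (s.n xU) (s.n xV) ∧
      s'.r rC = quadC p δ (s.n xQ) (s.n xU)) s := by
  -- Coordinates are read from memory, so the real registers assigned in the meantime do not matter.
  have safe : ∀ (x : Fin numVars), s.n x < n → ∀ (r : Fin numVars → ℝ) (c : Fin d),
      (coordE d (.var x) c).Safe M W { s with r := r } := fun x hx r c =>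
    coordE_safe hM hW (s := { s with r := r }) (.var x) trivial hx c
  have val : ∀ (x : Fin numVars), s.n x < n → ∀ (r : Fin numVars → ℝ) (c : Fin d),
      (coordE d (.var x) c).val { s with r := r } = coord p (s.n x) c := fun x hx r c =>
    coordE_val (s := { s with r := r }) ⟨hs.n_eq, hs.coord, hs.width⟩ (.var x) hx c
  have h0 := hs.n_eq
  refine ⟨RExp.safe_sum fun c => ?_, RExp.safe_sum fun c => ?_, ⟨RExp.safe_sum fun c => ?_, ?_⟩, ?_⟩
  · exact ⟨⟨safe _ hv s.r c, safe _ hu s.r c⟩, safe _ hv s.r c, safe _ hu s.r c⟩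
  · exact ⟨⟨safe _ hu _ c, safe _ hq _ c⟩, safe _ hv _ c, safe _ hu _ c⟩
  · exact ⟨⟨safe _ hu _ c, safe _ hq _ c⟩, safe _ hu _ c, safe _ hq _ c⟩
  · unfold wordBound at hW
    unfold space at hM
    simp [h0]
    omega
  · have val' := fun x hx c => val x hx s.r c
    simp [val', val, hq, hu, hv, quadA, quadB, quadC, h0, hs.width]

theorem quadSolve_vc : quadSolve.vc M W (fun s' => s'.n = s.n ∧ s'.nm = s.nm ∧ s'.rm = s.rm ∧
    s'.r rLo = quadLo (s.r rA) (s.r rB) (s.r rC) ∧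
    s'.r rHi = quadHi (s.r rA) (s.r rB) (s.r rC)) s := by
  simp only [quadSolve, Cmd.vc, Cond.Holds, Cond.Safe]
  refine ⟨by simp, fun h1 => ⟨by simp, by simp, fun h2 => ⟨trivial, trivial, ?_⟩,
    fun h2 => ⟨by simp, by simp, by simp, fun h3 => ⟨by simp, by simp, fun h4 => ⟨by simp, ?_⟩,
      fun h4 => ?_⟩, fun h3 => ⟨by simp, fun h4 => ⟨by simp, ?_⟩, fun h4 => ?_⟩⟩⟩,
      fun h1 => ⟨by simp, fun h2 => ⟨trivial, trivial, ?_⟩, fun h2 => ⟨trivial, trivial, ?_⟩⟩⟩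
  all_goals
    simp at h1 h2
    simp [quadLo, quadHi, h1, h2, not_lt.2]
  all_goals
    simp at h3 h4
    constructor
    · first | exact h3 | exact h3.le
    · first | exact h4 | exact h4.le

theorem storeInterval_vc (hM : space d n ≤ M) (hW : wordBound d n ≤ W) (hn : s.n xN = n)
    (hq : s.n xQ < n) (hu : s.n xU < n) (hv : s.n xV < n) (hT : s.n xT < n * n * n) :
    (storeInterval d).vc M W (fun s' => s'.n = Function.update s.n xT (s.n xT + 1) ∧ s'.nm = s.nm ∧
      s'.rm = Function.update (Function.update s.rm
        (tableAddr d n 0 (s.n xQ) (s.n xU) (s.n xV)) (s.r rLo))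
        (tableAddr d n 1 (s.n xQ) (s.n xU) (s.n xV)) (s.r rHi)) s := by
  have safe : ∀ (k : ℕ), k < 2 → ∀ f, (tableAddrE d k (.var xQ) (.var xU) (.var xV)).Safe M W
      { s with rm := f } := fun k hk f =>
    tableAddrE_safe (s := { s with rm := f }) hW hn hk trivial trivial trivial hq hu hv
  have e0 := tableAddr_lt hM (show 0 < 2 by omega) hq hu hv
  have e1 := tableAddr_lt hM (show 1 < 2 by omega) hq hu hv
  have hW' := hW
  unfold wordBound at hW'
  have h1 : 1 ≤ W := by omega
  have h2 : s.n xT + 1 ≤ W := by omega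
  simp [storeInterval, Cmd.vc, hn, e0, e1, safe, h1, h2]

/-- The first `t` entries of the table have been computed. -/
structure TablePrefix {d n : ℕ} (p : Fin n → Pt d) (δ : ℝ) (s : State) : Prop where
  input : InputMem p δ s
  nm : s.nm = fun _ => 0
  lo : ∀ q < n, ∀ u < n, ∀ v < n, (q * n + u) * n + v < s.n xT →
    s.rm (tableAddr d n 0 q u v) = loFun p δ q u v
  hi : ∀ q < n, ∀ u < n, ∀ v < n, (q * n + u) * n + v < s.n xT →
    s.rm (tableAddr d n 1 q u v) = hiFun p δ q u v

theorem exists_triple {n t : ℕ} (h : t < n * n * n) :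
    ∃ q u v, q < n ∧ u < n ∧ v < n ∧ t = (q * n + u) * n + v := by
  have hn : 0 < n := Nat.pos_of_ne_zero (by rintro rfl; simp at h)
  refine ⟨t / n / n, t / n % n, t % n, ?_, Nat.mod_lt _ hn, Nat.mod_lt _ hn, ?_⟩
  · rw [Nat.div_lt_iff_lt_mul hn, Nat.div_lt_iff_lt_mul hn]
    exact h
  · rw [Nat.div_add_mod', Nat.div_add_mod']

theorem triple_inj {n q u v q' u' v' : ℕ} (hu : u < n) (hv : v < n) (hu' : u' < n) (hv' : v' < n)
    (h : (q * n + u) * n + v = (q' * n + u') * n + v') : q = q' ∧ u = u' ∧ v = v' := by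
  have key : ∀ a b, b < n → (a * n + b) / n = a ∧ (a * n + b) % n = b := fun a b hb =>
    ⟨by rw [Nat.mul_comm, Nat.mul_add_div (by omega), Nat.div_eq_of_lt hb, add_zero],
      by rw [Nat.mul_comm, Nat.mul_add_mod, Nat.mod_eq_of_lt hb]⟩
  have h1 := key (q * n + u) v hv
  have h2 := key (q' * n + u') v' hv'
  have h3 := key q u hu
  have h4 := key q' u' hu'
  rw [h, h2.1, h2.2] at h1
  rw [← h1.1, h4.1, h4.2] at h3
  omega

theorem makeTableBody_vc (hM : space d n ≤ M) (hW : wordBound d n ≤ W) (hs : TablePrefix p δ s)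
    (hT : s.n xT < n * n * n) : (makeTableBody d).vc M W (fun s' => TablePrefix p δ s' ∧
      s'.n xT = s.n xT + 1) s := by
  obtain ⟨q, u, v, hq, hu, hv, e⟩ := exists_triple hT
  have h0 := hs.input.n_eq
  refine Cmd.vc.seq (decodeTriple_vc hW h0 hq hu hv e) ?_
  rintro s₁ ⟨a1, a2, a3, a4, a5, a6, a7⟩
  have hi₁ : InputMem p δ s₁ := ⟨a1, by rw [a7]; exact hs.input.coord, by rw [a7]; exact hs.input.width⟩
  refine Cmd.vc.seq (quadCoeffs_vc hM hW hi₁ (by rwa [a3]) (by rwa [a4]) (by rwa [a5])) ?_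
  rintro s₂ ⟨b1, b2, b3, b4, b5, b6⟩
  refine Cmd.vc.seq quadSolve_vc ?_
  rintro s₃ ⟨c1, c2, c3, c4, c5⟩
  have n3 : s₃.n = s₁.n := c1.trans b1
  rw [b4, b5, b6, a3, a4, a5] at c4 c5
  refine (storeInterval_vc hM hW (by rw [n3, a1]) (by rwa [n3, a3]) (by rwa [n3, a4])
    (by rwa [n3, a5]) (by rwa [n3, a2])).mono _ ?_
  rintro s' ⟨e1, e2, e3⟩
  rw [n3, a3, a4, a5, c4, c5, c3, b3, a7] at e3
  have ht : s'.n xT = s.n xT + 1 := by rw [e1, n3, a2]; simp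
  -- The table lies behind the input, which stays intact.
  have hlow : ∀ a, a < n * d + 1 → s'.rm a = s.rm a := by
    intro a ha
    rw [e3, Function.update_of_ne, Function.update_of_ne]
    all_goals unfold tableAddr; omega
  refine ⟨⟨⟨?_, ?_, ?_⟩, ?_, ?_, ?_⟩, ht⟩
  · rw [e1, n3]; simpa using a1
  · intro i hi c
    rw [hlow _ (by have := mul_add_lt_mul hi c; omega), hs.input.coord i hi]
  · rw [hlow _ (by omega), hs.input.width]
  · rw [e2, c2, b2, a6, hs.nm]
  · intro q' hq' u' hu' v' hv' hlt
    rw [e3, Function.update_of_ne (by unfold tableAddr; omega)]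
    by_cases he : (q' * n + u') * n + v' = s.n xT
    · obtain ⟨rfl, rfl, rfl⟩ := triple_inj hu' hv' hu hv (he.trans e)
      rw [Function.update_self]; rfl
    · rw [Function.update_of_ne (by unfold tableAddr; omega)]
      exact hs.lo q' hq' u' hu' v' hv' (by omega)
  · intro q' hq' u' hu' v' hv' hlt
    rw [e3]
    by_cases he : (q' * n + u') * n + v' = s.n xT
    · obtain ⟨rfl, rfl, rfl⟩ := triple_inj hu' hv' hu hv (he.trans e)
      rw [Function.update_self]; rfl
    · rw [Function.update_of_ne (by unfold tableAddr; omega),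
        Function.update_of_ne (by unfold tableAddr; omega)]
      exact hs.hi q' hq' u' hu' v' hv' (by omega)

/-- A bound on the running time of a loop whose body takes time `B` and that makes `m` rounds. -/
def loopTime (b : Cond) (B m : ℕ) : ℕ := (B + b.code.cost + 2) * m + b.code.cost + 2

theorem makeTable_wp (hM : space d n ≤ M) (hW : wordBound d n ≤ W) (hs : InputMem p δ s)
    (hnm : s.nm = fun _ => 0) : (makeTable d).WP M W
      (1 + ((Cmd.nset xT (.const 0)).code.cost +
        loopTime (.nlt (.var xT) (.var xN * .var xN * .var xN)) (makeTableBody d).code.cost (n * n * n)))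
      (fun s' => TableMem d n (loFun p δ) (hiFun p δ) s' ∧ s'.nm = fun _ => 0) s := by
  refine Cmd.WP.seq (Cmd.WP.mono (Cmd.WP.of_vc _ (Q := fun s' => TablePrefix p δ s' ∧ s'.n xT = 0) ?_)
    le_rfl ?_)
  · refine ⟨Nat.zero_le _, ⟨⟨hs.n_eq, hs.coord, hs.width⟩, hnm, ?_, ?_⟩, ?_⟩ <;> simp
  · rintro s₁ ⟨h1, h2⟩
    refine (Cmd.WP.loop (fun s => TablePrefix p δ s) (fun s => n * n * n - s.n xT)
      (B := (makeTableBody d).code.cost) h1 ?_ ?_).mono (by rw [h2]; exact le_rfl) ?_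
    · intro s' hs'
      unfold wordBound at hW
      simp [Cond.Safe, hs'.input.n_eq]
      omega
    · intro s' hs' hT
      have hT' : s'.n xT < n * n * n := by simpa [Cond.Holds, hs'.input.n_eq] using hT
      refine Cmd.WP.of_vc _ ((makeTableBody_vc hM hW hs' hT').mono _ ?_)
      rintro s'' ⟨h3, h4⟩
      exact ⟨h3, by rw [h4]; omega⟩
    · rintro s' ⟨hs', hT⟩
      have hT' : ¬ s'.n xT < n * n * n := by simpa [Cond.Holds, hs'.input.n_eq] using hT
      refine ⟨⟨hs'.input.n_eq, fun q hq u hu v hv => ?_, fun q hq u hu v hv => ?_⟩, hs'.nm⟩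
      · exact hs'.lo q hq u hu v hv (by have := triple_lt hq hu hv; omega)
      · exact hs'.hi q hq u hu v hv (by have := triple_lt hq hu hv; omega)

end

/-! #### The values of the nodes -/

def initBody : Cmd :=
  .seq (.nstore (valueAddrE (.var xT)) unreachedE) (.nset xT (.var xT + .const 1))

/-- The nodes numbered `0` and `1` are the two kinds of the start `(0, 0)`; only these have value
`0`. -/
def initValues : Cmd :=
  .seq (.nset xT (.const 0))
  (.seq (.loop (.nlt (.var xT) numNodesE) initBody)
  (.seq (.nstore (valueAddrE (.const 0)) (.const 0)) (.nstore (valueAddrE (.const 1)) (.const 0))))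

/-- If the value of the current node of kind `τ` is larger than `xX`, replace it. -/
def relax (τ : ℕ) : Cmd :=
  .ite (.nlt (.var xX) (.load (valueAddrE (nodeE τ (.var xI) (.var xJ)))))
    (.nstore (valueAddrE (nodeE τ (.var xI) (.var xJ))) (.var xX)) .skip

/-- An empty interval blocks the strip: no entry gets past this vertex and the queue is discarded.
-/
def enqueue (d : ℕ) : Cmd :=
  .ite (.rlt (.var rB) (.var rA)) (.nset xHd (.var xTl))
    (.seq (.rstore (heightAddrE d (.var xTl)) (.var rA))
    (.seq (.nstore (queueAddrE (.var xTl)) (.var xCur)) (.nset xTl (.var xTl + .const 1))))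

def relaxFresh : Cmd :=
  .ite (.nlt (.var xHd) (.var xTl))
    (.seq (.nset xX (.load (queueAddrE (.var xHd)))) (.seq (relax 0) (relax 1))) .skip

/-- Only kind `1` is lowered, and only from kind `0`: by the exchange argument one link within a
cell suffices. -/
def relaxSame (d : ℕ) : Cmd :=
  .seq (.rset rS (.load (tableAddrE d 0 (.var xP) (.var xJ) (.var xJ + .const 1))))
    (.ite (.rlt (.var rHi) (.var rS)) .skip
      (.seq (.nset xX (succValueE 0 (.var xP) (.var xJ))) (relax 1)))

def relaxAll (d : ℕ) : Cmd :=
  .seq (.rset rLo (.load (tableAddrE d 0 (.var xI) (.var xJ) (.var xJ + .const 1))))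
  (.seq (.rset rHi (.load (tableAddrE d 1 (.var xI) (.var xJ) (.var xJ + .const 1))))
    (.ite (.rlt (.var rHi) (.var rLo)) .skip (.seq relaxFresh (relaxSame d))))

def advance : Cmd :=
  .seq (.nset xCur (succValueE 1 (.var xP) (.var xJ))) (.nset xJ (.var xJ + .const 1))

def passVertex (d : ℕ) : Cmd := .seq (enqueue d) (.seq (relaxAll d) advance)

/-- Pop the queue, or pass the current vertex. -/
def stripBranch (d : ℕ) : Cmd :=
  .ite (.nlt (.var xHd) (.var xTl))
    (.ite (.rlt (.var rB) (.load (heightAddrE d (.var xHd))))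
      (.nset xHd (.var xHd + .const 1))
      (.ite (.nlt (.load (queueAddrE (.var xTl - .const 1))) (.var xCur))
        (.ite (.rlt (.var rA) (.load (heightAddrE d (.var xTl - .const 1))))
          (passVertex d)
          (.seq (.nset xTl (.var xTl - .const 1)) (.nset xCur (.load (queueAddrE (.var xTl))))))
        (.nset xTl (.var xTl - .const 1))))
    (passVertex d)

def stripBody (d : ℕ) : Cmd :=
  .seq (.rset rA (.load (tableAddrE d 0 (.var xJ) (.var xP) (.var xI))))
  (.seq (.rset rB (.load (tableAddrE d 1 (.var xJ) (.var xP) (.var xI)))) (stripBranch d))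

def stripInit : Cmd :=
  .seq (.nset xJ (.const 0))
    (.seq (.nset xHd (.const 0)) (.seq (.nset xTl (.const 0)) (.nset xCur unreachedE)))

def strip (d : ℕ) : Cmd :=
  .seq stripInit
  (.seq (.loop (.nlt (.var xJ + .const 1) (.var xN)) (stripBody d))
    (.nset xP (.var xP + .const 1)))

def rowValues (d : ℕ) : Cmd :=
  .seq (.nset xP (.const 0))
  (.seq (.loop (.nlt (.var xP) (.var xI)) (strip d)) (.nset xI (.var xI + .const 1)))

/-- Links lead to larger vertices, so row `0` is final after the initialization. -/
def allValues (d : ℕ) : Cmd :=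
  .seq (.nset xI (.const 1)) (.loop (.nlt (.var xI) (.var xN)) (rowValues d))

section
variable {d n M W : ℕ} {s : State} {lo hi : ℕ → ℕ → ℕ → ℝ}

theorem TableMem.congr {s' : State} (h : TableMem d n lo hi s) (hn : s'.n xN = n)
    (hr : ∀ a, a < n * d + 1 + 2 * (n * n * n) → s'.rm a = s.rm a) : TableMem d n lo hi s' := by
  refine ⟨hn, fun q hq u hu v hv => ?_, fun q hq u hu v hv => ?_⟩
  · rw [hr _ (by have := triple_lt hq hu hv; unfold tableAddr; omega), h.lo q hq u hu v hv]
  · rw [hr _ (by have := triple_lt hq hu hv; unfold tableAddr; omega), h.hi q hq u hu v hv]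

theorem two_le_numNodes (hn : 1 ≤ n) : 2 ≤ numNodes n := by
  unfold numNodes; nlinarith

theorem initValues_wp (hM : space d n ≤ M) (hW : wordBound d n ≤ W) (hn1 : 1 ≤ n)
    (hs : TableMem d n lo hi s) : initValues.WP M W
      (1 + ((Cmd.nset xT (.const 0)).code.cost + (1 + (loopTime (.nlt (.var xT) numNodesE) initBody.code.cost
        (numNodes n) + (Cmd.seq (.nstore (valueAddrE (.const 0)) (.const 0))
          (.nstore (valueAddrE (.const 1)) (.const 0))).code.cost))))
      (fun s' => TableMem d n lo hi s' ∧ ∀ u < numNodes n, valueMem n s' u =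
        if u < 2 then 0 else unreached n) s := by
  have h2 := two_le_numNodes hn1
  have hW1 : 1 ≤ W := by unfold wordBound at hW; omega
  have hWB : numNodes n ≤ W := by unfold wordBound at hW; unfold numNodes; omega
  refine Cmd.WP.seq (Cmd.WP.mono (Cmd.WP.of_vc _ (Q := fun s' => TableMem d n lo hi s' ∧ s'.n xT = 0)
    ?_) le_rfl ?_)
  · exact ⟨Nat.zero_le _, ⟨hs.n_eq, hs.lo, hs.hi⟩, by simp⟩
  rintro s₁ ⟨hs₁, hT₁⟩
  refine Cmd.WP.seq ((Cmd.WP.loop (fun s => TableMem d n lo hi s ∧ s.n xT ≤ numNodes n ∧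
    ∀ u < s.n xT, valueMem n s u = unreached n) (fun s => numNodes n - s.n xT)
    (B := initBody.code.cost) ⟨hs₁, by omega, by omega⟩ ?_ ?_).mono (by rw [hT₁]; exact le_rfl) ?_)
  · rintro s' ⟨hs', -, -⟩
    exact ⟨trivial, numNodesE_safe hW hs'.n_eq⟩
  · rintro s' ⟨hs', hle, hv⟩ hT
    have hn := hs'.n_eq
    have hT' : s'.n xT < numNodes n := by simpa [Cond.Holds, hn] using hT
    refine Cmd.WP.of_vc _ ⟨valueAddrE_safe hW hn trivial hT', unreachedE_safe hW hn, ?_, ?_, ?_⟩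
    · rw [valueAddrE_val hn]; exact valueAddr_lt hM hT'
    · simp [hW1]; omega
    · rw [valueAddrE_val hn, unreachedE_val hn]
      refine ⟨⟨⟨hn, hs'.lo, hs'.hi⟩, ?_, fun u hu => ?_⟩, ?_⟩
      · simpa using hT'
      · simp only [NExp.val_var, NExp.val_add, NExp.val_const, Function.update_self] at hu
        by_cases he : u = s'.n xT
        · subst he; simp [valueMem]
        · have := hv u (by omega)
          simpa [valueMem, valueAddr_inj, he] using this
      · simp only [NExp.val_var, NExp.val_add, NExp.val_const, Function.update_self]
        omega
  · rintro s₂ ⟨⟨hs₂, -, hv⟩, hT⟩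
    have hn := hs₂.n_eq
    have hT' : numNodes n ≤ s₂.n xT := by simpa [Cond.Holds, hn] using hT
    have hA : ∀ f c, (valueAddrE (.const c)).val { s₂ with nm := f } = valueAddr n c :=
      fun f c => valueAddrE_val (s := { s₂ with nm := f }) hn (.const c)
    refine Cmd.WP.of_vc _ ⟨valueAddrE_safe hW hn (Nat.zero_le _) (by simp only [NExp.val_const]; omega),
      Nat.zero_le _, ?_, valueAddrE_safe (M := M) (s := { s₂ with nm := _ }) (e := .const 1) hW hn hW1
        (by simp only [NExp.val_const]; omega), Nat.zero_le _, ?_, ?_⟩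
    · rw [hA]; exact valueAddr_lt hM (by omega)
    · rw [hA]; exact valueAddr_lt hM (by omega)
    · rw [hA, hA]
      refine ⟨⟨hn, hs₂.lo, hs₂.hi⟩, fun u hu => ?_⟩
      have := hv u (by omega)
      simp only [valueMem, NExp.val_const, Function.update_apply, valueAddr_inj] at this ⊢
      split_ifs <;> first | rfl | omega

/-! ##### One strip -/

/-- State of the memory before the links from `i'` to `i` have been processed. -/
structure StripCore (d n : ℕ) (lo hi : ℕ → ℕ → ℕ → ℝ) (V₀ : ℕ → ℕ) (i i' : ℕ) (j : ℕ) (s : State) :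
    Prop where
  table : TableMem d n lo hi s
  i_eq : s.n xI = i
  p_eq : s.n xP = i'
  j_lt : s.n xJ < n
  le : s.n xHd ≤ s.n xTl
  bound : ∀ u < numNodes n, valueMem n s u ≤ unreached n
  other : ∀ τ ii jj, τ < 2 → ii < n → jj < n → ii ≠ i →
    valueMem n s (node n τ ii jj) = V₀ (node n τ ii jj)
  row : ∀ jj, jj + 1 < n → ∀ w < unreached n,
    (valueMem n s (node n 0 i jj) ≤ w ↔
      V₀ (node n 0 i jj) ≤ w ∨ jj < j ∧ FreshPred n lo hi V₀ w i' i jj) ∧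
    (valueMem n s (node n 1 i jj) ≤ w ↔ V₀ (node n 1 i jj) ≤ w ∨
      jj < j ∧ (FreshPred n lo hi V₀ w i' i jj ∨ SamePred n lo hi V₀ w i' i jj))

/-- Values of the entries of a strip. -/
def entryValue (n : ℕ) (V₀ : ℕ → ℕ) (i' j : ℕ) : ℕ := succValue n V₀ (node n 1 i' j)

/-- The invariant of the loop over a strip. -/
structure StripInv (d n : ℕ) (lo hi : ℕ → ℕ → ℕ → ℝ) (V₀ : ℕ → ℕ) (i i' : ℕ) (s : State) : Prop where
  core : StripCore d n lo hi V₀ i i' (s.n xJ) s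
  tl_le : s.n xTl ≤ s.n xJ
  queue : IsQueue (fun m => lo m i' i) (fun m => hi m i' i) (entryValue n V₀ i') (unreached n)
    (heightMem d n s) (queueMem n s) (s.n xJ) (s.n xHd) (s.n xTl) (s.n xCur)

/-- The situation after the current vertex of the strip has been passed. -/
structure StripPassed (d n : ℕ) (lo hi : ℕ → ℕ → ℕ → ℝ) (V₀ : ℕ → ℕ) (i i' j : ℕ) (s : State) :
    Prop where
  core : StripCore d n lo hi V₀ i i' j s
  tl_le : s.n xTl ≤ s.n xJ + 1
  passed : IsPassed (fun m => lo m i' i) (fun m => hi m i' i) (entryValue n V₀ i') (unreached n)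
    (heightMem d n s) (queueMem n s) (s.n xJ) (s.n xHd) (s.n xTl)

variable {V₀ : ℕ → ℕ} {i i' : ℕ}

theorem valueAddr_ne_queueAddr {u a : ℕ} (h : u < numNodes n) : valueAddr n u ≠ queueAddr n a := by
  unfold valueAddr queueAddr; omega

theorem StripCore.congr {j : ℕ} {s' : State} (h : StripCore d n lo hi V₀ i i' j s)
    (table : TableMem d n lo hi s') (hI : s'.n xI = s.n xI) (hP : s'.n xP = s.n xP)
    (hj : s'.n xJ < n) (hle : s'.n xHd ≤ s'.n xTl)
    (hV : ∀ u < numNodes n, valueMem n s' u = valueMem n s u) (hi_lt : i < n) :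
    StripCore d n lo hi V₀ i i' j s' := by
  refine ⟨table, hI.trans h.i_eq, hP.trans h.p_eq, hj, hle, fun u hu => ?_,
    fun τ ii jj h1 h2 h3 h4 => ?_, fun jj hjj w hw => ?_⟩
  · rw [hV u hu]; exact h.bound u hu
  · rw [hV _ (node_lt h1 h2 h3)]; exact h.other τ ii jj h1 h2 h3 h4
  · rw [hV _ (node_lt (by omega) hi_lt (by omega)), hV _ (node_lt (by omega) hi_lt (by omega))]
    exact h.row jj hjj w hw

/-- The conditions `hf` and `hl` express that no pop is due, as `IsQueue.push` demands. At most one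
element is appended per vertex, so `n` queue cells suffice without reuse. -/
theorem enqueue_vc (hM : space d n ≤ M) (hW : wordBound d n ≤ W)
    (hs : StripInv d n lo hi V₀ i i' s) (hi_lt : i < n)
    (ha : s.r rA = lo (s.n xJ) i' i) (hb : s.r rB = hi (s.n xJ) i' i)
    (hf : s.n xHd < s.n xTl → heightMem d n s (s.n xHd) ≤ s.r rB)
    (hl : s.n xHd < s.n xTl → queueMem n s (s.n xTl - 1) < s.n xCur ∧
      s.r rA < heightMem d n s (s.n xTl - 1)) :
    (enqueue d).vc M W (fun s' => StripPassed d n lo hi V₀ i i' (s.n xJ) s' ∧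
      s'.n xJ = s.n xJ ∧ s'.n xTl - s'.n xHd ≤ s.n xTl - s.n xHd + 1) s := by
  have hn := hs.core.table.n_eq
  have htl := hs.tl_le
  have hj := hs.core.j_lt
  refine ⟨⟨trivial, trivial⟩, fun h => ⟨trivial, ⟨?_, ?_, ?_⟩, ?_, ?_⟩, fun h => ?_⟩
  · exact hs.core.congr ⟨hn, hs.core.table.lo, hs.core.table.hi⟩ rfl rfl hj (by simp)
      (fun _ _ => rfl) hi_lt
  · simp; omega
  · have h' : hi (s.n xJ) i' i < lo (s.n xJ) i' i := by rw [← ha, ← hb]; exact h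
    exact IsPassed.empty (α := fun m => lo m i' i) (β := fun m => hi m i' i) h' (s.n xTl)
  · simp
  · simp
  · have h' : lo (s.n xJ) i' i ≤ hi (s.n xJ) i' i := by rw [← ha, ← hb]; exact not_lt.1 h
    have htn : s.n xTl < n := by omega
    have hW' : s.n xTl + 1 ≤ W ∧ 1 ≤ W := by unfold wordBound at hW; omega
    have hp := hs.queue.push h' (fun hlt => (hf hlt).trans hb.le)
      (fun hlt => ⟨(hl hlt).1, ha ▸ (hl hlt).2⟩) hs.core.le
    have hA : ∀ f, (queueAddrE (.var xTl)).val { s with rm := f } = queueAddr n (s.n xTl) :=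
      fun f => queueAddrE_val (s := { s with rm := f }) hn (.var xTl)
    have hB : (heightAddrE d (.var xTl)).val s = heightAddr d n (s.n xTl) := heightAddrE_val hn _
    refine ⟨heightAddrE_safe hW hn trivial htn, trivial, ?_,
      queueAddrE_safe (M := M) (s := { s with rm := _ }) (e := .var xTl) hW hn trivial htn, trivial, ?_, ?_, ⟨?_, ?_, ?_⟩, ?_, ?_⟩
    · rw [hB]; exact heightAddr_lt hM htn
    · rw [hA]; exact queueAddr_lt hM htn
    · simpa [and_comm] using hW'
    · rw [hA, hB]
      refine hs.core.congr (hs.core.table.congr hn fun a ha => ?_) rfl rfl hj ?_ (fun u hu => ?_) hi_lt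
      · exact Function.update_of_ne (by unfold heightAddr; omega) _ _
      · have := hs.core.le
        simp; omega
      · exact Function.update_of_ne (valueAddr_ne_queueAddr hu) _ _
    · simpa using htl
    · rw [hA, hB]
      convert hp using 1
      · funext a
        simp [heightMem, Function.update_apply, heightAddr, ha]
      · funext a
        simp [queueMem, Function.update_apply, queueAddr]
      · simp
      · simp
      · simp
    · simp
    · simp; omega

end

/-! ### Lowering the values of a node -/

section
variable {d n M W : ℕ} {s : State} {lo hi : ℕ → ℕ → ℕ → ℝ} {V₀ : ℕ → ℕ} {i i' j : ℕ}

/-- The values of the two nodes of vertex `i` and cell `j` have been lowered, according to `F` and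
`G`. -/
structure Relaxed (n i j : ℕ) (F G : ℕ → Prop) (s s' : State) : Prop where
  reg : ∀ x, x ≠ xX → s'.n x = s.n x
  rm : s'.rm = s.rm
  other : ∀ a, a ≠ valueAddr n (node n 0 i j) → a ≠ valueAddr n (node n 1 i j) → s'.nm a = s.nm a
  zero : ∀ w, valueMem n s' (node n 0 i j) ≤ w ↔ valueMem n s (node n 0 i j) ≤ w ∨ F w
  one : ∀ w, valueMem n s' (node n 1 i j) ≤ w ↔ valueMem n s (node n 1 i j) ≤ w ∨ G w

/-- In terms of thresholds `w` a minimum is a disjunction, so successive lowerings compose without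
comparing values. -/
theorem Relaxed.trans {F G F' G' : ℕ → Prop} {s' s'' : State} (h : Relaxed n i j F G s s')
    (h' : Relaxed n i j F' G' s' s'') :
    Relaxed n i j (fun w => F w ∨ F' w) (fun w => G w ∨ G' w) s s'' where
  reg x hx := (h'.reg x hx).trans (h.reg x hx)
  rm := h'.rm.trans h.rm
  other a h0 h1 := (h'.other a h0 h1).trans (h.other a h0 h1)
  zero w := by rw [h'.zero, h.zero, or_assoc]
  one w := by rw [h'.one, h.one, or_assoc]

theorem Relaxed.of_eq {s' : State} (reg : ∀ x, x ≠ xX → s'.n x = s.n x) (rm : s'.rm = s.rm)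
    (nm : s'.nm = s.nm) : Relaxed n i j (fun _ => False) (fun _ => False) s s' where
  reg := reg
  rm := rm
  other a _ _ := by rw [nm]
  zero w := by simp [valueMem, nm]
  one w := by simp [valueMem, nm]

theorem Relaxed.imp {F G F' G' : ℕ → Prop} {s' : State} (h : Relaxed n i j F G s s')
    (hF : ∀ w, F w ↔ F' w) (hG : ∀ w, G w ↔ G' w) : Relaxed n i j F' G' s s' where
  reg := h.reg
  rm := h.rm
  other := h.other
  zero w := by rw [h.zero, hF]
  one w := by rw [h.one, hG]

theorem Relaxed.of_left {F G : ℕ → Prop} {s₀ s' : State} (h : Relaxed n i j F G s s')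
    (reg : ∀ x, x ≠ xX → s.n x = s₀.n x) (rm : s.rm = s₀.rm) (nm : s.nm = s₀.nm) :
    Relaxed n i j F G s₀ s' :=
  ((Relaxed.of_eq reg rm nm).trans h).imp (by simp) (by simp)

theorem relax_vc (hM : space d n ≤ M) (hW : wordBound d n ≤ W) (hn : s.n xN = n)
    (hI : s.n xI = i) (hJ : s.n xJ = j) (hi_lt : i < n) (hj : j < n) {τ : ℕ} (hτ : τ < 2) :
    (relax τ).vc M W (fun s' => s'.n = s.n ∧ s'.r = s.r ∧
      Relaxed n i j (fun w => τ = 0 ∧ s.n xX ≤ w) (fun w => τ = 1 ∧ s.n xX ≤ w) s s') s := by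
  have h1 : (nodeE τ (.var xI) (.var xJ)).Safe M W s :=
    nodeE_safe hW hn hτ trivial trivial (hI.trans_lt hi_lt) (hJ.trans_lt hj)
  have h2 : (nodeE τ (.var xI) (.var xJ)).val s = node n τ i j := by rw [nodeE_val hn]; simp [hI, hJ]
  have h3 := node_lt hτ hi_lt hj
  have h4 := valueAddrE_safe hW hn h1 (h2.trans_lt h3)
  have h5 : (valueAddrE (nodeE τ (.var xI) (.var xJ))).val s = valueAddr n (node n τ i j) := by
    rw [valueAddrE_val hn, h2]
  have h6 : valueAddr n (node n τ i j) < M := valueAddr_lt hM h3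
  refine ⟨⟨trivial, h4, h5.trans_lt h6⟩, fun h => ⟨h4, trivial, h5.trans_lt h6, rfl, rfl, ?_⟩,
    fun h => ⟨rfl, rfl, ?_⟩⟩
  · have h' : s.n xX < valueMem n s (node n τ i j) := by
      simpa [Cond.Holds, h5, valueMem] using h
    rw [h5]
    refine ⟨fun _ _ => rfl, rfl, fun a h0 h1 => ?_, fun w => ?_, fun w => ?_⟩
    · refine Function.update_of_ne ?_ _ _
      interval_cases τ <;> assumption
    · by_cases hτ0 : τ = 0
      · subst hτ0
        simp only [valueMem, Function.update_self, NExp.val_var, true_and] at h' ⊢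
        omega
      · have : node n 0 i j ≠ node n τ i j := by unfold node; omega
        simp [valueMem, valueAddr_inj, this, hτ0]
    · by_cases hτ0 : τ = 1
      · subst hτ0
        simp only [valueMem, Function.update_self, NExp.val_var, true_and] at h' ⊢
        omega
      · have : node n 1 i j ≠ node n τ i j := by unfold node; omega
        simp [valueMem, valueAddr_inj, this, hτ0]
  · have h' : valueMem n s (node n τ i j) ≤ s.n xX := by
      simpa [Cond.Holds, h5, valueMem] using h
    refine ⟨fun _ _ => rfl, rfl, fun a h0 h1 => rfl, fun w => ?_, fun w => ?_⟩
    · refine ⟨Or.inl, ?_⟩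
      rintro (hw | ⟨rfl, hw⟩)
      exacts [hw, h'.trans hw]
    · refine ⟨Or.inl, ?_⟩
      rintro (hw | ⟨rfl, hw⟩)
      exacts [hw, h'.trans hw]

theorem relaxFresh_vc (hM : space d n ≤ M) (hW : wordBound d n ≤ W) (hn : s.n xN = n)
    (hI : s.n xI = i) (hJ : s.n xJ = j) (hi_lt : i < n) (hj : j < n) (htl : s.n xTl ≤ n) :
    relaxFresh.vc M W (fun s' => s'.r = s.r ∧
      Relaxed n i j (fun w => s.n xHd < s.n xTl ∧ queueMem n s (s.n xHd) ≤ w)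
        (fun w => s.n xHd < s.n xTl ∧ queueMem n s (s.n xHd) ≤ w) s s') s := by
  refine ⟨⟨trivial, trivial⟩, fun h => ?_, fun h => ⟨rfl, ?_⟩⟩
  · have h' : s.n xHd < s.n xTl := h
    have h1 : s.n xHd < n := by omega
    have h2 : (queueAddrE (.var xHd)).val s = queueAddr n (s.n xHd) := queueAddrE_val hn _
    refine ⟨⟨queueAddrE_safe hW hn trivial h1, h2.trans_lt (queueAddr_lt hM h1)⟩, ?_⟩
    rw [NExp.val_load, h2]
    refine Cmd.vc.seq (relax_vc hM hW (i := i) (j := j) (s := { s with n := Function.update s.n xX _ }) hn hI hJ hi_lt hj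
      Nat.two_pos) ?_
    rintro s₁ ⟨e1, e2, r1⟩
    refine Cmd.vc.mono _ (relax_vc hM hW (i := i) (j := j) (by rw [e1]; exact hn)
      (by rw [e1]; exact hI) (by rw [e1]; exact hJ) hi_lt hj Nat.one_lt_two) ?_
    rintro s₂ ⟨e3, e4, r2⟩
    refine ⟨e4.trans e2, ((r1.trans r2).of_left (fun x hx => Function.update_of_ne hx _ _) rfl rfl).imp ?_ ?_⟩
    · intro w; simp [h', queueMem]
    · intro w; simp [e1, h', queueMem]
  · have h' : ¬ s.n xHd < s.n xTl := h
    refine Relaxed.imp (Relaxed.of_eq (fun _ _ => rfl) rfl rfl) ?_ ?_ <;> simp [h']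

theorem relaxSame_vc (hM : space d n ≤ M) (hW : wordBound d n ≤ W) (ht : TableMem d n lo hi s)
    (hI : s.n xI = i) (hP : s.n xP = i') (hJ : s.n xJ = j) (hi_lt : i < n) (hi' : i' < n)
    (hj : j + 1 < n) (hb : ∀ u < numNodes n, valueMem n s u ≤ unreached n) :
    (relaxSame d).vc M W (Relaxed n i j (fun _ => False) (fun w =>
      lo i' j (j + 1) ≤ s.r rHi ∧ succValue n (valueMem n s) (node n 0 i' j) ≤ w) s) s := by
  have hn := ht.n_eq
  have hW1 : j + 1 ≤ W ∧ 1 ≤ W := by unfold wordBound at hW; omega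
  have h1 : (tableAddrE d 0 (.var xP) (.var xJ) (.var xJ + .const 1)).val s =
      tableAddr d n 0 i' j (j + 1) := by rw [tableAddrE_val hn]; simp [hP, hJ]
  refine ⟨⟨tableAddrE_safe hW hn Nat.two_pos trivial trivial (by simpa [hJ, and_comm] using hW1)
    (hP.trans_lt hi') (hJ.trans_lt (by omega)) (by simpa [hJ] using hj), ?_⟩, ⟨trivial, trivial⟩,
    fun h => ?_, fun h => ⟨?_, ?_⟩⟩
  · rw [h1]; exact tableAddr_lt hM Nat.two_pos hi' (by omega) hj
  · have h' : s.r rHi < lo i' j (j + 1) := by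
      simpa [Cond.Holds, h1, ht.lo i' hi' j (by omega) (j + 1) hj] using h
    refine Relaxed.imp (Relaxed.of_eq (fun _ _ => rfl) rfl rfl) ?_ ?_ <;> simp [not_le.2 h']
  · exact succValueE_safe hM hW (s := { s with r := _ }) (a := .var xP) (b := .var xJ) hn
      Nat.two_pos trivial trivial (hP.trans_lt hi') (hJ.trans_lt (by omega)) hb
  · have h' : lo i' j (j + 1) ≤ s.r rHi := by
      simpa [Cond.Holds, h1, ht.lo i' hi' j (by omega) (j + 1) hj] using h
    have h2 : ∀ f, (succValueE 0 (.var xP) (.var xJ)).val { s with r := f } =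
        succValue n (valueMem n s) (node n 0 i' j) := fun f => by
      rw [succValueE_val (s := { s with r := f }) hn, ← hP, ← hJ]; rfl
    rw [h2]
    refine Cmd.vc.mono _ (relax_vc hM hW (i := i) (j := j) (s := { s with n := Function.update s.n xX _, r := _ })
      hn hI hJ
      hi_lt (by omega) Nat.one_lt_two) ?_
    rintro s₁ ⟨e1, e2, r1⟩
    refine (r1.of_left (fun x hx => Function.update_of_ne hx _ _) rfl rfl).imp ?_ ?_
    · intro w; simp
    · intro w; simp [h']

theorem relaxAll_vc (hM : space d n ≤ M) (hW : wordBound d n ≤ W) (ht : TableMem d n lo hi s)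
    (hI : s.n xI = i) (hP : s.n xP = i') (hJ : s.n xJ = j) (hi_lt : i < n) (hi' : i' < i)
    (hj : j + 1 < n) (htl : s.n xTl ≤ n) (hb : ∀ u < numNodes n, valueMem n s u ≤ unreached n) :
    (relaxAll d).vc M W (Relaxed n i j
      (fun w => lo i j (j + 1) ≤ hi i j (j + 1) ∧ s.n xHd < s.n xTl ∧ queueMem n s (s.n xHd) ≤ w)
      (fun w => lo i j (j + 1) ≤ hi i j (j + 1) ∧
        (s.n xHd < s.n xTl ∧ queueMem n s (s.n xHd) ≤ w ∨
        lo i' j (j + 1) ≤ hi i j (j + 1) ∧ succValue n (valueMem n s) (node n 0 i' j) ≤ w)) s) s := by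
  have hn := ht.n_eq
  have hW1 : j + 1 ≤ W ∧ 1 ≤ W := by unfold wordBound at hW; omega
  have h1 : ∀ k f, (tableAddrE d k (.var xI) (.var xJ) (.var xJ + .const 1)).val { s with r := f } =
      tableAddr d n k i j (j + 1) := fun k f => by
    rw [tableAddrE_val (s := { s with r := f }) hn]; simp [hI, hJ]
  have h2 : ∀ k < 2, ∀ f, (tableAddrE d k (.var xI) (.var xJ) (.var xJ + .const 1)).Safe M W
      { s with r := f } := fun k hk f =>
    tableAddrE_safe (s := { s with r := f }) hW hn hk trivial trivial
      (by simpa [hJ, and_comm] using hW1) (hI.trans_lt hi_lt) (hJ.trans_lt (by omega))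
      (by simpa [hJ] using hj)
  refine ⟨⟨h2 0 Nat.two_pos s.r, ?_⟩, ⟨h2 1 Nat.one_lt_two _, ?_⟩, ⟨trivial, trivial⟩, fun h => ?_,
    fun h => ?_⟩
  · rw [h1 0 s.r]; exact tableAddr_lt hM Nat.two_pos hi_lt (by omega) hj
  · rw [h1]; exact tableAddr_lt hM Nat.one_lt_two hi_lt (by omega) hj
  · have h' : hi i j (j + 1) < lo i j (j + 1) := by
      simpa [Cond.Holds, h1, h1 0 s.r, ht.lo i hi_lt j (by omega) (j + 1) hj,
        ht.hi i hi_lt j (by omega) (j + 1) hj] using h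
    refine Relaxed.imp (Relaxed.of_eq (fun _ _ => rfl) rfl rfl) ?_ ?_ <;> simp [not_le.2 h']
  · have h' : lo i j (j + 1) ≤ hi i j (j + 1) := by
      simpa [Cond.Holds, h1, h1 0 s.r, ht.lo i hi_lt j (by omega) (j + 1) hj,
        ht.hi i hi_lt j (by omega) (j + 1) hj] using h
    refine Cmd.vc.seq (relaxFresh_vc hM hW (i := i) (j := j) (s := { s with r := _ }) hn hI hJ hi_lt
      (by omega) htl) ?_
    rintro s₁ ⟨e1, r1⟩
    have e2 : s₁.r rHi = hi i j (j + 1) := by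
      rw [e1]; simp [h1, ht.hi i hi_lt j (by omega) (j + 1) hj]
    have hb1 : ∀ u < numNodes n, valueMem n s₁ u ≤ unreached n := by
      intro u hu
      by_cases h0 : u = node n 0 i j
      · rw [h0, r1.zero]; exact Or.inl (hb _ (h0 ▸ hu))
      by_cases h0' : u = node n 1 i j
      · rw [h0', r1.one]; exact Or.inl (hb _ (h0' ▸ hu))
      · rw [valueMem, r1.other _ (by rwa [Ne, valueAddr_inj]) (by rwa [Ne, valueAddr_inj])]
        exact hb u hu
    have ht1 : TableMem d n lo hi s₁ := ht.congr ((r1.reg _ (by decide)).trans hn)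
      fun a _ => by rw [r1.rm]
    refine (relaxSame_vc hM hW (i := i) (j := j) (i' := i') ht1 ((r1.reg _ (by decide)).trans hI)
      ((r1.reg _ (by decide)).trans hP) ((r1.reg _ (by decide)).trans hJ) hi_lt (by omega) hj
      hb1).mono _ ?_
    intro s₂ r2
    -- The first lowering has changed nodes of vertex `i` only, and `i' ≠ i`.
    have e3 : succValue n (valueMem n s₁) (node n 0 i' j) =
        succValue n (valueMem n s) (node n 0 i' j) := by
      have h0 : node n 0 i' j ≠ node n 0 i j := fun h0 =>
        hi'.ne (node_inj Nat.two_pos (by omega) Nat.two_pos (by omega) h0).2.1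
      have h0' : node n 0 i' j ≠ node n 1 i j := fun h0 =>
        hi'.ne (node_inj Nat.two_pos (by omega) Nat.one_lt_two (by omega) h0).2.1
      unfold succValue cost
      rw [valueMem, r1.other _ (by rwa [Ne, valueAddr_inj]) (by rwa [Ne, valueAddr_inj])]
      rfl
    refine ((r1.trans r2).of_left (s₀ := s) (fun _ _ => rfl) rfl rfl).imp ?_ ?_
    · intro w; simp [h', queueMem]
    · intro w; simp [h', e2, e3, queueMem]

/-- By `IsPassed.head_le_iff` the test on the head of the queue is the existence of a link into the
current cell, so the processed cells grow by one. -/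
theorem relaxAll_passed (hM : space d n ≤ M) (hW : wordBound d n ≤ W)
    (hs : StripPassed d n lo hi V₀ i i' (s.n xJ) s) (hi_lt : i < n) (hi' : i' < i)
    (hj : s.n xJ + 1 < n) :
    (relaxAll d).vc M W (fun s' => StripPassed d n lo hi V₀ i i' (s.n xJ + 1) s' ∧
      s'.n xJ = s.n xJ ∧ s'.n xHd = s.n xHd ∧ s'.n xTl = s.n xTl) s := by
  have hc := hs.core
  have htl := hs.tl_le
  have hn := hc.table.n_eq
  refine (relaxAll_vc hM hW hc.table hc.i_eq hc.p_eq rfl hi_lt hi' hj (by omega) hc.bound).mono _ ?_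
  intro s' r
  have eJ := r.reg xJ (by decide)
  have eH := r.reg xHd (by decide)
  have eT := r.reg xTl (by decide)
  have hother : ∀ u, u ≠ node n 0 i (s.n xJ) → u ≠ node n 1 i (s.n xJ) →
      valueMem n s' u = valueMem n s u := fun u h0 h1 =>
    r.other _ (by rwa [Ne, valueAddr_inj]) (by rwa [Ne, valueAddr_inj])
  have hq : queueMem n s' = queueMem n s := by
    funext a
    exact r.other _ (valueAddr_ne_queueAddr (node_lt Nat.two_pos hi_lt (by omega))).symm
      (valueAddr_ne_queueAddr (node_lt Nat.one_lt_two hi_lt (by omega))).symm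
  have hh : heightMem d n s' = heightMem d n s := by unfold heightMem; rw [r.rm]
  have hsucc : ∀ τ < 2, ∀ jj < n, succValue n (valueMem n s) (node n τ i' jj) =
      succValue n V₀ (node n τ i' jj) := fun τ hτ jj hjj => by
    unfold succValue cost; rw [hc.other τ i' jj hτ (by omega) hjj hi'.ne]
  have key : ∀ w < unreached n, (s.n xHd < s.n xTl ∧ queueMem n s (s.n xHd) ≤ w) ↔
      ∃ j' < s.n xJ, Heights (fun m => lo m i' i) (fun m => hi m i' i) j' (s.n xJ) ∧
        succValue n V₀ (node n 1 i' j') ≤ w := fun w hw => hs.passed.head_le_iff hw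
  refine ⟨⟨⟨?_, ?_, ?_, ?_, ?_, fun u hu => ?_, fun τ ii jj hτ hii hjj hne => ?_,
    fun jj hjj w hw => ?_⟩, ?_, ?_⟩, eJ, eH, eT⟩
  · exact hc.table.congr ((r.reg _ (by decide)).trans hn) fun a _ => by rw [r.rm]
  · rw [r.reg _ (by decide), hc.i_eq]
  · rw [r.reg _ (by decide), hc.p_eq]
  · omega
  · have := hc.le
    omega
  · by_cases h0 : u = node n 0 i (s.n xJ)
    · rw [h0, r.zero]; exact Or.inl (hc.bound _ (h0 ▸ hu))
    by_cases h1 : u = node n 1 i (s.n xJ)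
    · rw [h1, r.one]; exact Or.inl (hc.bound _ (h1 ▸ hu))
    · rw [hother u h0 h1]; exact hc.bound u hu
  · rw [hother _ (fun h => hne (node_inj hτ hjj Nat.two_pos (by omega) h).2.1)
      (fun h => hne (node_inj hτ hjj Nat.one_lt_two (by omega) h).2.1)]
    exact hc.other τ ii jj hτ hii hjj hne
  · obtain ⟨h1, h2⟩ := hc.row jj hjj w hw
    by_cases hjJ : jj = s.n xJ
    · subst hjJ
      rw [r.zero, r.one, h1, h2, hsucc 0 Nat.two_pos _ (by omega), key w hw]
      simp only [lt_irrefl, false_and, or_false, Nat.lt_succ_self, true_and, FreshPred, SamePred]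
      rw [and_or_left, and_left_comm (b := lo i' _ _ ≤ _)]
    · have e : ∀ τ < 2, valueMem n s' (node n τ i jj) = valueMem n s (node n τ i jj) := fun τ hτ =>
        hother _ (fun h => hjJ (node_inj hτ (by omega) Nat.two_pos (by omega) h).2.2)
          (fun h => hjJ (node_inj hτ (by omega) Nat.one_lt_two (by omega) h).2.2)
      rw [e 0 Nat.two_pos, e 1 Nat.one_lt_two, h1, h2, show jj < s.n xJ + 1 ↔ jj < s.n xJ by omega]
      exact ⟨Iff.rfl, Iff.rfl⟩
  · omega
  · rw [hh, hq, eJ, eH, eT]; exact hs.passed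

theorem advance_vc (hM : space d n ≤ M) (hW : wordBound d n ≤ W)
    (hs : StripPassed d n lo hi V₀ i i' (s.n xJ + 1) s) (hi_lt : i < n) (hi' : i' < i)
    (hj : s.n xJ + 1 < n) :
    advance.vc M W (fun s' => StripInv d n lo hi V₀ i i' s' ∧ s'.n xJ = s.n xJ + 1 ∧
      s'.n xHd = s.n xHd ∧ s'.n xTl = s.n xTl) s := by
  have hc := hs.core
  have hn := hc.table.n_eq
  have hP := hc.p_eq
  have hW1 : s.n xJ + 1 ≤ W ∧ 1 ≤ W := by unfold wordBound at hW; omega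
  have hv : (succValueE 1 (.var xP) (.var xJ)).val s = entryValue n V₀ i' (s.n xJ) := by
    rw [succValueE_val hn]
    unfold entryValue succValue cost
    simp only [NExp.val_var, hP]
    rw [hc.other 1 i' _ Nat.one_lt_two (by omega) (by omega) hi'.ne]
  refine ⟨succValueE_safe hM hW hn Nat.one_lt_two trivial trivial (hP.trans_lt (by omega))
    (show s.n xJ < n by omega) hc.bound, by simpa [and_comm] using hW1, ⟨?_, ?_, ?_⟩, ?_, ?_, ?_⟩
  · refine hc.congr (hc.table.congr hn fun _ _ => rfl) rfl rfl ?_ hc.le (fun _ _ => rfl) hi_lt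
    simpa using hj
  · simpa using hs.tl_le
  · rw [hv]
    exact hs.passed.next
  · simp
  · simp
  · simp

end

/-! ### The loop over a strip -/

section
variable {d n M W : ℕ} {s : State} {lo hi : ℕ → ℕ → ℕ → ℝ} {V₀ : ℕ → ℕ} {i i' j : ℕ}

/-- Bounds the number of iterations of the loop over a strip. -/
def stripMeasure (n : ℕ) (s : State) : ℕ := 2 * (n - s.n xJ) + (s.n xTl - s.n xHd)

/-- Passing a vertex lowers the first summand of the measure by `2` and lengthens the queue by at
most `1`; hence the weight `2`. -/
theorem passVertex_vc (hM : space d n ≤ M) (hW : wordBound d n ≤ W)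
    (hs : StripInv d n lo hi V₀ i i' s) (hi_lt : i < n) (hi' : i' < i) (hj : s.n xJ + 1 < n)
    (ha : s.r rA = lo (s.n xJ) i' i) (hb : s.r rB = hi (s.n xJ) i' i)
    (hf : s.n xHd < s.n xTl → heightMem d n s (s.n xHd) ≤ s.r rB)
    (hl : s.n xHd < s.n xTl → queueMem n s (s.n xTl - 1) < s.n xCur ∧
      s.r rA < heightMem d n s (s.n xTl - 1)) :
    (passVertex d).vc M W (fun s' => StripInv d n lo hi V₀ i i' s' ∧
      stripMeasure n s' < stripMeasure n s) s := by
  refine Cmd.vc.seq (enqueue_vc hM hW hs hi_lt ha hb hf hl) ?_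
  rintro s₁ ⟨h1, e1, m1⟩
  rw [← e1] at h1
  refine Cmd.vc.seq (relaxAll_passed hM hW h1 hi_lt hi' (by omega)) ?_
  rintro s₂ ⟨h2, e2, e3, e4⟩
  rw [← e2] at h2
  refine Cmd.vc.mono _ (advance_vc hM hW h2 hi_lt hi' (by omega)) ?_
  rintro s₃ ⟨h3, e5, e6, e7⟩
  refine ⟨h3, ?_⟩
  unfold stripMeasure
  omega

theorem StripInv.of_regs {f : Fin numVars → ℕ} (hs : StripInv d n lo hi V₀ i i' s) (hi_lt : i < n)
    (hN : f xN = s.n xN) (hI : f xI = s.n xI) (hP : f xP = s.n xP) (hJ : f xJ = s.n xJ)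
    (hle : f xHd ≤ f xTl) (htl : f xTl ≤ s.n xTl)
    (hq : IsQueue (fun m => lo m i' i) (fun m => hi m i' i) (entryValue n V₀ i') (unreached n)
      (heightMem d n s) (queueMem n s) (s.n xJ) (f xHd) (f xTl) (f xCur)) :
    StripInv d n lo hi V₀ i i' { s with n := f } where
  core := by
    have := hs.core.congr (s' := { s with n := f })
      (hs.core.table.congr (hN.trans hs.core.table.n_eq) fun _ _ => rfl)
      hI hP (hJ.trans_lt hs.core.j_lt) hle (fun _ _ => rfl) hi_lt
    dsimp only
    rwa [hJ]
  tl_le := by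
    have := hs.tl_le
    dsimp only
    omega
  queue := by
    dsimp only
    rw [hJ]
    exact hq

/-- The three pops are `popFront`, `popBack_of_le` and `popBack_of_low`; each shortens the queue by
one. If none applies, the vertex is passed. -/
theorem stripBranch_vc (hM : space d n ≤ M) (hW : wordBound d n ≤ W)
    (hs : StripInv d n lo hi V₀ i i' s) (hi_lt : i < n) (hi' : i' < i) (hj : s.n xJ + 1 < n)
    (ha : s.r rA = lo (s.n xJ) i' i) (hb : s.r rB = hi (s.n xJ) i' i) :
    (stripBranch d).vc M W (fun s' => StripInv d n lo hi V₀ i i' s' ∧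
      stripMeasure n s' < stripMeasure n s) s := by
  have hn := hs.core.table.n_eq
  have hle := hs.core.le
  have htl := hs.tl_le
  have hW1 : s.n xHd + 1 ≤ W ∧ 1 ≤ W ∧ s.n xTl - 1 ≤ W := by unfold wordBound at hW; omega
  refine ⟨⟨trivial, trivial⟩, fun h => ?_, fun h => ?_⟩
  swap
  · have h' : ¬ s.n xHd < s.n xTl := h
    exact passVertex_vc hM hW hs hi_lt hi' hj ha hb (fun h => absurd h h') fun h => absurd h h'
  have h' : s.n xHd < s.n xTl := h
  have e1 : (heightAddrE d (.var xHd)).val s = heightAddr d n (s.n xHd) := heightAddrE_val hn _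
  have e2 : (queueAddrE (.var xTl - .const 1)).val s = queueAddr n (s.n xTl - 1) :=
    queueAddrE_val hn _
  have e3 : (heightAddrE d (.var xTl - .const 1)).val s = heightAddr d n (s.n xTl - 1) :=
    heightAddrE_val hn _
  have sub : (NExp.var xTl - NExp.const 1).Safe M W s := by simpa using hW1.2
  have lt : (NExp.var xTl - NExp.const 1).val s < n := by simp; omega
  refine ⟨⟨trivial, heightAddrE_safe hW hn trivial (show s.n xHd < n by omega),
    e1.trans_lt (heightAddr_lt hM (by omega))⟩, fun h1 => ?_, fun h1 => ?_⟩
  · have h1' : hi (s.n xJ) i' i < heightMem d n s (s.n xHd) := by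
      simpa [Cond.Holds, e1, heightMem, hb] using h1
    refine ⟨by simpa using ⟨hW1.2.1, hW1.1⟩, hs.of_regs hi_lt rfl rfl rfl rfl ?_ ?_ ?_, ?_⟩
    · simpa using h'
    · simp
    · exact hs.queue.popFront h1'
    · simp only [stripMeasure, NExp.val_add, NExp.val_var, NExp.val_const, ne_eq, Fin.reduceEq,
        not_false_eq_true, Function.update_of_ne, Function.update_self]
      omega
  have h1' : heightMem d n s (s.n xHd) ≤ s.r rB := by
    simpa [Cond.Holds, e1, heightMem] using h1
  have hq := hs.queue
  rw [show s.n xTl = s.n xTl - 1 + 1 by omega] at hq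
  refine ⟨⟨⟨queueAddrE_safe hW hn sub lt, e2.trans_lt (queueAddr_lt hM (by omega))⟩, trivial⟩,
    fun h2 => ?_, fun h2 => ?_⟩
  swap
  · have h2' : s.n xCur ≤ queueMem n s (s.n xTl - 1) := by
      simpa [Cond.Holds, e2, queueMem] using h2
    refine ⟨sub, hs.of_regs hi_lt rfl rfl rfl rfl ?_ ?_ ?_, ?_⟩
    · simp; omega
    · simp
    · exact hq.popBack_of_le h2'
    · simp only [stripMeasure, NExp.val_sub, NExp.val_var, NExp.val_const, ne_eq, Fin.reduceEq,
        not_false_eq_true, Function.update_of_ne, Function.update_self]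
      omega
  have h2' : queueMem n s (s.n xTl - 1) < s.n xCur := by
    simpa [Cond.Holds, e2, queueMem] using h2
  refine ⟨⟨trivial, heightAddrE_safe hW hn sub lt, e3.trans_lt (heightAddr_lt hM (by omega))⟩,
    fun h3 => ?_, fun h3 => ?_⟩
  · have h3' : s.r rA < heightMem d n s (s.n xTl - 1) := by
      simpa [Cond.Holds, e3, heightMem] using h3
    exact passVertex_vc hM hW hs hi_lt hi' hj ha hb (fun _ => h1') fun _ => ⟨h2', h3'⟩
  · have h3' : heightMem d n s (s.n xTl - 1) ≤ lo (s.n xJ) i' i := by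
      simpa [Cond.Holds, e3, heightMem, ha] using h3
    have e4 : (queueAddrE (.var xTl)).val { s with n := Function.update s.n xTl (s.n xTl - 1) } =
        queueAddr n (s.n xTl - 1) :=
      queueAddrE_val (s := { s with n := Function.update s.n xTl (s.n xTl - 1) }) hn _
    refine ⟨sub, ⟨queueAddrE_safe (s := { s with n := Function.update s.n xTl (s.n xTl - 1) }) hW hn
      trivial (by simp; omega), ?_⟩, ?_⟩
    · exact e4.trans_lt (queueAddr_lt hM (by omega))
    · refine ⟨hs.of_regs (f := Function.update (Function.update s.n xTl _) xCur _) hi_lt rfl rfl rfl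
        rfl ?_ ?_ ?_, ?_⟩
      · simp; omega
      · simp
      · have := hq.popBack_of_low (by omega) h2'.le h3'
        convert this using 1
        · simp
        · simp
        · exact congrArg s.nm e4
      · simp only [stripMeasure, NExp.val_sub, NExp.val_var, NExp.val_const, ne_eq, Fin.reduceEq,
          not_false_eq_true, Function.update_of_ne, Function.update_self]
        omega

theorem stripBody_vc (hM : space d n ≤ M) (hW : wordBound d n ≤ W)
    (hs : StripInv d n lo hi V₀ i i' s) (hi_lt : i < n) (hi' : i' < i) (hj : s.n xJ + 1 < n) :
    (stripBody d).vc M W (fun s' => StripInv d n lo hi V₀ i i' s' ∧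
      stripMeasure n s' < stripMeasure n s) s := by
  have hc := hs.core
  have hn := hc.table.n_eq
  have hI := hc.i_eq
  have hP := hc.p_eq
  have h1 : ∀ k f, (tableAddrE d k (.var xJ) (.var xP) (.var xI)).val { s with r := f } =
      tableAddr d n k (s.n xJ) i' i := fun k f => by
    rw [tableAddrE_val (s := { s with r := f }) hn]; simp [hI, hP]
  have h2 : ∀ k < 2, ∀ f, (tableAddrE d k (.var xJ) (.var xP) (.var xI)).Safe M W
      { s with r := f } := fun k hk f =>
    tableAddrE_safe (s := { s with r := f }) hW hn hk trivial trivial trivial hc.j_lt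
      (hP.trans_lt (by omega)) (hI.trans_lt hi_lt)
  have h3 : ∀ k < 2, tableAddr d n k (s.n xJ) i' i < M := fun k hk =>
    tableAddr_lt hM hk hc.j_lt (by omega) hi_lt
  refine ⟨⟨h2 0 Nat.two_pos s.r, ?_⟩, ⟨h2 1 Nat.one_lt_two _, ?_⟩, ?_⟩
  · exact (h1 0 s.r).trans_lt (h3 0 Nat.two_pos)
  · rw [h1]; exact h3 1 Nat.one_lt_two
  · refine stripBranch_vc (s := { s with r := _ }) hM hW ⟨⟨⟨hn, hc.table.lo, hc.table.hi⟩, hI, hP,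
      hc.j_lt, hc.le, hc.bound, hc.other, hc.row⟩, hs.tl_le, hs.queue⟩ hi_lt hi' hj ?_ ?_
    · simp [h1 0 s.r, hc.table.lo _ hc.j_lt i' (by omega) i hi_lt]
    · simp [h1, hc.table.hi _ hc.j_lt i' (by omega) i hi_lt]

end

/-! #### All strips -/

section
variable {d n M W : ℕ} {s : State} {lo hi : ℕ → ℕ → ℕ → ℝ} {V V' : ℕ → ℕ} {i i' : ℕ}

theorem succValue_congr {u : ℕ} (h : V' u = V u) : succValue n V' u = succValue n V u := by
  unfold succValue cost; rw [h]

theorem freshPred_congr {w j : ℕ} (hj : j < n) (h : ∀ jj < n, V' (node n 1 i' jj) = V (node n 1 i' jj)) :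
    FreshPred n lo hi V' w i' i j ↔ FreshPred n lo hi V w i' i j := by
  unfold FreshPred
  refine and_congr_right fun _ => exists_congr fun j' => and_congr_right fun hj' =>
    and_congr_right fun _ => ?_
  rw [succValue_congr (h j' (by omega))]

theorem samePred_congr {w j : ℕ} (h : V' (node n 0 i' j) = V (node n 0 i' j)) :
    SamePred n lo hi V' w i' i j ↔ SamePred n lo hi V w i' i j := by
  unfold SamePred
  rw [succValue_congr h]

/-- The specification reads only row `i` and the rows below `b`. -/
theorem RowSpec.congr {b : ℕ} (h : RowSpec n lo hi V i b)
    (hV : ∀ τ < 2, ∀ ii jj, ii = i ∨ ii < b → jj < n → V' (node n τ ii jj) = V (node n τ ii jj)) :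
    RowSpec n lo hi V' i b := by
  intro j hj w hw
  obtain ⟨h1, h2⟩ := h j hj w hw
  rw [hV 0 Nat.two_pos i j (Or.inl rfl) (by omega), hV 1 Nat.one_lt_two i j (Or.inl rfl) (by omega),
    h1, h2]
  refine ⟨or_congr Iff.rfl (exists_congr fun ii => and_congr_right fun hii => ?_),
    or_congr Iff.rfl (exists_congr fun ii => and_congr_right fun hii => ?_)⟩
  · exact (freshPred_congr (by omega) fun jj hjj => hV 1 Nat.one_lt_two ii jj (Or.inr hii) hjj).symm
  · exact (or_congr
      (freshPred_congr (by omega) fun jj hjj => hV 1 Nat.one_lt_two ii jj (Or.inr hii) hjj)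
      (samePred_congr (hV 0 Nat.two_pos ii j (Or.inr hii) (by omega)))).symm

/-- The values of the vertices below `i` are final, those of vertex `i` take into account all links
from vertices below `i'`. -/
structure PartialTable (n : ℕ) (lo hi : ℕ → ℕ → ℕ → ℝ) (i i' : ℕ) (V : ℕ → ℕ) : Prop where
  bound : ∀ u < numNodes n, V u ≤ unreached n
  start : V (node n 1 0 0) = 0
  below : ∀ ii < i, RowSpec n lo hi V ii ii
  current : i < n → RowSpec n lo hi V i i'
  above : ∀ ii < n, i < ii → RowSpec n lo hi V ii 0

theorem PartialTable.nextRow (h : PartialTable n lo hi i i V) (hi_lt : i < n) :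
    PartialTable n lo hi (i + 1) 0 V where
  bound := h.bound
  start := h.start
  below ii hii := by
    rcases Nat.lt_succ_iff_lt_or_eq.1 hii with hlt | hlt
    · exact h.below ii hlt
    · subst hlt
      exact h.current hi_lt
  current hi := h.above _ hi (by omega)
  above ii hii hlt := h.above ii hii (by omega)

/-- A strip changes row `i` only, while its predecessors lie in rows below `i`. So old and new
values may be exchanged in all link conditions. -/
theorem PartialTable.nextStrip (h : PartialTable n lo hi i i' V) (hi_pos : 1 ≤ i) (hi_lt : i < n)
    (hi' : i' < i) (bound : ∀ u < numNodes n, V' u ≤ unreached n)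
    (other : ∀ τ ii jj, τ < 2 → ii < n → jj < n → ii ≠ i → V' (node n τ ii jj) = V (node n τ ii jj))
    (row : ∀ jj, jj + 1 < n → ∀ w < unreached n,
      (V' (node n 0 i jj) ≤ w ↔ V (node n 0 i jj) ≤ w ∨ FreshPred n lo hi V w i' i jj) ∧
      (V' (node n 1 i jj) ≤ w ↔ V (node n 1 i jj) ≤ w ∨
        (FreshPred n lo hi V w i' i jj ∨ SamePred n lo hi V w i' i jj))) :
    PartialTable n lo hi i (i' + 1) V' where
  bound := bound
  start := (other 1 0 0 Nat.one_lt_two (by omega) (by omega) (by omega)).trans h.start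
  below ii hii := (h.below ii hii).congr fun τ hτ ii' jj hii' hjj =>
    other τ ii' jj hτ (by omega) hjj (by omega)
  above ii hii hlt := (h.above ii hii hlt).congr fun τ hτ ii' jj hii' hjj =>
    other τ ii' jj hτ (by omega) hjj (by omega)
  current _ := by
    intro j hj w hw
    obtain ⟨h1, h2⟩ := h.current hi_lt j hj w hw
    obtain ⟨h3, h4⟩ := row j hj w hw
    have e1 : ∀ ii < i' + 1, (FreshPred n lo hi V' w ii i j ↔ FreshPred n lo hi V w ii i j) :=
      fun ii hii => freshPred_congr (by omega) fun jj hjj =>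
        other 1 ii jj Nat.one_lt_two (by omega) hjj (by omega)
    have e2 : ∀ ii < i' + 1, (SamePred n lo hi V' w ii i j ↔ SamePred n lo hi V w ii i j) :=
      fun ii hii => samePred_congr (other 0 ii j Nat.two_pos (by omega) (by omega) (by omega))
    rw [h3, h4, h1, h2, or_assoc, or_assoc,
      exists_congr fun ii => and_congr_right fun hii => e1 ii hii,
      exists_congr fun ii => and_congr_right fun hii => or_congr (e1 ii hii) (e2 ii hii),
      Nat.exists_lt_succ_right, Nat.exists_lt_succ_right]
    exact ⟨Iff.rfl, Iff.rfl⟩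

theorem PartialTable.of_unreached (hn : 1 ≤ n)
    (h : ∀ u < numNodes n, V u = if u < 2 then 0 else unreached n) : PartialTable n lo hi 1 0 V := by
  have h2 := two_le_numNodes hn
  have row : ∀ ii < n, RowSpec n lo hi V ii 0 := by
    intro ii hii j hj w hw
    have e : ∀ τ < 2, (V (node n τ ii j) ≤ w ↔ ii = 0 ∧ j = 0) := by
      intro τ hτ
      rw [h _ (node_lt hτ hii (by omega))]
      have : node n τ ii j < 2 ↔ ii = 0 ∧ j = 0 := by
        unfold node
        constructor
        · intro hlt
          have : ii * n + j = 0 := by omega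
          simp only [Nat.add_eq_zero_iff, Nat.mul_eq_zero] at this
          omega
        · rintro ⟨rfl, rfl⟩
          omega
      split_ifs with h0
      · simp [this.1 h0]
      · rw [← this]
        omega
    rw [e 0 Nat.two_pos, e 1 Nat.one_lt_two]
    simp
  exact ⟨fun u hu => by rw [h u hu]; split_ifs <;> omega, by rw [h _ (by simp [node]; omega)]; simp [node],
    fun ii hii => by obtain rfl : ii = 0 := by omega
                     exact row 0 (by omega), row 1, fun ii hii _ => row ii hii⟩

theorem PartialTable.isValueTable (h : PartialTable n lo hi n 0 V) : IsValueTable n lo hi V :=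
  ⟨h.start, h.below⟩

end

/-- The memory holds the table of intervals and a part of the values. -/
structure ValueMem (d n : ℕ) (lo hi : ℕ → ℕ → ℕ → ℝ) (i i' : ℕ) (s : State) : Prop where
  table : TableMem d n lo hi s
  values : PartialTable n lo hi i i' (valueMem n s)

section
variable {d n M W : ℕ} {s : State} {lo hi : ℕ → ℕ → ℕ → ℝ} {i i' : ℕ}

theorem stripInit_vc (hW : wordBound d n ≤ W)
    (hs : ValueMem d n lo hi i i' s) (hI : s.n xI = i) (hP : s.n xP = i') (hi_lt : i < n) :
    stripInit.vc M W (fun s₁ => StripInv d n lo hi (valueMem n s) i i' s₁ ∧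
      stripMeasure n s₁ = 2 * n) s := by
  have hn := hs.table.n_eq
  have e : ∀ f : Fin numVars → ℕ, f xN = s.n xN → unreachedE.val { s with n := f } = unreached n :=
    fun f hf => unreachedE_val (s := { s with n := f }) (hf.trans hn)
  refine ⟨Nat.zero_le _, Nat.zero_le _, Nat.zero_le _, unreachedE_safe hW hn, ⟨⟨⟨hn, hs.table.lo,
    hs.table.hi⟩, hI, hP, ?_, le_rfl, hs.values.bound, fun _ _ _ _ _ _ _ => rfl, ?_⟩, le_rfl, ?_⟩, ?_⟩
  · exact Nat.zero_lt_of_lt hi_lt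
  · intro jj hjj w hw
    refine ⟨⟨Or.inl, ?_⟩, ⟨Or.inl, ?_⟩⟩ <;>
    · rintro (h | ⟨h, -⟩)
      · exact h
      · exact absurd h (Nat.not_lt_zero jj)
  · let f := Function.update (Function.update (Function.update s.n xJ 0) xHd 0) xTl 0
    change IsQueue _ _ _ _ _ _ 0 0 0 (unreachedE.val { s with n := f })
    rw [e f rfl]
    exact isQueue_init _ _ _ _ _ _
  · simp [stripMeasure]

theorem strip_wp (hM : space d n ≤ M) (hW : wordBound d n ≤ W) (hs : ValueMem d n lo hi i i' s)
    (hI : s.n xI = i) (hP : s.n xP = i') (hi_pos : 1 ≤ i) (hi_lt : i < n) (hi' : i' < i) :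
    (strip d).WP M W (1 + (stripInit.code.cost +
      (1 + (loopTime (.nlt (.var xJ + .const 1) (.var xN)) (stripBody d).code.cost (2 * n) +
        (Cmd.nset xP (.var xP + .const 1)).code.cost))))
      (fun s' => ValueMem d n lo hi i (i' + 1) s' ∧ s'.n xI = i ∧ s'.n xP = i' + 1) s := by
  have hW1 : 1 ≤ W ∧ i' + 1 ≤ W ∧ n + 1 ≤ W := by unfold wordBound at hW; omega
  refine Cmd.WP.vc_seq (stripInit_vc hW hs hI hP hi_lt) ?_
  rintro s₁ ⟨h1, m1⟩
  refine Cmd.WP.seq_vc ((Cmd.WP.loop (StripInv d n lo hi (valueMem n s) i i') (stripMeasure n)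
    (B := (stripBody d).code.cost) h1 ?_ ?_).mono (by rw [m1]; exact le_rfl) fun _ h => h) ?_
  · intro s₂ h2
    have := h2.core.j_lt
    exact ⟨⟨trivial, hW1.1, show s₂.n xJ + 1 ≤ W by omega⟩, trivial⟩
  · intro s₂ h2 hj
    have hj' : s₂.n xJ + 1 < n := by simpa [Cond.Holds, h2.core.table.n_eq] using hj
    exact Cmd.WP.of_vc _ (stripBody_vc hM hW h2 hi_lt hi' hj')
  · rintro s₂ ⟨h2, hj⟩
    have hc := h2.core
    have hj' : n ≤ s₂.n xJ + 1 := by simpa [Cond.Holds, hc.table.n_eq] using hj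
    have hP2 := hc.p_eq
    refine ⟨⟨trivial, hW1.1, show s₂.n xP + 1 ≤ W by omega⟩,
      ⟨⟨hc.table.n_eq, hc.table.lo, hc.table.hi⟩, hs.values.nextStrip hi_pos hi_lt hi' hc.bound
        hc.other fun jj hjj w hw => ?_⟩, hc.i_eq, by simp [hP2]⟩
    have := hc.row jj hjj w hw
    -- The loop ends when `xJ + 1` reaches `n`, that is, after all `n - 1` cells have been
    -- processed.
    rwa [iff_true_intro (show jj < s₂.n xJ by omega), true_and, true_and] at this

/-- A bound on the running time of `strip`. -/
def stripTime (d n : ℕ) : ℕ :=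
  1 + (stripInit.code.cost +
    (1 + (loopTime (.nlt (.var xJ + .const 1) (.var xN)) (stripBody d).code.cost (2 * n) +
      (Cmd.nset xP (.var xP + .const 1)).code.cost)))

/-- A bound on the running time of `rowValues`. -/
def rowTime (d n : ℕ) : ℕ :=
  1 + ((Cmd.nset xP (.const 0)).code.cost +
    (1 + (loopTime (.nlt (.var xP) (.var xI)) (stripTime d n) n +
      (Cmd.nset xI (.var xI + .const 1)).code.cost)))

theorem rowValues_wp (hM : space d n ≤ M) (hW : wordBound d n ≤ W) (hs : ValueMem d n lo hi i 0 s)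
    (hI : s.n xI = i) (hi_pos : 1 ≤ i) (hi_lt : i < n) :
    (rowValues d).WP M W (rowTime d n) (fun s' => ValueMem d n lo hi (i + 1) 0 s' ∧
      s'.n xI = i + 1) s := by
  have hW1 : 1 ≤ W ∧ i + 1 ≤ W := by unfold wordBound at hW; omega
  refine Cmd.WP.vc_seq (R := fun s₁ => (ValueMem d n lo hi i (s₁.n xP) s₁ ∧ s₁.n xI = i ∧
    s₁.n xP ≤ i) ∧ s₁.n xP = 0) ⟨Nat.zero_le _, ⟨⟨⟨hs.table.n_eq, hs.table.lo, hs.table.hi⟩,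
      hs.values⟩, hI, Nat.zero_le _⟩, rfl⟩ ?_
  rintro s₁ ⟨h1, m1⟩
  refine Cmd.WP.seq_vc ((Cmd.WP.loop (fun s₁ => ValueMem d n lo hi i (s₁.n xP) s₁ ∧ s₁.n xI = i ∧
    s₁.n xP ≤ i) (fun s => i - s.n xP) (B := stripTime d n) h1 ?_ ?_).mono ?_ fun _ h => h) ?_
  · intro s₂ h2
    exact ⟨trivial, trivial⟩
  · rintro s₂ ⟨h2, h3, h4⟩ hlt
    have hlt' : s₂.n xP < i := by simpa [Cond.Holds, h3] using hlt
    refine (strip_wp hM hW h2 h3 rfl hi_pos hi_lt hlt').mono le_rfl ?_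
    rintro s₃ ⟨h5, h6, h7⟩
    refine ⟨⟨h7 ▸ h5, h6, by omega⟩, by omega⟩
  · unfold loopTime
    gcongr
    omega
  · rintro s₂ ⟨⟨h2, h3, h4⟩, hlt⟩
    have hlt' : i ≤ s₂.n xP := by simpa [Cond.Holds, h3] using hlt
    have e : s₂.n xP = i := by omega
    rw [e] at h2
    exact ⟨⟨trivial, hW1.1, show s₂.n xI + 1 ≤ W by omega⟩, ⟨⟨h2.table.n_eq, h2.table.lo,
      h2.table.hi⟩, h2.values.nextRow hi_lt⟩, by simp [h3]⟩

/-- A bound on the running time of `allValues`. -/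
def allTime (d n : ℕ) : ℕ :=
  1 + ((Cmd.nset xI (.const 1)).code.cost + loopTime (.nlt (.var xI) (.var xN)) (rowTime d n) n)

theorem allValues_wp (hM : space d n ≤ M) (hW : wordBound d n ≤ W) (hn1 : 1 ≤ n)
    (hs : TableMem d n lo hi s)
    (hV : ∀ u < numNodes n, valueMem n s u = if u < 2 then 0 else unreached n) :
    (allValues d).WP M W (allTime d n) (fun s' => TableMem d n lo hi s' ∧
      IsValueTable n lo hi (valueMem n s') ∧ ∀ u < numNodes n, valueMem n s' u ≤ unreached n) s := by
  have hW1 : 1 ≤ W := by unfold wordBound at hW; omega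
  refine Cmd.WP.vc_seq (R := fun s₁ => (ValueMem d n lo hi (s₁.n xI) 0 s₁ ∧ 1 ≤ s₁.n xI ∧
    s₁.n xI ≤ n) ∧ s₁.n xI = 1) ⟨hW1, ⟨⟨⟨hs.n_eq, hs.lo, hs.hi⟩, PartialTable.of_unreached hn1 hV⟩,
      le_rfl, hn1⟩, rfl⟩ ?_
  rintro s₁ ⟨h1, m1⟩
  refine (Cmd.WP.loop (fun s₁ => ValueMem d n lo hi (s₁.n xI) 0 s₁ ∧ 1 ≤ s₁.n xI ∧
    s₁.n xI ≤ n) (fun s => n - s.n xI) (B := rowTime d n) h1 ?_ ?_).mono ?_ ?_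
  · intro s₂ h2
    exact ⟨trivial, trivial⟩
  · rintro s₂ ⟨h2, h3, h4⟩ hlt
    have hlt' : s₂.n xI < n := by simpa [Cond.Holds, h2.table.n_eq] using hlt
    refine (rowValues_wp hM hW h2 rfl h3 hlt').mono le_rfl ?_
    rintro s₃ ⟨h5, h6⟩
    exact ⟨⟨h6 ▸ h5, by omega, by omega⟩, by omega⟩
  · unfold loopTime
    gcongr
    omega
  · rintro s₂ ⟨⟨h2, h3, h4⟩, hlt⟩
    have hlt' : n ≤ s₂.n xI := by simpa [Cond.Holds, h2.table.n_eq] using hlt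
    have e : s₂.n xI = n := by omega
    rw [e] at h2
    exact ⟨h2.table, h2.values.isValueTable, h2.values.bound⟩

end

/-! #### The output -/

def outputInit : Cmd :=
  .seq (.nset xU (nodeE 1 (.var xN - .const 1) (.var xN - .const 2)))
  (.seq (.nset xT (.load (valueAddrE (.var xU)) / numNodesE + .const 1)) (.nstore (.const 0) (.var xT)))

/-- The vertices are written from the last to the first. The remainder modulo `numNodes n`, which is
the predecessor, is computed by division and subtraction. -/
def outputBody : Cmd :=
  .seq (.nstore (.var xT) (.var xU / (.const 2 * .var xN)))
  (.seq (.nset xX (.load (valueAddrE (.var xU))))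
  (.seq (.nset xU (.var xX - .var xX / numNodesE * numNodesE)) (.nset xT (.var xT - .const 1))))

def output : Cmd := .seq outputInit (.loop (.nlt (.const 0) (.var xT)) outputBody)

/-- Follow predecessors `m` times, starting from the goal. -/
def backtrack (n : ℕ) (V : ℕ → ℕ) : ℕ → ℕ
  | 0 => node n 1 (n - 1) (n - 2)
  | m + 1 => V (backtrack n V m) % numNodes n

section
variable {d n M W : ℕ} {s : State} {V : ℕ → ℕ}

theorem backtrack_lt (hn : 1 ≤ n) (m : ℕ) : backtrack n V m < numNodes n := by
  cases m with
  | zero => exact node_lt Nat.one_lt_two (by omega) (by omega)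
  | succ m => exact Nat.mod_lt _ (by have := two_le_numNodes hn; omega)

/-- The vertices `t` with `s.n xT ≤ t < k` have been output. -/
structure OutputMem (n : ℕ) (V : ℕ → ℕ) (k : ℕ) (s : State) : Prop where
  n_eq : s.n xN = n
  count_le : s.n xT ≤ k
  current : s.n xU = backtrack n V (k - s.n xT)
  size : s.nm 0 = k
  out : ∀ t < k, s.n xT ≤ t → s.nm (t + 1) = backtrack n V (k - 1 - t) / (2 * n)
  values : ∀ u < numNodes n, valueMem n s u = V u

/-- The bound `hk` on the cost makes the output fit into the natural cells in front of the node
values. -/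
theorem outputInit_vc (hM : space d n ≤ M) (hW : wordBound d n ≤ W) (hn1 : 1 ≤ n)
    (hn : s.n xN = n) (hV : ∀ u < numNodes n, valueMem n s u = V u)
    (hk : cost n V (backtrack n V 0) ≤ n) :
    outputInit.vc M W (fun s' => OutputMem n V (cost n V (backtrack n V 0)) s' ∧
      s'.n xT = cost n V (backtrack n V 0)) s := by
  have hW1 : 2 ≤ W ∧ n ≤ W := by unfold wordBound at hW; omega
  have hlt := backtrack_lt (V := V) hn1 0
  have e1 : (nodeE 1 (.var xN - .const 1) (.var xN - .const 2)).val s = backtrack n V 0 := by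
    rw [nodeE_val hn]; simp [hn, backtrack]
  rw [cost] at hk
  let f := Function.update s.n xU (backtrack n V 0)
  have hf : f xN = n := hn
  have e2 : (NExp.load (valueAddrE (.var xU)) / numNodesE + .const 1).val { s with n := f } =
      cost n V (backtrack n V 0) := by
    rw [NExp.val_add, NExp.val_div, numNodesE_val (s := { s with n := f }) hf, NExp.val_load,
      valueAddrE_val (s := { s with n := f }) hf, cost, ← hV _ hlt]
    simp [valueMem, f]
  have h1 : (valueAddrE (.var xU)).Safe M W { s with n := f } :=
    valueAddrE_safe (s := { s with n := f }) (e := .var xU) hW hf trivial (by simpa [f] using hlt)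
  have h2 : (valueAddrE (.var xU)).val { s with n := f } < M := by
    rw [valueAddrE_val (s := { s with n := f }) hf]
    exact valueAddr_lt hM (by simpa [f] using hlt)
  have h3 := numNodesE_safe (M := M) (s := { s with n := f }) hW hf
  refine ⟨nodeE_safe hW hn Nat.one_lt_two ⟨trivial, ?_, ?_⟩ ⟨trivial, ?_, ?_⟩ ?_ ?_, ?_⟩
  · exact (by omega : 1 ≤ W)
  · exact (by omega : s.n xN - 1 ≤ W)
  · exact hW1.1
  · exact (by omega : s.n xN - 2 ≤ W)
  · simp; omega
  · simp; omega
  rw [e1]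
  change Cmd.vc M W (.seq _ _) _ { s with n := f }
  refine ⟨⟨⟨⟨h1, h2⟩, h3, ?_⟩, show 1 ≤ W by omega, ?_⟩, ?_⟩
  · have : (NExp.load (valueAddrE (.var xU)) / numNodesE).val { s with n := f } + 1 = _ := e2
    rw [cost] at this
    exact (by omega : (NExp.load (valueAddrE (.var xU)) / numNodesE).val { s with n := f } ≤ W)
  · exact (e2.trans_le hk).trans hW1.2
  · rw [e2]
    refine ⟨Nat.zero_le _, trivial, show 0 < M by omega, ⟨hn, ?_, ?_, ?_, ?_, ?_⟩, ?_⟩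
    · simp
    · simp [f]
    · simp
    · intro t ht ht'
      simp at ht'
      omega
    · intro u hu
      rw [← hV u hu]
      simp [valueMem, valueAddr]
    · simp

theorem outputBody_vc (hM : space d n ≤ M) (hW : wordBound d n ≤ W) (hn1 : 1 ≤ n)
    (hVb : ∀ u < numNodes n, V u ≤ unreached n) {k : ℕ} (hk : k ≤ n)
    (hs : OutputMem n V k s) (h0 : 0 < s.n xT) :
    outputBody.vc M W (fun s' => OutputMem n V k s' ∧ s'.n xT < s.n xT) s := by
  have hn := hs.n_eq
  have hW1 : 2 ≤ W ∧ 2 * n ≤ W ∧ n ≤ W ∧ unreached n ≤ W ∧ numNodes n ≤ W := by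
    have : (n + 1) * numNodes n = 2 * (n * n * n) + 2 * (n * n) := by unfold numNodes; ring
    have : numNodes n = 2 * (n * n) := rfl
    unfold wordBound at hW
    unfold unreached
    omega
  have hMn : n < M := by unfold space at hM; omega
  have hlt := backtrack_lt (V := V) hn1 (k - s.n xT)
  have hTk := hs.count_le
  have e0 : (NExp.var xU / (NExp.const 2 * NExp.var xN)).val s =
      backtrack n V (k - s.n xT) / (2 * n) := by
    simp [hn, hs.current]
  let g := Function.update s.nm (s.n xT) (backtrack n V (k - s.n xT) / (2 * n))
  -- The cell written has address at most `k ≤ n`, so the values still to be read are not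
  -- overwritten.
  have hg : ∀ u < numNodes n, valueMem n { s with nm := g } u = V u := by
    intro u hu
    rw [← hs.values u hu]
    exact Function.update_of_ne (by unfold valueAddr; omega) _ _
  have e1 : (valueAddrE (.var xU)).val { s with nm := g } =
      valueAddr n (backtrack n V (k - s.n xT)) := by
    rw [valueAddrE_val (s := { s with nm := g }) hn, ← hs.current]; rfl
  have e2 : (NExp.load (valueAddrE (.var xU))).val { s with nm := g } =
      V (backtrack n V (k - s.n xT)) := by
    rw [NExp.val_load, e1]
    exact hg _ hlt
  let f := Function.update s.n xX (V (backtrack n V (k - s.n xT)))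
  have e3 : ∀ r m, numNodesE.val ⟨f, r, m, s.rm⟩ = numNodes n := fun r m =>
    numNodesE_val (s := ⟨f, r, m, s.rm⟩) hn
  have e4 : (NExp.var xX - NExp.var xX / numNodesE * numNodesE).val { s with n := f, nm := g } =
      backtrack n V (k - (s.n xT - 1)) := by
    rw [NExp.val_sub, NExp.val_mul, NExp.val_div, e3, NExp.val_var,
      show k - (s.n xT - 1) = k - s.n xT + 1 by omega, backtrack, Nat.mod_eq_sub_div_mul]
    simp [f]
  have hX : V (backtrack n V (k - s.n xT)) ≤ W := (hVb _ hlt).trans hW1.2.2.2.1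
  have safeN := numNodesE_safe (M := M) (s := { s with n := f, nm := g }) hW hn
  refine ⟨trivial, ⟨trivial, ⟨hW1.1, trivial, ?_⟩, ?_⟩, ?_, ?_⟩
  · simpa [NatOp.eval, hn] using hW1.2.1
  · refine (Nat.div_le_self _ _).trans ?_
    simp only [NExp.val_var, hs.current]
    exact hlt.le.trans hW1.2.2.2.2
  · exact (by omega : s.n xT < M)
  rw [e0]
  change Cmd.vc M W (.seq _ _) _ { s with nm := g }
  refine ⟨⟨?_, ?_⟩, ?_⟩
  · exact valueAddrE_safe (s := { s with nm := g }) (e := .var xU) hW hn trivial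
      (hs.current.trans_lt hlt)
  · rw [e1]
    exact valueAddr_lt hM hlt
  rw [e2]
  change Cmd.vc M W (.seq _ _) _ { s with n := f, nm := g }
  refine ⟨⟨trivial, ⟨⟨trivial, safeN, ?_⟩, safeN, ?_⟩, ?_⟩, ?_⟩
  · exact (Nat.div_le_self _ _).trans hX
  · change (NExp.var xX / numNodesE).val _ * numNodesE.val _ ≤ W
    exact (Nat.div_mul_le_self _ _).trans hX
  · exact (Nat.sub_le _ _).trans hX
  rw [e4]
  refine ⟨⟨trivial, show 1 ≤ W by omega, ?_⟩, ⟨hn, ?_, ?_, ?_, ?_, hg⟩, ?_⟩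
  · exact (by omega : s.n xT - 1 ≤ W)
  · exact (by omega : s.n xT - 1 ≤ k)
  · rfl
  · exact (Function.update_of_ne h0.ne _ _).trans hs.size
  · intro t ht ht'
    have ht'' : s.n xT - 1 ≤ t := ht'
    by_cases he : t + 1 = s.n xT
    · change g (t + 1) = _
      rw [he, show k - 1 - t = k - s.n xT by omega]
      exact Function.update_self _ _ _
    · exact (Function.update_of_ne he _ _).trans (hs.out t ht (by omega))
  · exact (by omega : s.n xT - 1 < s.n xT)

/-- A bound on the running time of `output`. -/
def outputTime (n : ℕ) : ℕ :=
  1 + (outputInit.code.cost + loopTime (.nlt (.const 0) (.var xT)) outputBody.code.cost n)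

theorem output_wp (hM : space d n ≤ M) (hW : wordBound d n ≤ W) (hn1 : 1 ≤ n) (hn : s.n xN = n)
    (hVb : ∀ u < numNodes n, valueMem n s u ≤ unreached n)
    (hk : cost n (valueMem n s) (backtrack n (valueMem n s) 0) ≤ n) :
    output.WP M W (outputTime n) (fun s' =>
      s'.nm 0 = cost n (valueMem n s) (backtrack n (valueMem n s) 0) ∧
      ∀ t < s'.nm 0, s'.nm (t + 1) = backtrack n (valueMem n s) (s'.nm 0 - 1 - t) / (2 * n)) s := by
  refine Cmd.WP.vc_seq (outputInit_vc hM hW hn1 hn (fun _ _ => rfl) hk) ?_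
  generalize hkk : cost n (valueMem n s) (backtrack n (valueMem n s) 0) = k at hk ⊢
  rintro s₁ ⟨h1, m1⟩
  refine (Cmd.WP.loop (OutputMem n (valueMem n s) k) (fun s => s.n xT) (B := outputBody.code.cost)
    h1 ?_ ?_).mono ?_ ?_
  · exact fun s₂ h2 => ⟨Nat.zero_le _, trivial⟩
  · exact fun s₂ h2 h0 => Cmd.WP.of_vc _ (outputBody_vc hM hW hn1 hVb hk h2 h0)
  · unfold loopTime
    gcongr
    omega
  · rintro s₂ ⟨h2, h0⟩
    have h0' : s₂.n xT = 0 := Nat.eq_zero_of_not_pos h0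
    refine ⟨h2.size, fun t ht => ?_⟩
    rw [h2.size] at ht ⊢
    exact h2.out t ht (by omega)

end

/-! #### The whole program -/

def program (d : ℕ) : Cmd :=
  .seq (makeTable d) (.seq initValues (.seq (allValues d) output))

section
variable {d n M W : ℕ} {s : State} {p : Fin n → Pt d} {δ : ℝ}

theorem outputCorrect_of_table {V : ℕ → ℕ} {lo hi : ℕ → ℕ → ℕ → ℝ} {m : Memory} (hδ : 0 ≤ δ)
    (hn : 1 ≤ n) (hI : IsIntervalTable p δ lo hi) (hV : IsValueTable n lo hi V)
    (h0 : m.nat 0 = cost n V (backtrack n V 0))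
    (h : ∀ t < m.nat 0, m.nat (t + 1) = backtrack n V (m.nat 0 - 1 - t) / (2 * n)) :
    OutputCorrect p δ m := by
  have hlt : ∀ j, backtrack n V j / (2 * n) < n := fun j => by
    rw [Nat.div_lt_iff_lt_mul (by omega)]
    have := backtrack_lt (V := V) hn j
    unfold numNodes at this
    linarith
  refine ⟨fun t => ⟨backtrack n V (m.nat 0 - 1 - t) / (2 * n), hlt _⟩, fun t => h t t.2, ?_⟩
  refine isMinSimplification_of_pred hδ hn hI hV _ (fun t => backtrack n V (m.nat 0 - 1 - t)) h0 ?_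
    (fun t ht => ?_) fun t => rfl
  · simp [backtrack]
  · rw [show m.nat 0 - 1 - t = m.nat 0 - 1 - (t + 1) + 1 by omega, backtrack]

theorem cost_goal_le {V : ℕ → ℕ} {lo hi : ℕ → ℕ → ℕ → ℝ} (hδ : 0 ≤ δ) (hn : 1 ≤ n)
    (hI : IsIntervalTable p δ lo hi) (hV : IsValueTable n lo hi V) :
    cost n V (backtrack n V 0) ≤ n := by
  obtain rfl | hn2 : n = 1 ∨ 2 ≤ n := by omega
  · rw [backtrack, cost, hV.start, Nat.zero_div]
  · exact cost_le_of_isSimplification hδ hn2 hI hV (isSimplification_id hδ hn)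

/-- A bound on the running time of `program`. -/
def programTime (d n : ℕ) : ℕ :=
  1 + ((1 + ((Cmd.nset xT (.const 0)).code.cost +
      loopTime (.nlt (.var xT) (.var xN * .var xN * .var xN)) (makeTableBody d).code.cost (n * n * n))) +
    (1 + ((1 + ((Cmd.nset xT (.const 0)).code.cost + (1 + (loopTime (.nlt (.var xT) numNodesE) initBody.code.cost
        (numNodes n) + (Cmd.seq (.nstore (valueAddrE (.const 0)) (.const 0))
          (.nstore (valueAddrE (.const 1)) (.const 0))).code.cost)))) +
      (1 + (allTime d n + outputTime n)))))

theorem program_wp (hM : space d n ≤ M) (hW : wordBound d n ≤ W) (hδ : 0 ≤ δ) (hn : 1 ≤ n)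
    (hs : InputMem p δ s) (hnm : s.nm = fun _ => 0) :
    (program d).WP M W (programTime d n) (fun s' => OutputCorrect p δ ⟨s'.nm, s'.rm⟩) s := by
  have hI := isIntervalTable p hδ
  refine Cmd.WP.seq ((makeTable_wp hM hW hs hnm).mono le_rfl ?_)
  rintro s₁ ⟨h1, -⟩
  refine Cmd.WP.seq ((initValues_wp hM hW hn h1).mono le_rfl ?_)
  rintro s₂ ⟨h2, h3⟩
  refine Cmd.WP.seq ((allValues_wp hM hW hn h2 h3).mono le_rfl ?_)
  rintro s₃ ⟨h4, h5, h6⟩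
  refine (output_wp hM hW hn h4.n_eq h6 (cost_goal_le hδ hn hI h5)).mono le_rfl ?_
  rintro s₄ ⟨h7, h8⟩
  exact outputCorrect_of_table hδ hn hI h5 h7 h8

end

/-! #### Bounds -/

/-- `f n = O(n ^ k)`. -/
def PolyBounded (k : ℕ) (f : ℕ → ℕ) : Prop := ∃ K, ∀ n, 1 ≤ n → f n ≤ K * n ^ k

theorem PolyBounded.mono {k l : ℕ} {f g : ℕ → ℕ} (h : PolyBounded k f) (hkl : k ≤ l)
    (hg : ∀ n, g n ≤ f n) : PolyBounded l g := by
  obtain ⟨K, hK⟩ := h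
  exact ⟨K, fun n hn => (hg n).trans ((hK n hn).trans
    (Nat.mul_le_mul_left _ (Nat.pow_le_pow_right hn hkl)))⟩

theorem PolyBounded.const (k a : ℕ) : PolyBounded k fun _ => a :=
  ⟨a, fun _ hn => Nat.le_mul_of_pos_right a (pow_pos hn k)⟩

theorem PolyBounded.id : PolyBounded 1 fun n => n := ⟨1, fun _ _ => by simp⟩

theorem PolyBounded.add {k : ℕ} {f g : ℕ → ℕ} (hf : PolyBounded k f) (hg : PolyBounded k g) :
    PolyBounded k fun n => f n + g n := by
  obtain ⟨K, hK⟩ := hf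
  obtain ⟨L, hL⟩ := hg
  exact ⟨K + L, fun n hn => by rw [add_mul]; exact Nat.add_le_add (hK n hn) (hL n hn)⟩

theorem PolyBounded.mul {k l : ℕ} {f g : ℕ → ℕ} (hf : PolyBounded k f) (hg : PolyBounded l g) :
    PolyBounded (k + l) fun n => f n * g n := by
  obtain ⟨K, hK⟩ := hf
  obtain ⟨L, hL⟩ := hg
  exact ⟨K * L, fun m hm => (Nat.mul_le_mul (hK m hm) (hL m hm)).trans_eq (by ring)⟩

theorem PolyBounded.loopTime {k l : ℕ} {B m : ℕ → ℕ} (b : Cond) (hB : PolyBounded k B)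
    (hm : PolyBounded l m) : PolyBounded (k + l) fun n => loopTime b (B n) (m n) :=
  ((((hB.add (.const k _)).add (.const k 2)).mul hm).add (.const _ _)).add (.const _ 2)

/-- The amortized bound of `2 * n` rounds makes a strip linear; the two loops around it lead to the
exponent `3`. -/
theorem polyBounded_stripTime (d : ℕ) : PolyBounded 1 (stripTime d) :=
  (PolyBounded.const 1 1).add ((PolyBounded.const 1 _).add ((PolyBounded.const 1 1).add
    ((PolyBounded.loopTime (k := 0) _ (.const 0 _)
      ((PolyBounded.const 0 2).mul .id)).add (.const 1 _))))

theorem polyBounded_rowTime (d : ℕ) : PolyBounded 2 (rowTime d) :=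
  (PolyBounded.const 2 1).add ((PolyBounded.const 2 _).add ((PolyBounded.const 2 1).add
    ((PolyBounded.loopTime _ (polyBounded_stripTime d) .id).add (.const 2 _))))

theorem polyBounded_allTime (d : ℕ) : PolyBounded 3 (allTime d) :=
  (PolyBounded.const 3 1).add ((PolyBounded.const 3 _).add
    (PolyBounded.loopTime _ (polyBounded_rowTime d) .id))

theorem polyBounded_outputTime : PolyBounded 3 outputTime :=
  (PolyBounded.const 3 1).add ((PolyBounded.const 3 _).add
    ((PolyBounded.loopTime (k := 2) _ (.const 2 _) .id)))

theorem polyBounded_programTime (d : ℕ) : PolyBounded 3 (programTime d) := by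
  have hn3 : PolyBounded 3 fun n => n * n * n := (PolyBounded.id.mul .id).mul .id
  have hn2 : PolyBounded 3 numNodes :=
    ((PolyBounded.const 0 2).mul (PolyBounded.id.mul .id)).mono (by omega) fun _ => le_rfl
  have one : PolyBounded 3 fun _ => 1 := .const 3 1
  exact one.add ((one.add ((PolyBounded.const 3 _).add
    (PolyBounded.loopTime (k := 0) _ (.const 0 _) hn3))).add
    (one.add ((one.add ((PolyBounded.const 3 _).add (one.add
      ((PolyBounded.loopTime (k := 0) _ (.const 0 _) hn2).add (.const 3 _))))).add
    (one.add ((polyBounded_allTime d).add polyBounded_outputTime)))))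

theorem polyBounded_space (d : ℕ) : PolyBounded 3 fun n => 2 * space d n + 1 := by
  have hn3 : PolyBounded 3 fun n => n * n * n := (PolyBounded.id.mul .id).mul .id
  have hn2 : PolyBounded 3 fun n => n * n := (PolyBounded.id.mul .id).mono (by omega) fun _ => le_rfl
  have hn1 : PolyBounded 3 fun n => n := PolyBounded.id.mono (by omega) fun _ => le_rfl
  have two : PolyBounded 0 fun _ => 2 := .const 0 2
  refine PolyBounded.add (PolyBounded.mono (k := 3) (two.mul (((((hn1.mul (.const 0 d)).add
    (two.mul hn3)).add (two.mul hn2)).add ((PolyBounded.const 0 3).mul hn1)).add (.const 3 3))) le_rfl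
      fun _ => le_rfl) (.const 3 1)

/-- The constant factor is absorbed by the exponent: `K ≤ 2 ^ K ≤ (n + 1) ^ K`. -/
theorem exists_wordBound_le (d : ℕ) : ∃ c, ∀ n, 1 ≤ n → wordBound d n ≤ (n + 1) ^ c := by
  have hn3 : PolyBounded 3 fun n => n * n * n := (PolyBounded.id.mul .id).mul .id
  have hn2 : PolyBounded 3 fun n => n * n := (PolyBounded.id.mul .id).mono (by omega) fun _ => le_rfl
  have hn1 : PolyBounded 3 fun n => n := PolyBounded.id.mono (by omega) fun _ => le_rfl
  obtain ⟨K, hK⟩ : PolyBounded 3 (wordBound d) :=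
    ((PolyBounded.const 0 12).mul (((((hn1.mul (.const 0 d)).add hn3).add hn2).add hn1).add
      (.const 3 1))).add (.const 3 d)
  refine ⟨K + 3, fun n hn => (hK n hn).trans ?_⟩
  rw [pow_add]
  refine Nat.mul_le_mul ?_ (Nat.pow_le_pow_left (by omega) 3)
  exact Nat.lt_two_pow_self.le.trans (Nat.pow_le_pow_left (by omega) K)

/-! ### From the language back to the machine -/

/-- The data of the start configuration. -/
noncomputable def startStore {d n : ℕ} (p : Fin n → Pt d) (δ : ℝ) : Store where
  nreg := ((startConfig (.instr (.natConst 0 0)) 1 p δ).proc 0).nreg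
  rreg := fun _ => 0
  nmem := fun _ => 0
  rmem := (startConfig (.instr (.natConst 0 0)) 1 p δ).mem.real

theorem startConfig_eq {d n : ℕ} (prog : Prog) (p : Fin n → Pt d) (δ : ℝ) :
    startConfig prog 1 p δ = (startStore p δ).config [prog] := by
  simp [startConfig, startStore, Store.config]

theorem inputMem_startStore {d n : ℕ} (p : Fin n → Pt d) (δ : ℝ) :
    InputMem p δ (startStore p δ).state where
  n_eq := rfl
  coord i hi c := by
    have h1 := mul_add_lt_mul hi c
    have h2 : (i * d + c) / d = i := by
      rw [Nat.mul_comm, Nat.mul_add_div (by have := c.2; omega), Nat.div_eq_of_lt c.2, add_zero]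
    have h3 : (i * d + c) % d = c := by
      rw [Nat.mul_comm, Nat.mul_add_mod, Nat.mod_eq_of_lt c.2]
    simp [startStore, startConfig, Store.state, coord, vertex, h1, h2, h3, hi]
  width := by simp [startStore, startConfig, Store.state]

/-- The run is taken with empty continuation, so its final configuration is halted; it makes no
access and is therefore good as well. -/
theorem solves_of_wp {d n M W T : ℕ} {c : Cmd} {p : Fin n → Pt d} {δ : ℝ} (hM : n * d + 1 ≤ M)
    (hW : n ≤ W) (h : c.WP M W T (fun s => OutputCorrect p δ ⟨s.nm, s.rm⟩) (startStore p δ).state) :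
    ∃ t ≤ T, Solves c.code 1 p δ t M W := by
  have hb : (startStore p δ).Bounded W := by
    refine ⟨fun r => ?_, fun x => Nat.zero_le W⟩
    simp only [startStore, startConfig]
    split_ifs <;> simp [hW]
  obtain ⟨σ, t, ht, hσ, hexec, hQ⟩ := h _ hb rfl
  obtain ⟨h1, h2⟩ := hexec []
  refine ⟨t, ht, ?_⟩
  unfold Solves
  rw [startConfig_eq, h1]
  refine ⟨fun i => rfl, hQ, hM, fun u hu => ?_⟩
  rcases hu.lt_or_eq with hlt | rfl
  · exact h2 u hlt
  · rw [h1]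
    exact good_config hσ fun c K' h => by cases h

/-- The sequential program runs in cubic time and cubic space. This is within the bounds for one
processor and, as `log (n + 1) ≤ n`, also within those for parallel machines. -/
theorem exists_solves (d : ℕ) : ∃ K L c, ∀ n, 1 ≤ n → ∀ (p : Fin n → Pt d) (δ : ℝ), 0 < δ →
    ∃ T M, Solves (program d).code 1 p δ T M ((n + 1) ^ c) ∧ T ≤ K * n ^ 3 ∧
      2 * M + 1 ≤ L * n ^ 3 := by
  obtain ⟨K, hK⟩ := polyBounded_programTime d
  obtain ⟨L, hL⟩ := polyBounded_space d
  obtain ⟨c, hc⟩ := exists_wordBound_le d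
  refine ⟨K, L, c, fun n hn p δ hδ => ?_⟩
  obtain ⟨T, hT, h⟩ := solves_of_wp (M := space d n) (W := (n + 1) ^ c) (by unfold space; omega)
    (le_trans (by unfold wordBound; omega) (hc n hn))
    (program_wp le_rfl (hc n hn) hδ.le hn (inputMem_startStore p δ) rfl)
  exact ⟨T, _, h, hT.trans (hK n hn), hL n hn⟩

theorem pow_three_le_div_log {n : ℕ} (hn : 1 ≤ n) :
    (n : ℝ) ^ 3 ≤ (n : ℝ) ^ 4 / Real.log ((n : ℝ) + 1) := by
  have hn' : (1 : ℝ) ≤ n := by exact_mod_cast hn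
  have h1 : 0 < Real.log ((n : ℝ) + 1) := Real.log_pos (by linarith)
  have h2 : Real.log ((n : ℝ) + 1) ≤ n := by
    have := Real.log_le_sub_one_of_pos (show (0 : ℝ) < n + 1 by linarith)
    linarith
  rw [le_div_iff₀ h1, pow_succ _ 3]
  exact mul_le_mul_of_nonneg_left h2 (by positivity)

end CurveSimp

theorem mainTheorem1 (d : ℕ) :
    (∃ (prog : RealPRAM.Prog) (C c : ℕ),
      ∀ n : ℕ, 1 ≤ n → ∀ (p : Fin n → CurveSimp.Pt d) (δ : ℝ), 0 < δ →
        ∃ T M : ℕ, CurveSimp.Solves prog 1 p δ T M ((n + 1) ^ c) ∧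
          T ≤ C * n ^ 4 ∧ 2 * M + 1 ≤ C * n ^ 3) ∧
    (∃ (prog : RealPRAM.Prog) (procs : ℕ → ℕ) (C c : ℕ),
      ∀ n : ℕ, 1 ≤ n → 1 ≤ procs n ∧
        ∀ (p : Fin n → CurveSimp.Pt d) (δ : ℝ), 0 < δ →
          ∃ T M : ℕ, CurveSimp.Solves prog (procs n) p δ T M ((n + 1) ^ c) ∧
            T ≤ C * n ^ 3 ∧
            (2 * M + procs n : ℝ) ≤ C * ((n : ℝ) ^ 4 / Real.log ((n : ℝ) + 1))) := by
  -- The same program serves both parts, the second one with the constant processor count `1`; `K +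
  -- L` dominates the time and the space constant.
  obtain ⟨K, L, c, h⟩ := CurveSimp.exists_solves d
  refine ⟨⟨(CurveSimp.program d).code, K + L, c, fun n hn p δ hδ => ?_⟩, ⟨(CurveSimp.program d).code, fun _ => 1, K + L, c,
    fun n hn => ⟨le_rfl, fun p δ hδ => ?_⟩⟩⟩
  · obtain ⟨T, M, h1, h2, h3⟩ := h n hn p δ hδ
    refine ⟨T, M, h1, h2.trans ?_, h3.trans ?_⟩
    · exact Nat.mul_le_mul (by omega) (Nat.pow_le_pow_right hn (by omega))
    · exact Nat.mul_le_mul_right _ (by omega)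
  · obtain ⟨T, M, h1, h2, h3⟩ := h n hn p δ hδ
    refine ⟨T, M, h1, h2.trans (Nat.mul_le_mul_right _ (by omega)), ?_⟩
    have h3' : (2 * M + 1 : ℝ) ≤ L * (n : ℝ) ^ 3 := by exact_mod_cast h3
    have h4 := CurveSimp.pow_three_le_div_log hn
    push_cast
    calc (2 * M + 1 : ℝ) ≤ L * (n : ℝ) ^ 3 := h3'
      _ ≤ (K + L) * (n : ℝ) ^ 3 := by gcongr; simp
      _ ≤ _ := by gcongr
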